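/- Let $k$ be an algebraically closed field of characteristic $0$, let $S=k[x_1,\dots,x_N]$ be a standard graded polynomial ring, and let $X$ be a $2\times e$ matrix whose entries are linear forms of $S$ (homogeneous of degree $1$, possibly zero). Let $I_2(X)$ be the ideal generated by the $2\times 2$ minors of $X$, and let $R=S/I_2(X)$ with the induced grading. The algebra $R$ is called Koszul if $k=R/R_{+}$ has a linear resolution over $R$, that is, a graded free resolution $\cdots\to R(-2)^{b_2}\to R(-1)^{b_1}\to R\to k\to 0$ with all $b_i$ finite. A Kronecker–Weierstrass normal form of $X$ is a matrix $PXC$ with $P\in \mathrm{GL}_2(k)$, $C\in\mathrm{GL}_e(k)$ which is, up to the order of the columns, a concatenation of blocks of the following three types, where the linear forms $x_{i,\cdot},y_{j,\cdot},z_{l,\cdot}$ occurring in all the blocks are together linearly independent over $k$: - nilpotent blocks of length $m_i\ge 1$: $\begin{pmatrix}0&x_{i,1}&\cdots&x_{i,m_i-2}&x_{i,m_i-1}\\ x_{i,1}&x_{i,2}&\cdots&x_{i,m_i-1}&0\end{pmatrix}$ (a zero column if $m_i=1$); - scroll blocks of length $n_j\ge 1$: $\begin{pmatrix}y_{j,1}&y_{j,2}&\cdots&y_{j,n_j}\\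 y_{j,2}&y_{j,3}&\cdots&y_{j,n_j+1}\end{pmatrix}$; - Jordan blocks of length $p_l\ge 1$ with eigenvalue $\lambda_l\in k$: $\begin{pmatrix}z_{l,1}&\cdots&z_{l,p_l-1}&z_{l,p_l}\\ z_{l,2}+\lambda_l z_{l,1}&\cdots&z_{l,p_l}+\lambda_l z_{l,p_l-1}&\lambda_l z_{l,p_l}\end{pmatrix}$. Then $X$ has a Kronecker–Weierstrass normal form, and for every Kronecker–Weierstrass normal form of $X$ the following holds: $R$ is Koszul if and only if $m\le 2n$, where $m$ is the length of the longest nilpotent block and $n$ is the length of the shortest scroll block in this normal form. (The condition $m\le 2n$ is regarded as satisfied if there is no nilpotent block or no scroll block.) -/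

import Mathlib

open MvPolynomial

noncomputable section

/-! ### Koszul algebras -/

/-- The ideal `R₊` generated by the homogeneous elements of positive degree. When `R` is a standard
graded `k`-algebra, `R₊` is the graded maximal ideal and `R ⧸ R₊` is the residue field `k`. -/
def gradedMaximalIdeal {k R : Type*} [CommSemiring k] [CommRing R] [Algebra k R]
    (𝒜 : ℕ → Submodule k R) : Ideal R :=
  Ideal.span (⋃ i ∈ Set.Ioi (0 : ℕ), (𝒜 i : Set R))

/-- A linear resolution of `R ⧸ R₊`: a free resolution
`⋯ → R(-2)^{b₂} → R(-1)^{b₁} → R → R ⧸ R₊ → 0` with `b₀ = 1` and all `bᵢ` finite, in which the map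
`R(-i-1)^{bᵢ₊₁} → R(-i)^{bᵢ}` is given by a matrix whose entries are homogeneous of degree one. -/
structure LinearResolution {k R : Type*} [CommSemiring k] [CommRing R] [Algebra k R]
    (𝒜 : ℕ → Submodule k R) where
  /-- The ranks `bᵢ` of the free modules. -/
  rank : ℕ → ℕ
  rank_zero : rank 0 = 1
  /-- The matrix of the differential `R^{bᵢ₊₁} → R^{bᵢ}`. -/
  d : (i : ℕ) → Matrix (Fin (rank i)) (Fin (rank (i + 1))) R
  linear : ∀ i r s, d i r s ∈ 𝒜 1
  /-- Exactness at `R^{b₀} = R`: the image of the first differential is the kernel `R₊` of the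
  projection `R → R ⧸ R₊`. -/
  exact_zero : LinearMap.range (d 0).mulVecLin =
    Submodule.pi Set.univ (fun _ : Fin (rank 0) => gradedMaximalIdeal 𝒜)
  /-- Exactness at `R^{bᵢ₊₁}`. -/
  exact_succ : ∀ i, Function.Exact (d (i + 1)).mulVecLin (d i).mulVecLin

/-- The standard graded `k`-algebra `R = ⨁ 𝒜ᵢ` is Koszul: its residue field `k = R ⧸ R₊` has a
linear resolution over `R`. -/
def IsKoszulAlgebra {k R : Type*} [CommSemiring k] [CommRing R] [Algebra k R]
    (𝒜 : ℕ → Submodule k R) : Prop :=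
  Nonempty (LinearResolution 𝒜)

/-! ### Determinantal rings of `2 × e` matrices -/

/-- The ideal `I₂(X)` generated by the `2 × 2` minors of a `2 × e` matrix. -/
def idealOfMinors {S : Type*} [CommRing S] {e : ℕ} (X : Matrix (Fin 2) (Fin e) S) : Ideal S :=
  Ideal.span (Set.range fun c : Fin 2 → Fin e => (X.submatrix id c).det)

/-- The determinantal ring `k[x₁, …, x_N] ⧸ I₂(X)`. -/
abbrev DeterminantalRing {k : Type*} [Field k] {N e : ℕ}
    (X : Matrix (Fin 2) (Fin e) (MvPolynomial (Fin N) k)) : Type _ :=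
  MvPolynomial (Fin N) k ⧸ idealOfMinors X

/-- The grading of the determinantal ring induced by the standard grading of the polynomial ring. -/
def determinantalGrading {k : Type*} [Field k] {N e : ℕ}
    (X : Matrix (Fin 2) (Fin e) (MvPolynomial (Fin N) k)) (i : ℕ) :
    Submodule k (DeterminantalRing X) :=
  (homogeneousSubmodule (Fin N) k i).map (Ideal.Quotient.mkₐ k (idealOfMinors X)).toLinearMap

/-! ### Kronecker–Weierstrass normal forms -/

/-- The types of blocks in a Kronecker–Weierstrass normal form: nilpotent blocks and scroll blocks
of a given length, Jordan blocks of a given length and eigenvalue. -/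
inductive KWBlock (k : Type*) where
  | nilpotent (m : ℕ)
  | scroll (n : ℕ)
  | jordan (p : ℕ) (eigenvalue : k)

namespace KWBlock

variable {k : Type*}

/-- The length of a block, which is its number of columns. -/
def length : KWBlock k → ℕ
  | nilpotent m => m
  | scroll n => n
  | jordan p _ => p

/-- The number of independent linear forms in a block (of positive length). -/
def numForms : KWBlock k → ℕ
  | nilpotent m => m - 1
  | scroll n => n + 1
  | jordan p _ => p

/-- Extension of a finite sequence `w₀, …, w_{r-1}` by zero. -/
def extendZero {S : Type*} [Zero S] {r : ℕ} (w : Fin r → S) (j : ℕ) : S :=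
  if h : j < r then w ⟨j, h⟩ else 0

/-- The `2 × length` matrix of a block in the linear forms `w₀, w₁, …`, namely
* nilpotent block of length `m`: first row `0, w₀, …, w_{m-2}`, second row `w₀, …, w_{m-2}, 0`;
* scroll block of length `n`: first row `w₀, …, w_{n-1}`, second row `w₁, …, w_n`;
* Jordan block of length `p` and eigenvalue `a`: first row `w₀, …, w_{p-1}`, second row
  `w₁ + a w₀, …, w_{p-1} + a w_{p-2}, a w_{p-1}`. -/
def matrix {S : Type*} [CommRing S] [SMul k S] :
    (B : KWBlock k) → (Fin B.numForms → S) → Matrix (Fin 2) (Fin B.length) S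
  | nilpotent _, w => Matrix.of
      ![fun j => if (j : ℕ) = 0 then 0 else extendZero w ((j : ℕ) - 1),
        fun j => extendZero w j]
  | scroll _, w => Matrix.of
      ![fun j => extendZero w j,
        fun j => extendZero w (j + 1)]
  | jordan _ a, w => Matrix.of
      ![fun j => extendZero w j,
        fun j => extendZero w (j + 1) + a • extendZero w j]

end KWBlock

/-- A Kronecker–Weierstrass normal form of a `2 × e` matrix `X` of linear forms: a matrix
`rowChange * X * colChange` with `rowChange ∈ GL₂(k)` and `colChange ∈ GL_e(k)` which is a
concatenation of nilpotent, scroll and Jordan blocks of positive length, the linear forms in all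
these blocks together being linearly independent over `k`. -/
structure KWNormalForm {k : Type*} [Field k] {N e : ℕ}
    (X : Matrix (Fin 2) (Fin e) (MvPolynomial (Fin N) k)) where
  /-- The number of blocks. -/
  numBlocks : ℕ
  /-- The blocks. -/
  block : Fin numBlocks → KWBlock k
  length_pos : ∀ i, 0 < (block i).length
  /-- The linear forms which are the entries of the blocks. -/
  form : (i : Fin numBlocks) → Fin (block i).numForms → MvPolynomial (Fin N) k
  form_linear : ∀ i j, (form i j).IsHomogeneous 1
  form_independent :
    LinearIndependent k (fun a : Σ i, Fin (block i).numForms => form a.1 a.2)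
  /-- The block and the position in it to which each column belongs. -/
  column : Fin e ≃ Σ i, Fin (block i).length
  /-- The change of rows. -/
  rowChange : GL (Fin 2) k
  /-- The change of columns. -/
  colChange : GL (Fin e) k
  eq_concatenation :
    (rowChange : Matrix (Fin 2) (Fin 2) k).map (C : k →+* MvPolynomial (Fin N) k) * X *
      (colChange : Matrix (Fin e) (Fin e) k).map (C : k →+* MvPolynomial (Fin N) k) =
    Matrix.of fun r j => (block (column j).1).matrix (form (column j).1) r (column j).2

namespace KWNormalForm

variable {k : Type*} [Field k] {N e : ℕ} {X : Matrix (Fin 2) (Fin e) (MvPolynomial (Fin N) k)}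

/-- The set of the lengths of the nilpotent blocks. -/
def nilpotentLengths (F : KWNormalForm X) : Set ℕ :=
  {m | ∃ i, F.block i = KWBlock.nilpotent m}

/-- The set of the lengths of the scroll blocks. -/
def scrollLengths (F : KWNormalForm X) : Set ℕ :=
  {n | ∃ i, F.block i = KWBlock.scroll n}

/-- The length condition `m ≤ 2n`, where `m` is the length of the longest nilpotent block and `n`
is the length of the shortest scroll block. It holds if there is no nilpotent block or no scroll
block. -/
def LengthCondition (F : KWNormalForm X) : Prop :=
  ∀ m n : ℕ, IsGreatest F.nilpotentLengths m → IsLeast F.scrollLengths n → m ≤ 2 * n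

end KWNormalForm

end

-- Sufficiency. In normal form, `R` is generated by the entries `x`, `y`, `z` of the nilpotent,
-- scroll and Jordan blocks and by free variables `u`, subject only to the minors
-- (`KWPresentation`). The minors give `x * x = 0` and `x * z = 0`. They also make `y_a * x_i`, for
-- fixed blocks of lengths `n` and `m`, depend only on `a + i` and vanish unless `n < a + i < m`.
-- Modulo `u`, `x`, `z` the ring is toric: a monomial in the scroll entries depends only on its
-- total index and its multiset of blocks. Koszulness follows from a Koszul filtration: a family of
-- ideals containing the maximal ideal, each reached from `0` by adding linear forms one at a time
-- so that all colon ideals stay in the family (`isKoszulAlgebra_of_idealFlag`). The family is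
-- `KoszulFamily`. Its colon ideals are found by mapping `R` to explicit rings, in which
-- annihilators are visible: `colonElement_u`, `colonElement_z`, `colonElement_x`,
-- `IsScrollCoord.colonElement_coord`. The length condition enters when a nilpotent block is added,
-- beginning with its middle entry `x_{i₀}`. The colon ideal by this entry is generated by linear
-- forms if `i₀` and `m - i₀` are at most the length of every scroll block, and `m ≤ 2 * n` allows
-- this.
--
-- Necessity. Suppose that `m > 2 * n` for a nilpotent and a scroll block. Let `β` restrict to the
-- curve `y_i ↦ s ^ (n - i) * t ^ i` on which all other coordinates vanish, and let `D` be the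
-- derivation along `β` that sends the entries `x_i` to basis vectors and the other coordinates to
-- `0`. Then `D` maps the ideal of minors into the image of an explicit map `theta`, whose kernel,
-- on the coordinates `1, …, m`, is generated by one vector of degree `m - 1`. Lifting three
-- differentials of a linear resolution to the polynomial ring, one attaches to each syzygy of the
-- second lifted matrix a pairing in `k[s, t]`. Exactness makes it a multiple of `t ^ (m - 1)` with
-- cofactor in an ideal generated by forms of degree `n` (`exists_pairing_eq`). A telescoping syzygy
-- built from the relations `y_a * x_{i+1} = y_{a+1} * x_i` violates this
-- (`length_le_of_isKoszulAlgebra`).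
--
-- Existence of normal forms. The two rows are linear maps `a`, `b` from column vectors to linear
-- forms. After a row change `a` has maximal rank, which forces `b (ker a)` into the range of `a`.
-- Induction on the dimension removes `ker a`, then replaces the space by `b⁻¹ (range a)`, until `b`
-- factors through `a` and the Jordan form applies (`nonempty_pencilDecomposition`). Dimension
-- counts carried along turn spanning families into bases.

universe v

/-! ### Koszul filtrations and linear resolutions -/

section KoszulFiltration

variable {k R : Type*} [Field k] [CommRing R] [Algebra k R]

/-- The ideal of all `r` with `r • v ∈ N`. -/
def colonElement {M : Type*} [AddCommGroup M] [Module R M] (N : Submodule R M) (v : M) : Ideal R :=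
  N.comap (LinearMap.toSpanSingleton R M v)

lemma mem_colonElement {M : Type*} [AddCommGroup M] [Module R M] {N : Submodule R M} {v : M}
    {r : R} : r ∈ colonElement N v ↔ r • v ∈ N := by
  simp [colonElement]

/-- Ideals obtained from `0` by successively adding elements of `L` in such a way that all the
colon ideals which occur belong to `F`. -/
inductive IdealFlag (F : Set (Ideal R)) (L : Submodule k R) : Ideal R → Prop
  | bot : IdealFlag F L ⊥
  | step (J : Ideal R) (h : R) : IdealFlag F L J → h ∈ L → colonElement J h ∈ F →
      IdealFlag F L (J ⊔ Ideal.span {h})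

/-- Families of vectors such that the colon ideals of the submodules spanned by the initial
subfamilies by the next vectors belong to `F`. -/
inductive VectorFlag (F : Set (Ideal R)) {M : Type*} [AddCommGroup M] [Module R M] :
    (s : ℕ) → (Fin s → M) → Prop
  | nil (g : Fin 0 → M) : VectorFlag F 0 g
  | snoc (s : ℕ) (g : Fin s → M) (v : M) : VectorFlag F s g →
      colonElement (Submodule.span R (Set.range g)) v ∈ F →
      VectorFlag F (s + 1) (Fin.snoc g v : Fin (s + 1) → M)

lemma span_range_snoc {M : Type*} [AddCommGroup M] [Module R M] {s : ℕ} (g : Fin s → M) (v : M) :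
    Submodule.span R (Set.range (Fin.snoc g v : Fin (s + 1) → M)) =
      Submodule.span R (Set.range g) ⊔ Submodule.span R {v} := by
  rw [Fin.range_snoc, Submodule.span_insert, sup_comm]

lemma VectorFlag.map {F : Set (Ideal R)} {M M' : Type*} [AddCommGroup M] [Module R M]
    [AddCommGroup M'] [Module R M'] (f : M →ₗ[R] M') (hf : Function.Injective f) {s : ℕ}
    {g : Fin s → M} (h : VectorFlag F s g) : VectorFlag F s (f ∘ g) := by
  induction h with
  | nil g => exact VectorFlag.nil _
  | snoc s g v _ hv ih =>
    rw [Fin.comp_snoc]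
    refine VectorFlag.snoc s _ _ ih ?_
    convert hv using 1
    ext r
    rw [mem_colonElement, mem_colonElement, Set.range_comp, ← Submodule.map_span, ← map_smul]
    exact ⟨fun ⟨y, hy, hyr⟩ => hf hyr ▸ hy, fun h => ⟨_, h, rfl⟩⟩

/-- Whenever a linear multiple of a vector of linear forms is a combination of vectors of linear
forms, the coefficients may be chosen to be linear. -/
def HasLinearLifts (L : Submodule k R) : Prop :=
  ∀ (b s : ℕ) (g : Fin s → Fin b → R) (v : Fin b → R) (l : R), (∀ i r, g i r ∈ L) →
    (∀ r, v r ∈ L) → l ∈ L → l • v ∈ Submodule.span R (Set.range g) →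
    ∃ a : Fin s → R, (∀ i, a i ∈ L) ∧ l • v = ∑ i, a i • g i

/-- Extension of vectors by a last coordinate zero. -/
def snocZero (R : Type*) [CommRing R] (s : ℕ) : (Fin s → R) →ₗ[R] (Fin (s + 1) → R) where
  toFun w := Fin.snoc w 0
  map_add' w w' := by
    ext i
    refine Fin.lastCases ?_ (fun j => ?_) i <;> simp
  map_smul' r w := by
    ext i
    refine Fin.lastCases ?_ (fun j => ?_) i <;> simp

lemma snocZero_injective (s : ℕ) : Function.Injective (snocZero R s) := by
  intro w w' h
  ext i
  simpa [snocZero] using congrFun h i.castSucc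

/-- The last coordinates of the syzygies of `(g, v)` form the colon ideal of `span g` by `v`, and
the syzygies with last coordinate `0` are those of `g`. Hence a flag of the colon ideal, lifted
generator by generator to linear syzygies, prolongs a flagged family of syzygies of `g`. The result
is flagged again, so the construction can be iterated. -/
lemma VectorFlag.exists_syzygies {F : Set (Ideal R)} {L : Submodule k R} (hL : HasLinearLifts L)
    (hF : ∀ I ∈ F, IdealFlag F L I) {b s : ℕ} {g : Fin s → Fin b → R} (h : VectorFlag F s g)
    (hg : ∀ i r, g i r ∈ L) :
    ∃ (t : ℕ) (w : Fin t → Fin s → R), VectorFlag F t w ∧ (∀ i r, w i r ∈ L) ∧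
      Submodule.span R (Set.range w) = LinearMap.ker (Fintype.linearCombination R g) := by
  induction h with
  | nil g =>
    refine ⟨0, Fin.elim0, VectorFlag.nil _, fun i => i.elim0, ?_⟩
    ext x
    rw [Subsingleton.elim x 0]
    exact iff_of_true (zero_mem _) (zero_mem _)
  | snoc s g v hgf hv ih =>
    obtain ⟨t, w, hwf, hwL, hws⟩ := ih fun i r => by simpa using hg i.castSucc r
    have hgL : ∀ i r, g i r ∈ L := fun i r => by simpa using hg i.castSucc r
    have hvL : ∀ r, v r ∈ L := fun r => by simpa using hg (Fin.last s) r
    -- Induction along the flag of the colon ideal: generate the syzygies whose last coordinate lies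
    -- in the part `J` reached so far.
    have key : ∀ J : Ideal R, IdealFlag F L J →
        J ≤ colonElement (Submodule.span R (Set.range g)) v →
        ∃ (t : ℕ) (w : Fin t → Fin (s + 1) → R), VectorFlag F t w ∧ (∀ i r, w i r ∈ L) ∧
          ∀ x, x ∈ Submodule.span R (Set.range w) ↔
            Fintype.linearCombination R (Fin.snoc g v : Fin (s + 1) → Fin b → R) x = 0 ∧
              x (Fin.last s) ∈ J := by
      intro J hJ
      induction hJ with
      | bot =>
        intro _
        refine ⟨t, snocZero R s ∘ w, hwf.map _ (snocZero_injective s), fun i r => ?_, fun x => ?_⟩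
        · refine Fin.lastCases ?_ (fun j => ?_) r
          · simp [snocZero]
          · simpa [snocZero] using hwL i j
        · rw [Set.range_comp, ← Submodule.map_span, hws]
          constructor
          · rintro ⟨y, hy, rfl⟩
            have hy' : ∑ i, y i • g i = 0 := by
              simpa [Fintype.linearCombination_apply] using hy
            simp [Fintype.linearCombination_apply, Fin.sum_univ_castSucc, snocZero, hy']
          · rintro ⟨h1, h2⟩
            rw [Ideal.mem_bot] at h2
            refine ⟨fun i => x i.castSucc, ?_, ?_⟩
            · simpa [Fintype.linearCombination_apply, Fin.sum_univ_castSucc, h2] using h1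
            · ext i
              refine Fin.lastCases ?_ (fun j => ?_) i
              · simp [snocZero, h2]
              · simp [snocZero]
      | step J l hJ hl hc ihJ =>
        intro hle
        obtain ⟨t', w', hwf', hwL', hws'⟩ := ihJ (le_sup_left.trans hle)
        have hlv : l • v ∈ Submodule.span R (Set.range g) :=
          mem_colonElement.1 (hle (le_sup_right (a := J) (Ideal.mem_span_singleton_self l)))
        obtain ⟨a, haL, ha⟩ := hL b s g v l hgL hvL hl hlv
        -- A syzygy with last coordinate `l`; `HasLinearLifts` makes its other coordinates linear.
        set x₀ : Fin (s + 1) → R := Fin.snoc (fun i => -a i) l with hx₀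
        have hx₀k : Fintype.linearCombination R
            (Fin.snoc g v : Fin (s + 1) → Fin b → R) x₀ = 0 := by
          simp [Fintype.linearCombination_apply, Fin.sum_univ_castSucc, hx₀, ha]
        have hx₀l : x₀ (Fin.last s) = l := by simp [hx₀]
        refine ⟨t' + 1, Fin.snoc w' x₀, VectorFlag.snoc _ _ _ hwf' ?_, fun i r => ?_, fun x => ?_⟩
        -- `r • x₀` is already spanned exactly when its last coordinate `r * l` lies in `J`, so this
        -- colon ideal is that of `J` by `l`.
        · convert hc using 1
          ext r
          simp [mem_colonElement, hws', map_smul, hx₀k, hx₀l]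
        · refine Fin.lastCases ?_ (fun j => ?_) i
          · refine Fin.lastCases ?_ (fun j => ?_) r
            · simpa [hx₀] using hl
            · simpa [hx₀] using L.neg_mem (haL j)
          · simpa using hwL' j r
        · rw [span_range_snoc, Submodule.mem_sup]
          constructor
          · rintro ⟨y, hy, z, hz, rfl⟩
            obtain ⟨r, rfl⟩ := Submodule.mem_span_singleton.1 hz
            obtain ⟨h1, h2⟩ := (hws' y).1 hy
            refine ⟨by rw [map_add, map_smul, h1, hx₀k]; simp, ?_⟩
            rw [Pi.add_apply, Pi.smul_apply, hx₀l]
            exact Submodule.add_mem_sup h2 (Ideal.mul_mem_left _ _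
              (Ideal.mem_span_singleton_self l))
          · rintro ⟨h1, h2⟩
            obtain ⟨j, hj, z, hz, hjz⟩ := Submodule.mem_sup.1 h2
            obtain ⟨r, rfl⟩ := Ideal.mem_span_singleton'.1 hz
            refine ⟨x - r • x₀, (hws' _).2 ⟨?_, ?_⟩, r • x₀,
              Submodule.smul_mem _ _ (Submodule.mem_span_singleton_self _), by simp⟩
            · rw [map_sub, map_smul, h1, hx₀k]; simp
            · rw [Pi.sub_apply, Pi.smul_apply, hx₀l, ← hjz]
              simpa using hj
    obtain ⟨t', w', h1, h2, h3⟩ := key _ (hF _ hv) le_rfl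
    refine ⟨t', w', h1, h2, ?_⟩
    ext x
    rw [h3, LinearMap.mem_ker, and_iff_left_iff_imp, mem_colonElement]
    intro hx
    have : x (Fin.last s) • v = -∑ i : Fin s, x i.castSucc • g i := by
      rw [eq_neg_iff_add_eq_zero, add_comm]
      simpa [Fintype.linearCombination_apply, Fin.sum_univ_castSucc] using hx
    rw [this]
    exact neg_mem (Submodule.sum_mem _ fun i _ => Submodule.smul_mem _ _
      (Submodule.subset_span ⟨i, rfl⟩))

lemma IdealFlag.exists_vectorFlag {F : Set (Ideal R)} {L : Submodule k R} {I : Ideal R}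
    (h : IdealFlag F L I) :
    ∃ (s : ℕ) (g : Fin s → Fin 1 → R), VectorFlag F s g ∧ (∀ i r, g i r ∈ L) ∧
      ∀ x, x ∈ Submodule.span R (Set.range g) ↔ x 0 ∈ I := by
  induction h with
  | bot =>
    refine ⟨0, Fin.elim0, VectorFlag.nil _, fun i => i.elim0, fun x => ?_⟩
    simp only [Set.range_eq_empty, Submodule.span_empty, Submodule.mem_bot]
    constructor
    · rintro rfl; rfl
    · intro h
      ext i
      rw [Subsingleton.elim i 0, h, Pi.zero_apply]
  | step J l hJ hl hc ih =>
    obtain ⟨s, g, hg, hgL, hgs⟩ := ih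
    refine ⟨s + 1, Fin.snoc g fun _ => l, VectorFlag.snoc _ _ _ hg ?_, fun i r => ?_, fun x => ?_⟩
    · convert hc using 1
      ext r
      simp [mem_colonElement, hgs]
    · refine Fin.lastCases ?_ (fun j => ?_) i
      · simpa using hl
      · simpa using hgL j r
    · rw [span_range_snoc, Submodule.mem_sup]
      constructor
      · rintro ⟨y, hy, z, hz, rfl⟩
        obtain ⟨r, rfl⟩ := Submodule.mem_span_singleton.1 hz
        exact Submodule.add_mem_sup ((hgs y).1 hy) (Ideal.mul_mem_left _ _
          (Ideal.mem_span_singleton_self l))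
      · intro h
        obtain ⟨j, hj, z, hz, hjz⟩ := Submodule.mem_sup.1 h
        obtain ⟨r, rfl⟩ := Ideal.mem_span_singleton'.1 hz
        refine ⟨fun _ => j, (hgs _).2 hj, r • fun _ => l,
          Submodule.smul_mem _ _ (Submodule.mem_span_singleton_self _), ?_⟩
        ext i
        rw [Subsingleton.elim i 0, ← hjz]
        rfl

/-- A matrix with linear entries whose columns form a flagged family. -/
structure FlaggedMatrix (F : Set (Ideal R)) (L : Submodule k R) (b : ℕ) where
  /-- The number of columns. -/
  cols : ℕ
  /-- The columns. -/
  col : Fin cols → Fin b → R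
  flag : VectorFlag F cols col
  linear : ∀ i r, col i r ∈ L

/-- The flagged matrix of the syzygies of the columns of a flagged matrix. -/
noncomputable def FlaggedMatrix.next {F : Set (Ideal R)} {L : Submodule k R}
    (hL : HasLinearLifts L) (hF : ∀ I ∈ F, IdealFlag F L I)
    (D : Σ b, FlaggedMatrix F L b) : Σ b, FlaggedMatrix F L b :=
  ⟨D.2.cols,
    { cols := (D.2.flag.exists_syzygies hL hF D.2.linear).choose
      col := (D.2.flag.exists_syzygies hL hF D.2.linear).choose_spec.choose
      flag := (D.2.flag.exists_syzygies hL hF D.2.linear).choose_spec.choose_spec.1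
      linear := (D.2.flag.exists_syzygies hL hF D.2.linear).choose_spec.choose_spec.2.1 }⟩

lemma FlaggedMatrix.next_span {F : Set (Ideal R)} {L : Submodule k R}
    (hL : HasLinearLifts L) (hF : ∀ I ∈ F, IdealFlag F L I)
    (D : Σ b, FlaggedMatrix F L b) :
    Submodule.span R (Set.range (FlaggedMatrix.next hL hF D).2.col) =
      LinearMap.ker (Fintype.linearCombination R D.2.col) :=
  (D.2.flag.exists_syzygies hL hF D.2.linear).choose_spec.choose_spec.2.2

lemma mulVecLin_of_transpose {b s : ℕ} (g : Fin s → Fin b → R) :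
    (Matrix.of fun r i => g i r : Matrix (Fin b) (Fin s) R).mulVecLin =
      Fintype.linearCombination R g := by
  refine LinearMap.ext fun x => ?_
  ext r
  simp [Matrix.mulVec, dotProduct, Fintype.linearCombination_apply, mul_comm]

lemma exact_mulVecLin_of_span {b s t : ℕ} (g : Fin s → Fin b → R) (w : Fin t → Fin s → R)
    (h : Submodule.span R (Set.range w) = LinearMap.ker (Fintype.linearCombination R g)) :
    Function.Exact (Matrix.of fun r i => w i r : Matrix (Fin s) (Fin t) R).mulVecLin
      (Matrix.of fun r i => g i r : Matrix (Fin b) (Fin s) R).mulVecLin := by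
  rw [LinearMap.exact_iff, mulVecLin_of_transpose, mulVecLin_of_transpose, ← h,
    Fintype.range_linearCombination]

/-- An algebra with a Koszul filtration is Koszul. -/
theorem isKoszulAlgebra_of_idealFlag {𝒜 : ℕ → Submodule k R} {F : Set (Ideal R)}
    (hL : HasLinearLifts (𝒜 1)) (hF : ∀ I ∈ F, IdealFlag F (𝒜 1) I)
    (hm : gradedMaximalIdeal 𝒜 ∈ F) : IsKoszulAlgebra 𝒜 := by
  obtain ⟨s, g, hg, hgL, hgs⟩ := (hF _ hm).exists_vectorFlag
  -- Begin with a flagged row generating the maximal ideal and pass to syzygies again and again.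
  let σ : ℕ → Σ b, FlaggedMatrix F (𝒜 1) b := fun n => Nat.rec
    (⟨1, ⟨s, g, hg, hgL⟩⟩ : Σ b, FlaggedMatrix F (𝒜 1) b)
    (fun _ D => FlaggedMatrix.next hL hF D) n
  refine ⟨{ rank := fun i => (σ i).1
            rank_zero := rfl
            d := fun i => Matrix.of fun r c => (σ i).2.col c r
            linear := fun i r c => (σ i).2.linear c r
            exact_zero := ?_
            exact_succ := fun i => ?_ }⟩
  · have h : LinearMap.range (Matrix.of fun r i => g i r : Matrix (Fin 1) (Fin s) R).mulVecLin =
        Submodule.pi Set.univ (fun _ : Fin 1 => gradedMaximalIdeal 𝒜) := by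
      rw [mulVecLin_of_transpose, Fintype.range_linearCombination]
      ext x
      rw [hgs]
      simp
    exact h
  · exact exact_mulVecLin_of_span _ _ (FlaggedMatrix.next_span hL hF (σ i))

end KoszulFiltration

/-! ### The grading of a determinantal ring -/

section Grading

variable {k : Type*} [Field k] {N e : ℕ}

attribute [local instance] MvPolynomial.gradedAlgebra

lemma homogeneousComponent_mul_of_isHomogeneous {σ : Type*} {j : ℕ} (f : MvPolynomial σ k)
    {g : MvPolynomial σ k} (hg : g.IsHomogeneous j) (d : ℕ) :
    homogeneousComponent (d + j) (f * g) = homogeneousComponent d f * g := by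
  rw [← decomposition.decompose'_apply, ← decomposition.decompose'_apply]
  exact DirectSum.coe_decompose_mul_add_of_right_mem (homogeneousSubmodule σ k) (i := d)
    (a := f) ((mem_homogeneousSubmodule j g).2 hg)

lemma homogeneousComponent_mul_of_isHomogeneous_of_lt {σ : Type*} {j : ℕ} (f : MvPolynomial σ k)
    {g : MvPolynomial σ k} (hg : g.IsHomogeneous j) {d : ℕ} (hd : d < j) :
    homogeneousComponent d (f * g) = 0 := by
  rw [← decomposition.decompose'_apply]
  exact DirectSum.coe_decompose_mul_of_right_mem_of_not_le (homogeneousSubmodule σ k) (n := d)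
    (a := f) ((mem_homogeneousSubmodule j g).2 hg) (not_le.2 hd)

variable {X : Matrix (Fin 2) (Fin e) (MvPolynomial (Fin N) k)}

lemma isHomogeneous_minor (hX : ∀ i j, (X i j).IsHomogeneous 1) (c : Fin 2 → Fin e) :
    ((X.submatrix id c).det).IsHomogeneous 2 := by
  rw [Matrix.det_fin_two]
  exact ((hX _ _).mul (hX _ _)).sub ((hX _ _).mul (hX _ _))

lemma homogeneousComponent_mem_idealOfMinors (hX : ∀ i j, (X i j).IsHomogeneous 1)
    {f : MvPolynomial (Fin N) k} (hf : f ∈ idealOfMinors X) (d : ℕ) :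
    homogeneousComponent d f ∈ idealOfMinors X := by
  have h : (idealOfMinors X).IsHomogeneous (homogeneousSubmodule (Fin N) k) := by
    refine Ideal.homogeneous_span _ _ ?_
    rintro _ ⟨c, rfl⟩
    exact ⟨2, isHomogeneous_minor hX c⟩
  exact homogeneousComponent_mem_of_mem h hf d

lemma exists_eq_sum_minors {f : MvPolynomial (Fin N) k} (hf : f ∈ idealOfMinors X) :
    ∃ a : (Fin 2 → Fin e) → MvPolynomial (Fin N) k, f = ∑ c, a c * (X.submatrix id c).det := by
  obtain ⟨a, ha⟩ := Ideal.mem_span_range_iff_exists_fun.1 hf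
  exact ⟨a, ha.symm⟩

lemma homogeneousComponent_eq_zero_of_mem_idealOfMinors (hX : ∀ i j, (X i j).IsHomogeneous 1)
    {f : MvPolynomial (Fin N) k} (hf : f ∈ idealOfMinors X) {d : ℕ} (hd : d < 2) :
    homogeneousComponent d f = 0 := by
  obtain ⟨a, rfl⟩ := exists_eq_sum_minors hf
  rw [map_sum]
  exact Finset.sum_eq_zero fun c _ =>
    homogeneousComponent_mul_of_isHomogeneous_of_lt _ (isHomogeneous_minor hX c) hd

lemma eq_zero_of_mem_idealOfMinors (hX : ∀ i j, (X i j).IsHomogeneous 1)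
    {f : MvPolynomial (Fin N) k} (hf : f ∈ idealOfMinors X) {d : ℕ} (hfd : f.IsHomogeneous d)
    (hd : d < 2) : f = 0 := by
  rw [← homogeneousComponent_eq_self hfd,
    homogeneousComponent_eq_zero_of_mem_idealOfMinors hX hf hd]

lemma exists_eq_sum_minors_of_isHomogeneous (hX : ∀ i j, (X i j).IsHomogeneous 1)
    {f : MvPolynomial (Fin N) k} (hf : f ∈ idealOfMinors X) (hf2 : f.IsHomogeneous 2) :
    ∃ a : (Fin 2 → Fin e) → k, f = ∑ c, C (a c) * (X.submatrix id c).det := by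
  obtain ⟨a, ha⟩ := exists_eq_sum_minors hf
  refine ⟨fun c => coeff 0 (a c), ?_⟩
  rw [← homogeneousComponent_eq_self hf2, ha, map_sum]
  refine Finset.sum_congr rfl fun c _ => ?_
  have h := homogeneousComponent_mul_of_isHomogeneous (a c) (isHomogeneous_minor hX c) 0
  rwa [zero_add, homogeneousComponent_zero] at h

lemma mem_determinantalGrading {i : ℕ} {r : DeterminantalRing X} :
    r ∈ determinantalGrading X i ↔
      ∃ f : MvPolynomial (Fin N) k, f.IsHomogeneous i ∧ Ideal.Quotient.mk _ f = r := by
  simp [determinantalGrading]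

/-- The ideal of minors is homogeneous, so the degree `2` part of a relation between linear forms is
again a relation, and it involves only the degree `1` parts of the coefficients. -/
lemma hasLinearLifts_determinantalGrading (hX : ∀ i j, (X i j).IsHomogeneous 1) :
    HasLinearLifts (determinantalGrading X 1) := by
  intro b s g v l hg hv hl hmem
  choose G hG hGg using fun i r => mem_determinantalGrading.1 (hg i r)
  choose V hV hVv using fun r => mem_determinantalGrading.1 (hv r)
  obtain ⟨l', hl', rfl⟩ := mem_determinantalGrading.1 hl
  obtain ⟨a, ha⟩ := (Submodule.mem_span_range_iff_exists_fun _).1 hmem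
  choose A hA using fun i => Ideal.Quotient.mk_surjective (a i)
  refine ⟨fun i => Ideal.Quotient.mk _ (homogeneousComponent 1 (A i)), fun i =>
    mem_determinantalGrading.2 ⟨_, homogeneousComponent_isHomogeneous _ _, rfl⟩, ?_⟩
  ext r
  have hr := congrFun ha r
  simp only [Finset.sum_apply, Pi.smul_apply, smul_eq_mul, ← hA, ← hGg, ← hVv, ← map_mul,
    ← map_sum] at hr ⊢
  rw [Ideal.Quotient.eq] at hr ⊢
  have h := homogeneousComponent_mem_idealOfMinors hX hr 2
  rw [map_sub, map_sum, homogeneousComponent_eq_self (hl'.mul (hV r))] at h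
  rw [← neg_mem_iff, neg_sub]
  convert h using 3 with i
  exact (homogeneousComponent_mul_of_isHomogeneous (A i) (hG i r) 1).symm

/-- The graded maximal ideal is generated by any set of linear forms which spans the space of all
linear forms. -/
lemma gradedMaximalIdeal_determinantalGrading {s : Set (DeterminantalRing X)}
    (hs : Submodule.span k s = determinantalGrading X 1) :
    gradedMaximalIdeal (determinantalGrading X) = Ideal.span s := by
  apply le_antisymm
  · refine Ideal.span_le.2 ?_
    intro r hr
    simp only [Set.mem_iUnion, Set.mem_Ioi] at hr
    obtain ⟨i, hi, hr⟩ := hr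
    obtain ⟨f, hf, rfl⟩ := mem_determinantalGrading.1 hr
    have hf' : f ∈ Ideal.span (Set.range (MvPolynomial.X : Fin N → MvPolynomial (Fin N) k)) := by
      rw [← Set.image_univ, MvPolynomial.mem_ideal_span_X_image]
      intro m hm
      have : m ≠ 0 := by
        rintro rfl
        have := hf (mem_support_iff.1 hm)
        simp at this
        omega
      obtain ⟨j, hj⟩ := Finsupp.ne_iff.1 this
      exact ⟨j, Set.mem_univ _, by simpa using hj⟩
    have h2 := Ideal.mem_map_of_mem (Ideal.Quotient.mk (idealOfMinors X)) hf'
    refine (Ideal.map_le_iff_le_comap.2 (Ideal.span_le.2 ?_)) h2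
    rintro _ ⟨j, rfl⟩
    have h3 : Ideal.Quotient.mk (idealOfMinors X) (MvPolynomial.X j) ∈ Submodule.span k s := by
      rw [hs]
      exact mem_determinantalGrading.2 ⟨_, isHomogeneous_X k j, rfl⟩
    have h4 : Submodule.span k s ≤ (Ideal.span s).restrictScalars k :=
      Submodule.span_le.2 Ideal.subset_span
    exact h4 h3
  · refine Ideal.span_le.2 fun r hr => Ideal.subset_span ?_
    simp only [Set.mem_iUnion, Set.mem_Ioi]
    exact ⟨1, one_pos, hs ▸ Submodule.subset_span hr⟩

end Grading

/-! ### Algebras presented by Kronecker–Weierstrass normal forms -/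

/-- The numerical data of a Kronecker–Weierstrass normal form: the lengths `m`, `n`, `p` of the
nilpotent blocks, the scroll blocks and the Jordan blocks, and the eigenvalues of the latter. -/
structure KWShape (k : Type*) where
  /-- The nilpotent blocks. -/
  Nil : Type
  /-- The scroll blocks. -/
  Scr : Type
  /-- The Jordan blocks. -/
  Jor : Type
  /-- The lengths of the nilpotent blocks. -/
  m : Nil → ℕ
  /-- The lengths of the scroll blocks. -/
  n : Scr → ℕ
  /-- The lengths of the Jordan blocks. -/
  p : Jor → ℕ
  /-- The eigenvalues of the Jordan blocks. -/
  ev : Jor → k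
  finite_nil : Finite Nil
  finite_scr : Finite Scr
  finite_jor : Finite Jor

attribute [instance] KWShape.finite_nil KWShape.finite_scr KWShape.finite_jor

section Columns

variable {k T : Type*} [Field k] [CommRing T] [Algebra k T]

/-- The columns of the matrix of a given shape with entries `x`, `y`, `z`. -/
inductive IsKWColumn (D : KWShape k) (x : D.Nil → ℕ → T) (y : D.Scr → ℕ → T)
    (z : D.Jor → ℕ → T) : T → T → Prop
  | nil (a : D.Nil) (i : ℕ) : i < D.m a → IsKWColumn D x y z (x a i) (x a (i + 1))
  | scr (j : D.Scr) (i : ℕ) : i < D.n j → IsKWColumn D x y z (y j i) (y j (i + 1))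
  | jor (l : D.Jor) (i : ℕ) : i < D.p l →
      IsKWColumn D x y z (z l i) (z l (i + 1) + D.ev l • z l i)

variable (T) in
/-- Elements of a `k`-algebra for which the `2 × 2` minors of the corresponding matrix in
Kronecker–Weierstrass normal form vanish. -/
structure KWSystem (D : KWShape k) where
  /-- The entries of the nilpotent blocks. -/
  x : D.Nil → ℕ → T
  /-- The entries of the scroll blocks. -/
  y : D.Scr → ℕ → T
  /-- The entries of the Jordan blocks. -/
  z : D.Jor → ℕ → T
  x_zero : ∀ a, x a 0 = 0
  x_top : ∀ a i, D.m a ≤ i → x a i = 0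
  z_top : ∀ l i, D.p l ≤ i → z l i = 0
  minor : ∀ a b a' b', IsKWColumn D x y z a b → IsKWColumn D x y z a' b' → a * b' = a' * b

/-- A system all of whose columns are multiples of a given column. -/
def KWSystem.ofRatio (D : KWShape k) (s t : T) (x : D.Nil → ℕ → T) (y : D.Scr → ℕ → T)
    (z : D.Jor → ℕ → T) (x_zero : ∀ a, x a 0 = 0) (x_top : ∀ a i, D.m a ≤ i → x a i = 0)
    (z_top : ∀ l i, D.p l ≤ i → z l i = 0)
    (ratio : ∀ a b, IsKWColumn D x y z a b → ∃ g, a = s * g ∧ b = t * g) : KWSystem T D where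
  x := x
  y := y
  z := z
  x_zero := x_zero
  x_top := x_top
  z_top := z_top
  minor a b a' b' h h' := by
    obtain ⟨g, rfl, rfl⟩ := ratio _ _ h
    obtain ⟨g', rfl, rfl⟩ := ratio _ _ h'
    ring

namespace KWSystem

variable {D : KWShape k} (E : KWSystem T D)

/-- Each minor moves one unit of index from one factor to the other, down to `x a 0 = 0`. -/
lemma x_mul_x (a a' : D.Nil) (i i' : ℕ) : E.x a i * E.x a' i' = 0 := by
  induction i generalizing i' with
  | zero => rw [E.x_zero, zero_mul]
  | succ i ih =>
    rcases le_or_gt (D.m a) i with h | h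
    · rw [E.x_top _ _ (h.trans i.le_succ), zero_mul]
    rcases le_or_gt (D.m a') i' with h' | h'
    · rw [E.x_top _ _ h', mul_zero]
    have := E.minor _ _ _ _ (.nil a i h) (.nil a' i' h')
    rw [mul_comm, ← this, ih]

lemma z_mul_x (l : D.Jor) (a : D.Nil) (i i' : ℕ) : E.z l i * E.x a i' = 0 := by
  induction i' generalizing i with
  | zero => rw [E.x_zero, mul_zero]
  | succ i' ih =>
    rcases le_or_gt (D.m a) i' with h | h
    · rw [E.x_top _ _ (h.trans i'.le_succ), mul_zero]
    rcases le_or_gt (D.p l) i with h' | h'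
    · rw [E.z_top _ _ h', zero_mul]
    have := E.minor _ _ _ _ (.nil a i' h) (.jor l i h')
    rw [← this, mul_add, mul_smul_comm, mul_comm, ih, mul_comm, ih, smul_zero, add_zero]

lemma z_mul_z (l l' : D.Jor) (i i' : ℕ) :
    E.z l i * (E.z l' (i' + 1) + D.ev l' • E.z l' i') =
      E.z l' i' * (E.z l (i + 1) + D.ev l • E.z l i) := by
  rcases le_or_gt (D.p l) i with h | h
  · rw [E.z_top _ _ h, E.z_top _ _ (h.trans i.le_succ)]; simp
  rcases le_or_gt (D.p l') i' with h' | h'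
  · rw [E.z_top _ _ h', E.z_top _ _ (h'.trans i'.le_succ)]; simp
  exact E.minor _ _ _ _ (.jor l i h) (.jor l' i' h')

lemma z_mul_z_of_ne {l l' : D.Jor} (h : D.ev l ≠ D.ev l') (i i' : ℕ) :
    E.z l i * E.z l' i' = 0 := by
  -- Descending induction on `i + i'`: once the products of larger total index vanish, the minor
  -- leaves the product times the nonzero difference of the eigenvalues.
  suffices H : ∀ c i i', D.p l + D.p l' ≤ i + i' + c → E.z l i * E.z l' i' = 0 from
    H (D.p l + D.p l') i i' (by omega)
  intro c
  induction c with
  | zero =>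
    intro i i' hc
    rcases le_or_gt (D.p l) i with h | h
    · rw [E.z_top _ _ h, zero_mul]
    · rw [E.z_top l' i' (by omega), mul_zero]
  | succ c ih =>
    intro i i' hc
    have h1 := E.z_mul_z l l' i i'
    rw [mul_add, mul_add, ih i (i' + 1) (by omega), mul_comm (E.z l' i') (E.z l (i + 1)),
      ih (i + 1) i' (by omega), zero_add, zero_add, mul_smul_comm, mul_smul_comm,
      mul_comm (E.z l' i'), ← sub_eq_zero, ← sub_smul] at h1
    have h2 := congrArg (fun r => (D.ev l' - D.ev l)⁻¹ • r) h1
    simpa [smul_smul, inv_mul_cancel₀ (sub_ne_zero.2 h.symm)] using h2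

lemma z_mul_z_succ {l l' : D.Jor} (h : D.ev l = D.ev l') (i i' : ℕ) :
    E.z l i * E.z l' (i' + 1) = E.z l (i + 1) * E.z l' i' := by
  have h1 := E.z_mul_z l l' i i'
  rw [h, mul_add, mul_add, mul_smul_comm, mul_smul_comm, mul_comm (E.z l' i') (E.z l i),
    add_left_inj] at h1
  rw [h1, mul_comm]

lemma z_mul_z_add {l l' : D.Jor} (h : D.ev l = D.ev l') (i i' c : ℕ) :
    E.z l i * E.z l' (i' + c) = E.z l (i + c) * E.z l' i' := by
  induction c generalizing i with
  | zero => rfl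
  | succ c ih => rw [← add_assoc, E.z_mul_z_succ h, ih, add_right_comm, add_assoc]

lemma y_succ_mul_z (j : D.Scr) (l : D.Jor) {a : ℕ} (ha : a < D.n j) (i : ℕ) :
    E.y j (a + 1) * E.z l i = E.y j a * (E.z l (i + 1) + D.ev l • E.z l i) := by
  rcases le_or_gt (D.p l) i with h | h
  · rw [E.z_top _ _ h, E.z_top _ _ (h.trans i.le_succ)]; simp
  rw [E.minor _ _ _ _ (.scr j a ha) (.jor l i h), mul_comm]

lemma y_mul_y_succ (j j' : D.Scr) {a a' : ℕ} (ha : a < D.n j) (ha' : a' < D.n j') :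
    E.y j a * E.y j' (a' + 1) = E.y j (a + 1) * E.y j' a' := by
  rw [E.minor _ _ _ _ (.scr j a ha) (.scr j' a' ha'), mul_comm]

lemma y_succ_mul_x (j : D.Scr) (b : D.Nil) {a : ℕ} (ha : a < D.n j) (i : ℕ) :
    E.y j (a + 1) * E.x b i = E.y j a * E.x b (i + 1) := by
  rcases le_or_gt (D.m b) i with h | h
  · rw [E.x_top _ _ h, E.x_top _ _ (h.trans i.le_succ)]; simp
  rw [E.minor _ _ _ _ (.scr j a ha) (.nil b i h), mul_comm]

/-- Combined with `x_zero` and `x_top`, this shift leaves `y j a * x b i` with `a ≤ D.n j` possibly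
nonzero only for `D.n j < a + i < D.m b`. -/
lemma y_add_mul_x (j : D.Scr) (b : D.Nil) {a c : ℕ} (ha : a + c ≤ D.n j) (i : ℕ) :
    E.y j (a + c) * E.x b i = E.y j a * E.x b (i + c) := by
  induction c generalizing i with
  | zero => rfl
  | succ c ih =>
    rw [← add_assoc, E.y_succ_mul_x j b (by omega), ih (by omega), add_right_comm, add_assoc]

lemma y_mul_x_eq_zero_of_le (j : D.Scr) (b : D.Nil) {a i : ℕ} (h : a + i ≤ D.n j) :
    E.y j a * E.x b i = 0 := by
  have := E.y_add_mul_x j b (a := a) (c := i) h 0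
  rw [E.x_zero, mul_zero, zero_add] at this
  exact this.symm

lemma y_mul_x_eq_zero_of_ge (j : D.Scr) (b : D.Nil) {a i : ℕ} (ha : a ≤ D.n j)
    (h : D.m b ≤ a + i) : E.y j a * E.x b i = 0 := by
  have := E.y_add_mul_x j b (a := 0) (c := a) (by omega) i
  rw [zero_add, E.x_top b (i + a) (by omega), mul_zero] at this
  exact this

/-- The linear form `∑ qᵢ yᵢ` associated with a polynomial `q = ∑ qᵢ Xⁱ`. -/
noncomputable def polyY (j : D.Scr) : Polynomial k →ₗ[k] T :=
  ∑ i ∈ Finset.range (D.n j + 1), (Polynomial.lcoeff k i).smulRight (E.y j i)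

lemma polyY_apply (j : D.Scr) (q : Polynomial k) :
    E.polyY j q = ∑ i ∈ Finset.range (D.n j + 1), q.coeff i • E.y j i := by
  simp [polyY, LinearMap.sum_apply]

lemma polyY_X_pow (j : D.Scr) {i : ℕ} (hi : i ≤ D.n j) :
    E.polyY j (Polynomial.X ^ i) = E.y j i := by
  rw [polyY_apply, Finset.sum_eq_single i]
  · simp
  · intro b _ hb
    rw [Polynomial.coeff_X_pow, if_neg hb, zero_smul]
  · intro h
    exact absurd (Finset.mem_range.2 (by omega)) h

lemma polyY_of_natDegree_lt (j : D.Scr) {q : Polynomial k} (hq : q.natDegree < D.n j) :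
    E.polyY j q = ∑ i ∈ Finset.range (D.n j), q.coeff i • E.y j i := by
  rw [polyY_apply, Finset.sum_range_succ, Polynomial.coeff_eq_zero_of_natDegree_lt hq, zero_smul,
    add_zero]

lemma polyY_X_mul (j : D.Scr) (q : Polynomial k) :
    E.polyY j (Polynomial.X * q) = ∑ i ∈ Finset.range (D.n j), q.coeff i • E.y j (i + 1) := by
  rw [polyY_apply, Finset.sum_range_succ']
  simp

lemma polyY_X_mul_mul (j j' : D.Scr) {q q' : Polynomial k} (hq : q.natDegree < D.n j)
    (hq' : q'.natDegree < D.n j') :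
    E.polyY j (Polynomial.X * q) * E.polyY j' q' =
      E.polyY j q * E.polyY j' (Polynomial.X * q') := by
  rw [polyY_X_mul, polyY_X_mul, E.polyY_of_natDegree_lt j hq, E.polyY_of_natDegree_lt j' hq',
    Finset.sum_mul_sum, Finset.sum_mul_sum]
  refine Finset.sum_congr rfl fun a ha => Finset.sum_congr rfl fun a' ha' => ?_
  rw [smul_mul_smul_comm, smul_mul_smul_comm,
    E.y_mul_y_succ j j' (Finset.mem_range.1 ha) (Finset.mem_range.1 ha')]

/-- The exchange relations move a factor `X` from one polynomial to the other, and scalars move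
freely, so `X - c` moves too. This gives scroll coordinates centred at any eigenvalue. -/
lemma polyY_sub_mul_mul (c : k) (j j' : D.Scr) {q q' : Polynomial k} (hq : q.natDegree < D.n j)
    (hq' : q'.natDegree < D.n j') :
    E.polyY j ((Polynomial.X - Polynomial.C c) * q) * E.polyY j' q' =
      E.polyY j q * E.polyY j' ((Polynomial.X - Polynomial.C c) * q') := by
  rw [sub_mul, sub_mul, map_sub, map_sub, sub_mul, mul_sub, E.polyY_X_mul_mul j j' hq hq',
    ← Polynomial.smul_eq_C_mul, ← Polynomial.smul_eq_C_mul, map_smul, map_smul, smul_mul_assoc,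
    mul_smul_comm]

/-- Subtracting the eigenvalue cancels the diagonal term of the Jordan column: the factor `X - D.ev
l` on the scroll side becomes the nilpotent shift on the Jordan side. -/
lemma polyY_sub_mul_z (l : D.Jor) (j : D.Scr) {q : Polynomial k} (hq : q.natDegree < D.n j)
    (i : ℕ) :
    E.polyY j ((Polynomial.X - Polynomial.C (D.ev l)) * q) * E.z l i =
      E.polyY j q * E.z l (i + 1) := by
  rw [sub_mul, map_sub, polyY_X_mul, ← Polynomial.smul_eq_C_mul, map_smul,
    E.polyY_of_natDegree_lt j hq, sub_mul, Finset.sum_mul, Finset.smul_sum, Finset.sum_mul,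
    Finset.sum_mul, ← Finset.sum_sub_distrib]
  refine Finset.sum_congr rfl fun a ha => ?_
  rw [smul_mul_assoc, E.y_succ_mul_z j l (Finset.mem_range.1 ha), smul_mul_assoc, smul_mul_assoc,
    smul_mul_assoc, mul_add, mul_smul_comm, smul_add, smul_comm, add_sub_cancel_right]

end KWSystem

end Columns

/-- An algebra with a presentation by a system of Kronecker–Weierstrass type and free variables:
it is generated by the entries of the system and the free variables, and universal for this. -/
structure KWPresentation {k : Type v} [Field k] (D : KWShape k) (U : Type) (R : Type v) [CommRing R]
    [Algebra k R] extends KWSystem R D where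
  /-- The free variables. -/
  u : U → R
  adjoin_eq_top : Algebra.adjoin k ({r | ∃ a i, r = x a i} ∪ {r | ∃ j i, i ≤ D.n j ∧ r = y j i} ∪
    {r | ∃ l i, r = z l i} ∪ Set.range u) = ⊤
  exists_lift : ∀ (T : Type v) [CommRing T] [Algebra k T] (E : KWSystem T D) (w : U → T),
    ∃ φ : R →ₐ[k] T, (∀ a i, φ (x a i) = E.x a i) ∧ (∀ j i, i ≤ D.n j → φ (y j i) = E.y j i) ∧
      (∀ l i, φ (z l i) = E.z l i) ∧ ∀ b, φ (u b) = w b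

namespace KWPresentation

variable {k : Type v} [Field k] {D : KWShape k} {U : Type} {R : Type v} [CommRing R]
  [Algebra k R] (P : KWPresentation D U R)

/-- Two algebra homomorphisms which agree on the generators are equal. -/
lemma algHom_ext {T : Type*} [CommRing T] [Algebra k T] {φ ψ : R →ₐ[k] T}
    (hx : ∀ a i, φ (P.x a i) = ψ (P.x a i)) (hy : ∀ j i, i ≤ D.n j → φ (P.y j i) = ψ (P.y j i))
    (hz : ∀ l i, φ (P.z l i) = ψ (P.z l i)) (hu : ∀ b, φ (P.u b) = ψ (P.u b)) : φ = ψ := by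
  refine AlgHom.ext_of_adjoin_eq_top P.adjoin_eq_top ?_
  rintro r (((⟨a, i, rfl⟩ | ⟨j, i, hi, rfl⟩) | ⟨l, i, rfl⟩) | ⟨b, rfl⟩)
  · exact hx a i
  · exact hy j i hi
  · exact hz l i
  · exact hu b

end KWPresentation

/-! ### Monomials in the entries of scroll blocks -/

section Exchange

variable {S T : Type*} [CommRing T]

/-- The product of the elements `g j e`, over a multiset of pairs `(j, e)`. -/
def blockProd (g : S → ℕ → T) (s : Multiset (S × ℕ)) : T := (s.map fun q => g q.1 q.2).prod

/-- The degree of a multiset of pairs `(j, e)`: the sum of the `e` and the multiset of the `j`. -/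
def blockDegree (s : Multiset (S × ℕ)) : ℕ × Multiset S := ((s.map Prod.snd).sum, s.map Prod.fst)

/-- All pairs `(j, e)` in the multiset satisfy `e ≤ n j`. -/
def IsAdmissible (n : S → ℕ) (s : Multiset (S × ℕ)) : Prop := ∀ q ∈ s, q.2 ≤ n q.1

/-- The exchange relations between the entries of scroll blocks of lengths `n j`. -/
def HasExchange (n : S → ℕ) (g : S → ℕ → T) : Prop :=
  ∀ j j' e e', e < n j → e' < n j' → g j e * g j' (e' + 1) = g j (e + 1) * g j' e'

variable {n : S → ℕ} {g : S → ℕ → T}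

@[simp] lemma blockProd_cons (q : S × ℕ) (s : Multiset (S × ℕ)) :
    blockProd g (q ::ₘ s) = g q.1 q.2 * blockProd g s := by simp [blockProd]

@[simp] lemma blockProd_zero : blockProd g 0 = 1 := by simp [blockProd]

@[simp] lemma blockDegree_cons (q : S × ℕ) (s : Multiset (S × ℕ)) :
    blockDegree (q ::ₘ s) = (q.2 + (blockDegree s).1, q.1 ::ₘ (blockDegree s).2) := by
  simp [blockDegree]

@[simp] lemma blockDegree_zero : blockDegree (0 : Multiset (S × ℕ)) = 0 := rfl

lemma isAdmissible_cons {q : S × ℕ} {s : Multiset (S × ℕ)} :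
    IsAdmissible n (q ::ₘ s) ↔ q.2 ≤ n q.1 ∧ IsAdmissible n s := by simp [IsAdmissible]

lemma exists_cons_of_mem_blockDegree {s : Multiset (S × ℕ)} {j : S} (h : j ∈ (blockDegree s).2) :
    ∃ a s', s = (j, a) ::ₘ s' := by
  obtain ⟨⟨j', a⟩, hq, rfl⟩ := Multiset.mem_map.1 h
  obtain ⟨s', hs'⟩ := Multiset.exists_cons_of_mem hq
  exact ⟨a, s', hs'⟩

lemma exists_exchange (hg : HasExchange n g) {j : S} {a : ℕ} (ha : a < n j)
    {s : Multiset (S × ℕ)} (hs : IsAdmissible n s) (hpos : 0 < (blockDegree s).1) :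
    ∃ s', IsAdmissible n s' ∧ (blockDegree s').2 = (blockDegree s).2 ∧
      (blockDegree s').1 + 1 = (blockDegree s).1 ∧
      g j a * blockProd g s = g j (a + 1) * blockProd g s' := by
  obtain ⟨e, he, hne⟩ : ∃ e ∈ s.map Prod.snd, e ≠ 0 := by
    by_contra! h
    exact hpos.ne' (Multiset.sum_eq_zero h)
  obtain ⟨⟨j', e'⟩, hq, rfl⟩ := Multiset.mem_map.1 he
  obtain ⟨t, rfl⟩ := Multiset.exists_cons_of_mem hq
  obtain ⟨c, rfl⟩ := Nat.exists_eq_succ_of_ne_zero hne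
  rw [isAdmissible_cons] at hs
  have hc : c < n j' := hs.1
  refine ⟨(j', c) ::ₘ t, isAdmissible_cons.2 ⟨hc.le, hs.2⟩, by simp, ?_, ?_⟩
  · simp only [blockDegree_cons]
    omega
  · simp only [blockProd_cons]
    rw [← mul_assoc, Nat.succ_eq_add_one, hg j j' a c ha hc, mul_assoc]

/-- A product of entries of scroll blocks depends only on its degree. -/
lemma blockProd_eq_of_blockDegree_eq (hg : HasExchange n g) {s s' : Multiset (S × ℕ)}
    (hs : IsAdmissible n s) (hs' : IsAdmissible n s') (h : blockDegree s = blockDegree s') :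
    blockProd g s = blockProd g s' := by
  suffices H : ∀ (c : ℕ) (s s' : Multiset (S × ℕ)), s.card = c → IsAdmissible n s →
      IsAdmissible n s' → blockDegree s = blockDegree s' → blockProd g s = blockProd g s' from
    H _ s s' rfl hs hs' h
  clear hs hs' h s s'
  intro c
  induction c with
  | zero =>
    intro s s' hc _ _ h
    rw [Multiset.card_eq_zero] at hc
    subst hc
    have : s'.map Prod.fst = 0 := (congrArg Prod.snd h).symm
    rw [Multiset.map_eq_zero] at this
    rw [this]
  | succ c ih =>
    -- Both monomials contain the block `j`. Raising the smaller of its two indices one by one, at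
    -- the expense of the other factors, makes the leading factors agree; the induction on the
    -- number of factors handles the rest.
    have key : ∀ (d : ℕ) (j : S) (a : ℕ) (t t' : Multiset (S × ℕ)), t.card = c →
        IsAdmissible n ((j, a) ::ₘ t) → IsAdmissible n ((j, a + d) ::ₘ t') →
        blockDegree ((j, a) ::ₘ t) = blockDegree ((j, a + d) ::ₘ t') →
        blockProd g ((j, a) ::ₘ t) = blockProd g ((j, a + d) ::ₘ t') := by
      intro d
      induction d with
      | zero =>
        intro j a t t' ht h1 h2 h3
        rw [isAdmissible_cons] at h1 h2
        simp only [blockDegree_cons, add_zero, Prod.mk.injEq, add_right_inj,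
          Multiset.cons_inj_right] at h3
        simp only [blockProd_cons, add_zero]
        rw [ih t t' ht h1.2 h2.2 (Prod.ext h3.1 h3.2)]
      | succ d ihd =>
        intro j a t t' ht h1 h2 h3
        rw [isAdmissible_cons] at h1
        have h2' := (isAdmissible_cons.1 h2).1
        simp only at h2'
        have h3' := congrArg Prod.fst h3
        simp only [blockDegree_cons] at h3'
        obtain ⟨t₁, ht₁, hd2, hd1, hp⟩ := exists_exchange hg (j := j) (a := a) (by omega) h1.2
          (by omega)
        have hcard : t₁.card = c := by
          have := congrArg Multiset.card hd2
          simpa [blockDegree, ht] using this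
        have h4 := ihd j (a + 1) t₁ t' hcard (isAdmissible_cons.2 ⟨by simp; omega, ht₁⟩)
          (by rwa [add_right_comm]) (by
            rw [add_right_comm a 1 d, add_assoc a d 1, ← h3, blockDegree_cons, blockDegree_cons,
              hd2, ← hd1]
            simp only [Prod.mk.injEq, and_true]
            omega)
        rw [blockProd_cons, hp, ← add_assoc, add_right_comm, ← h4, blockProd_cons]
    intro s s' hc hs hs' h
    obtain ⟨⟨j, a⟩, hq⟩ := Multiset.card_pos_iff_exists_mem.1 (by omega : 0 < s.card)
    obtain ⟨t, rfl⟩ := Multiset.exists_cons_of_mem hq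
    have hct : t.card = c := by simpa using hc
    have hj : j ∈ (blockDegree s').2 := by rw [← h]; simp
    obtain ⟨b, t', rfl⟩ := exists_cons_of_mem_blockDegree hj
    have hct' : t'.card = c := by
      have := congrArg (fun q => Multiset.card q.2) h
      simpa [blockDegree, hct] using this.symm
    rcases le_total a b with hab | hab
    · obtain ⟨d, rfl⟩ := Nat.exists_eq_add_of_le hab
      exact key d j a t t' hct hs hs' h
    · obtain ⟨d, rfl⟩ := Nat.exists_eq_add_of_le hab
      exact (key d j b t' t hct' hs' hs h.symm).symm

/-- A product of entries of scroll blocks is a multiple of an entry `g j e` with `b ≤ e`, as soon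
as its degree allows this. -/
lemma exists_blockProd_eq_mul (hg : HasExchange n g) {s : Multiset (S × ℕ)}
    (hs : IsAdmissible n s) {j : S} (hj : j ∈ (blockDegree s).2) {b : ℕ} (hb : b ≤ n j)
    (hbs : b ≤ (blockDegree s).1) :
    ∃ e, b ≤ e ∧ e ≤ n j ∧ ∃ r, blockProd g s = r * g j e := by
  obtain ⟨a, t, rfl⟩ := exists_cons_of_mem_blockDegree hj
  clear hj
  rw [isAdmissible_cons] at hs
  obtain ⟨ha, ht⟩ := hs
  simp only [blockDegree_cons, blockProd_cons] at *
  rcases le_total b a with h | h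
  · exact ⟨a, h, ha, _, mul_comm _ _⟩
  obtain ⟨d, rfl⟩ := Nat.exists_eq_add_of_le h
  clear h
  induction d generalizing a t with
  | zero => exact ⟨a, le_rfl, ha, _, mul_comm _ _⟩
  | succ d ih =>
    obtain ⟨t₁, ht₁, -, hd1, hp⟩ := exists_exchange hg (j := j) (a := a) (by omega) ht (by omega)
    obtain ⟨e, he, hen, r, hr⟩ := ih (a + 1) t₁ (by omega) ht₁ (by omega) (by omega)
    exact ⟨e, by omega, hen, r, hp.trans hr⟩

end Exchange

/-! ### Scroll coordinates -/

namespace KWPresentation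

variable {k : Type v} [Field k] {D : KWShape k} {U : Type} {R : Type v} [CommRing R]
  [Algebra k R] (P : KWPresentation D U R)

/-- The ideal generated by the free variables and the entries of the nilpotent blocks. -/
def idealUX : Ideal R := Ideal.span (Set.range P.u ∪ {r | ∃ a i, r = P.x a i})

/-- The ideal generated by the free variables and the entries of the nilpotent blocks and the
Jordan blocks. -/
def idealUXZ : Ideal R := P.idealUX ⊔ Ideal.span {r | ∃ l i, r = P.z l i}

lemma u_mem_idealUX (b : U) : P.u b ∈ P.idealUX := Ideal.subset_span (Or.inl ⟨b, rfl⟩)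

lemma x_mem_idealUX (a : D.Nil) (i : ℕ) : P.x a i ∈ P.idealUX :=
  Ideal.subset_span (Or.inr ⟨a, i, rfl⟩)

lemma idealUX_le_idealUXZ : P.idealUX ≤ P.idealUXZ := le_sup_left

lemma z_mem_idealUXZ (l : D.Jor) (i : ℕ) : P.z l i ∈ P.idealUXZ :=
  le_sup_right (a := P.idealUX) (Ideal.subset_span ⟨l, i, rfl⟩)

lemma idealUX_le {I : Ideal R} (hu : ∀ b, P.u b ∈ I) (hx : ∀ a i, P.x a i ∈ I) :
    P.idealUX ≤ I := by
  refine Ideal.span_le.2 ?_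
  rintro r (⟨b, rfl⟩ | ⟨a, i, rfl⟩)
  · exact hu b
  · exact hx a i

lemma idealUXZ_le {I : Ideal R} (hu : ∀ b, P.u b ∈ I) (hx : ∀ a i, P.x a i ∈ I)
    (hz : ∀ l i, P.z l i ∈ I) : P.idealUXZ ≤ I := by
  refine sup_le (P.idealUX_le hu hx) (Ideal.span_le.2 ?_)
  rintro r ⟨l, i, rfl⟩
  exact hz l i

/-- Coordinates on the scroll blocks in which the scroll part of the algebra is a monoid algebra. -/
structure IsScrollCoord (g : D.Scr → ℕ → R) : Prop where
  exchange : HasExchange D.n g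
  y_mem : ∀ j i, i ≤ D.n j → P.y j i ∈ Submodule.span k {r | ∃ e ≤ D.n j, r = g j e}
  mem_y : ∀ j e, e ≤ D.n j → g j e ∈ Submodule.span k {r | ∃ i ≤ D.n j, r = P.y j i}
  exists_model : ∃ δ : R →ₐ[k] AddMonoidAlgebra k (ℕ × Multiset D.Scr),
    (∀ j e, e ≤ D.n j → δ (g j e) = AddMonoidAlgebra.single (e, {j}) 1) ∧
      ∀ r ∈ P.idealUXZ, δ r = 0

variable {P}

/-- All generators outside the scroll blocks lie in `P.idealUXZ`, so modulo that ideal only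
polynomials in the scroll coordinates remain. -/
lemma IsScrollCoord.exists_sub_mem {g : D.Scr → ℕ → R} (hg : P.IsScrollCoord g) (f : R) :
    ∃ f₀ ∈ Submodule.span k {r | ∃ s, IsAdmissible D.n s ∧ r = blockProd g s},
      f - f₀ ∈ P.idealUXZ := by
  set A := Algebra.adjoin k {r | ∃ j e, e ≤ D.n j ∧ r = g j e} with hA
  have hAs : ∀ f₀ ∈ A, f₀ ∈ Submodule.span k {r | ∃ s, IsAdmissible D.n s ∧ r = blockProd g s} := by
    intro f₀ hf₀
    rw [← Subalgebra.mem_toSubmodule, hA, Algebra.adjoin_eq_span] at hf₀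
    refine Submodule.span_mono ?_ hf₀
    intro r hr
    induction hr using Submonoid.closure_induction with
    | mem r hr =>
      obtain ⟨j, e, he, rfl⟩ := hr
      exact ⟨{(j, e)}, by simpa [IsAdmissible] using he, by simp [blockProd]⟩
    | one => exact ⟨0, by simp [IsAdmissible], by simp⟩
    | mul r r' _ _ h h' =>
      obtain ⟨s, hs, rfl⟩ := h
      obtain ⟨s', hs', rfl⟩ := h'
      refine ⟨s + s', ?_, by simp [blockProd]⟩
      intro q hq
      rcases Multiset.mem_add.1 hq with h | h
      · exact hs q h
      · exact hs' q h
  suffices H : ∃ f₀ ∈ A, f - f₀ ∈ P.idealUXZ from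
    H.imp fun f₀ h => ⟨hAs f₀ h.1, h.2⟩
  have hf : f ∈ (⊤ : Subalgebra k R) := trivial
  rw [← P.adjoin_eq_top] at hf
  induction hf using Algebra.adjoin_induction with
  | mem r hr =>
    rcases hr with ((⟨a, i, rfl⟩ | ⟨j, i, hi, rfl⟩) | ⟨l, i, rfl⟩) | ⟨b, rfl⟩
    · exact ⟨0, A.zero_mem, by simpa using P.idealUX_le_idealUXZ (P.x_mem_idealUX a i)⟩
    · refine ⟨_, ?_, by rw [sub_self]; exact zero_mem _⟩
      have : Submodule.span k {r | ∃ e ≤ D.n j, r = g j e} ≤ Subalgebra.toSubmodule A := by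
        refine Submodule.span_le.2 ?_
        rintro _ ⟨e, he, rfl⟩
        exact Algebra.subset_adjoin ⟨j, e, he, rfl⟩
      exact this (hg.y_mem j i hi)
    · exact ⟨0, A.zero_mem, by simpa using P.z_mem_idealUXZ l i⟩
    · exact ⟨0, A.zero_mem, by simpa using P.idealUX_le_idealUXZ (P.u_mem_idealUX b)⟩
  | algebraMap c => exact ⟨_, A.algebraMap_mem c, by rw [sub_self]; exact zero_mem _⟩
  | add r r' _ _ h h' =>
    obtain ⟨f₀, h1, h2⟩ := h
    obtain ⟨f₁, h3, h4⟩ := h'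
    exact ⟨f₀ + f₁, add_mem h1 h3, by rw [add_sub_add_comm]; exact add_mem h2 h4⟩
  | mul r r' _ _ h h' =>
    obtain ⟨f₀, h1, h2⟩ := h
    obtain ⟨f₁, h3, h4⟩ := h'
    refine ⟨f₀ * f₁, mul_mem h1 h3, ?_⟩
    have : r * r' - f₀ * f₁ = (r - f₀) * r' + f₀ * (r' - f₁) := by ring
    rw [this]
    exact add_mem (Ideal.mul_mem_right _ _ h2) (Ideal.mul_mem_left _ _ h4)

lemma IsScrollCoord.exists_linearCombination {g : D.Scr → ℕ → R} (hg : P.IsScrollCoord g) (f : R) :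
    ∃ (Mon : ℕ × Multiset D.Scr → R) (l : ℕ × Multiset D.Scr →₀ k),
      (∀ s, IsAdmissible D.n s → Mon (blockDegree s) = blockProd g s) ∧
      (∀ d ∈ l.support, ∃ s, IsAdmissible D.n s ∧ blockDegree s = d) ∧
      f - Finsupp.linearCombination k Mon l ∈ P.idealUXZ := by
  classical
  obtain ⟨f₀, hf₀, hff₀⟩ := hg.exists_sub_mem f
  -- By `blockProd_eq_of_blockDegree_eq` one representative monomial for each degree suffices.
  let Mon : ℕ × Multiset D.Scr → R := fun d =>
    if h : ∃ s, IsAdmissible D.n s ∧ blockDegree s = d then blockProd g h.choose else 0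
  have hMon : ∀ s, IsAdmissible D.n s → Mon (blockDegree s) = blockProd g s := by
    intro s hs
    have h : ∃ s', IsAdmissible D.n s' ∧ blockDegree s' = blockDegree s := ⟨s, hs, rfl⟩
    simp only [Mon, dif_pos h]
    exact blockProd_eq_of_blockDegree_eq hg.exchange h.choose_spec.1 hs h.choose_spec.2
  set V : Set (ℕ × Multiset D.Scr) := {d | ∃ s, IsAdmissible D.n s ∧ blockDegree s = d}
  have hf₀' : f₀ ∈ Submodule.span k (Mon '' V) := by
    refine Submodule.span_mono ?_ hf₀
    rintro _ ⟨s, hs, rfl⟩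
    exact ⟨_, ⟨s, hs, rfl⟩, hMon s hs⟩
  obtain ⟨l, hl, rfl⟩ := (Finsupp.mem_span_image_iff_linearCombination k).1 hf₀'
  exact ⟨Mon, l, hMon, fun d hd => hl hd, hff₀⟩

/-- Computation of colon ideals by means of monomials. -/
lemma IsScrollCoord.colonElement_eq {g : D.Scr → ℕ → R} (hg : P.IsScrollCoord g) {J H : Ideal R}
    {j₀ : D.Scr} {e₀ : ℕ} (he₀ : e₀ ≤ D.n j₀) (hKH : P.idealUXZ ≤ H)
    (hHJ : ∀ r ∈ H, r * g j₀ e₀ ∈ J) (M : Set (ℕ × Multiset D.Scr))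
    (hM : ∀ d ∈ M, ∀ d', d' + d ∈ M)
    (hJM : ∃ G : Set R, J ≤ P.idealUXZ ⊔ Ideal.span G ∧
      ∀ r ∈ G, ∃ j e, e ≤ D.n j ∧ r = g j e ∧ (e, {j}) ∈ M)
    (hMH : ∀ s, IsAdmissible D.n s → blockDegree s + (e₀, {j₀}) ∈ M → blockProd g s ∈ H) :
    colonElement J (g j₀ e₀) = H := by
  classical
  apply le_antisymm
  swap
  · intro r hr
    rw [mem_colonElement]
    exact hHJ r hr
  intro f hf
  rw [mem_colonElement, smul_eq_mul] at hf
  obtain ⟨δ, hδg, hδK⟩ := hg.exists_model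
  obtain ⟨Mon, l, hMon, hl, hff₀⟩ := hg.exists_linearCombination f
  set f₀ := Finsupp.linearCombination k Mon l with hlf
  have hδs : ∀ s, IsAdmissible D.n s →
      δ (blockProd g s) = AddMonoidAlgebra.single (blockDegree s) 1 := by
    intro s
    induction s using Multiset.induction_on with
    | empty => intro _; simp [AddMonoidAlgebra.one_def]
    | cons q s ih =>
      intro hs
      rw [isAdmissible_cons] at hs
      rw [blockProd_cons, map_mul, ih hs.2, hδg _ _ hs.1, AddMonoidAlgebra.single_mul_single]
      simp [Prod.add_def]
  have hδf₀ : δ f₀ = AddMonoidAlgebra.ofCoeff l := by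
    rw [hlf, Finsupp.linearCombination_apply, map_finsuppSum]
    have : ∀ d ∈ l.support,
        δ (l d • Mon d) = AddMonoidAlgebra.ofCoeff (Finsupp.single d (l d)) := by
      intro d hd
      obtain ⟨s, hs, rfl⟩ := hl d hd
      rw [map_smul, hMon s hs, hδs s hs]
      simp
    rw [Finsupp.sum_congr (g2 := fun d c => AddMonoidAlgebra.ofCoeff (Finsupp.single d c)) this,
      ← AddMonoidAlgebra.ofCoeff_finsuppSum, Finsupp.sum_single]
  have hδJ : ∀ r ∈ J, δ r ∈ Ideal.span (AddMonoidAlgebra.of' k _ '' M) := by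
    obtain ⟨G, hJG, hG⟩ := hJM
    intro r hr
    have : P.idealUXZ ⊔ Ideal.span G ≤
        (Ideal.span (AddMonoidAlgebra.of' k _ '' M)).comap δ.toRingHom := by
      refine sup_le ?_ (Ideal.span_le.2 ?_)
      · intro r hr
        rw [Ideal.mem_comap]
        change δ r ∈ _
        rw [hδK r hr]
        exact zero_mem _
      · intro r hr
        obtain ⟨j, e, he, rfl, hjM⟩ := hG r hr
        change δ (g j e) ∈ Ideal.span (AddMonoidAlgebra.of' k _ '' M)
        rw [hδg j e he]
        exact Ideal.subset_span ⟨_, hjM, rfl⟩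
    exact this (hJG hr)
  -- In the model the product lies in a monomial ideal, where membership is tested degree by degree.
  -- Since `f₀` has at most one term in each degree, nothing cancels and each term can be treated
  -- separately.
  have hfh : δ (f₀ * g j₀ e₀) ∈ Ideal.span (AddMonoidAlgebra.of' k _ '' M) := by
    have h1 : δ (f₀ * g j₀ e₀) = δ (f * g j₀ e₀) := by
      have : δ (f - f₀) = 0 := hδK _ hff₀
      rw [map_sub, sub_eq_zero] at this
      rw [map_mul, map_mul, this]
    rw [h1]
    exact hδJ _ hf
  rw [map_mul, hδf₀, hδg _ _ he₀, AddMonoidAlgebra.mem_ideal_span_of'_image] at hfh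
  have hf₀H : f₀ ∈ H := by
    rw [hlf, Finsupp.linearCombination_apply]
    refine Ideal.sum_mem _ fun d hd => ?_
    obtain ⟨s, hs, rfl⟩ := hl d hd
    simp only
    rw [hMon s hs, Algebra.smul_def]
    refine Ideal.mul_mem_left _ _ (hMH s hs ?_)
    obtain ⟨d', hd', c, hc⟩ := hfh (blockDegree s + (e₀, {j₀})) (by
      rw [Finsupp.mem_support_iff, AddMonoidAlgebra.coeff_mul_single_add, mul_one]
      simpa using hd)
    rw [hc]
    exact hM d' hd' c
  have := add_mem (hKH hff₀) hf₀H
  rwa [sub_add_cancel] at this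

end KWPresentation

/-! ### Two kinds of scroll coordinates -/

namespace KWPresentation

variable {k : Type v} [Field k] {D : KWShape k} {U : Type} {R : Type v} [CommRing R]
  [Algebra k R] (P : KWPresentation D U R)

lemma map_idealUXZ_eq_zero {T : Type*} [CommRing T] [Algebra k T] {δ : R →ₐ[k] T}
    (hx : ∀ a i, δ (P.x a i) = 0) (hz : ∀ l i, δ (P.z l i) = 0) (hu : ∀ b, δ (P.u b) = 0) :
    ∀ r ∈ P.idealUXZ, δ r = 0 :=
  P.idealUXZ_le (I := RingHom.ker δ) hu hx hz

/-- The coordinates given by the entries of the scroll blocks in reversed order. -/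
def revY (j : D.Scr) (e : ℕ) : R := P.y j (D.n j - e)

/-- The model is `y j i ↦ σ ^ (n j - i) * s_j`: every scroll column is a multiple of `(σ, 1)`, and
the reversed index is the exponent of `σ`. -/
lemma isScrollCoord_revY : P.IsScrollCoord P.revY where
  exchange j j' e e' he he' := by
    simp only [revY]
    obtain ⟨c, hc⟩ : ∃ c, D.n j - e = c + 1 := ⟨D.n j - e - 1, by omega⟩
    obtain ⟨c', hc'⟩ : ∃ c, D.n j' - e' = c + 1 := ⟨D.n j' - e' - 1, by omega⟩
    rw [hc, hc', show D.n j - (e + 1) = c by omega, show D.n j' - (e' + 1) = c' by omega]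
    exact (P.y_mul_y_succ j j' (by omega) (by omega)).symm
  y_mem j i hi := Submodule.subset_span ⟨D.n j - i, by omega, by
    rw [revY, Nat.sub_sub_self hi]⟩
  mem_y j e he := Submodule.subset_span ⟨D.n j - e, by omega, rfl⟩
  exists_model := by
    let E : KWSystem (AddMonoidAlgebra k (ℕ × Multiset D.Scr)) D :=
      KWSystem.ofRatio D (AddMonoidAlgebra.single (1, 0) 1) 1 (fun _ _ => 0)
        (fun j i => AddMonoidAlgebra.single (D.n j - i, {j}) 1) (fun _ _ => 0)
        (fun _ => rfl) (fun _ _ _ => rfl) (fun _ _ _ => rfl) (by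
          rintro _ _ (⟨a, i, hi⟩ | ⟨j, i, hi⟩ | ⟨l, i, hi⟩)
          · exact ⟨0, by simp, by simp⟩
          · refine ⟨AddMonoidAlgebra.single (D.n j - (i + 1), {j}) 1, ?_, by simp⟩
            rw [AddMonoidAlgebra.single_mul_single, mul_one, Prod.mk_add_mk, zero_add]
            congr 2
            omega
          · exact ⟨0, by simp, by simp⟩)
    obtain ⟨δ, hx, hy, hz, hu⟩ := P.exists_lift _ E (fun _ => 0)
    refine ⟨δ, fun j e he => ?_, P.map_idealUXZ_eq_zero hx hz hu⟩
    rw [revY, hy _ _ (by omega)]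
    simp only [E, KWSystem.ofRatio]
    rw [Nat.sub_sub_self he]

/-- The coordinates given by the powers of `X - c`. -/
noncomputable def powY (c : k) (j : D.Scr) (e : ℕ) : R :=
  P.polyY j ((Polynomial.X - Polynomial.C c) ^ e)

lemma natDegree_X_sub_C_pow_lt {c : k} {e d : ℕ} (h : e < d) :
    ((Polynomial.X - Polynomial.C c) ^ e).natDegree < d := by
  simpa using h

lemma y_eq_sum_powY (c : k) (j : D.Scr) {i : ℕ} (hi : i ≤ D.n j) :
    P.y j i = ∑ e ∈ Finset.range (i + 1), (c ^ (i - e) * (i.choose e : k)) • P.powY c j e := by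
  rw [← P.polyY_X_pow j hi]
  have : (Polynomial.X : Polynomial k) ^ i =
      ((Polynomial.X - Polynomial.C c) + Polynomial.C c) ^ i := by rw [sub_add_cancel]
  rw [this, add_pow, map_sum]
  refine Finset.sum_congr rfl fun e _ => ?_
  rw [powY, ← map_smul]
  congr 1
  rw [Polynomial.smul_eq_C_mul, mul_assoc, mul_comm]
  congr 1
  simp

lemma powY_zero (c : k) (j : D.Scr) : P.powY c j 0 = P.y j 0 := by
  rw [powY, pow_zero, ← pow_zero Polynomial.X, P.polyY_X_pow j (Nat.zero_le _)]

/-- The model is `y j i ↦ (σ + c) ^ i * s_j`, with columns proportional to `(1, σ + c)`. It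
evaluates polynomials of degree at most `D.n j` at `σ + c`, so `(X - c) ^ e` becomes the monomial `σ
^ e * s_j`. -/
lemma isScrollCoord_powY (c : k) : P.IsScrollCoord (P.powY c) where
  exchange j j' e e' he he' := by
    simp only [powY]
    rw [pow_succ', pow_succ', P.polyY_sub_mul_mul c j j' (natDegree_X_sub_C_pow_lt he)
      (natDegree_X_sub_C_pow_lt he')]
  y_mem j i hi := by
    rw [P.y_eq_sum_powY c j hi]
    refine Submodule.sum_mem _ fun e he =>
      Submodule.smul_mem _ _ (Submodule.subset_span ⟨e, ?_, rfl⟩)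
    have := Finset.mem_range.1 he
    omega
  mem_y j e he := by
    rw [powY, KWSystem.polyY_apply]
    refine Submodule.sum_mem _ fun i hi =>
      Submodule.smul_mem _ _ (Submodule.subset_span ⟨i, ?_, rfl⟩)
    have := Finset.mem_range.1 hi
    omega
  exists_model := by
    set σ : AddMonoidAlgebra k (ℕ × Multiset D.Scr) := AddMonoidAlgebra.single (1, 0) 1 with hσ
    set t : AddMonoidAlgebra k (ℕ × Multiset D.Scr) := σ + algebraMap k _ c with ht
    let E : KWSystem (AddMonoidAlgebra k (ℕ × Multiset D.Scr)) D :=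
      KWSystem.ofRatio D 1 t (fun _ _ => 0)
        (fun j i => t ^ i * AddMonoidAlgebra.single (0, {j}) 1) (fun _ _ => 0)
        (fun _ => rfl) (fun _ _ _ => rfl) (fun _ _ _ => rfl) (by
          rintro _ _ (⟨a, i, hi⟩ | ⟨j, i, hi⟩ | ⟨l, i, hi⟩)
          · exact ⟨0, by simp, by simp⟩
          · refine ⟨t ^ i * AddMonoidAlgebra.single (0, {j}) 1, by rw [one_mul], ?_⟩
            rw [pow_succ', mul_assoc]
          · exact ⟨0, by simp, by simp⟩)
    obtain ⟨δ, hx, hy, hz, hu⟩ := P.exists_lift _ E (fun _ => 0)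
    refine ⟨δ, fun j e he => ?_, P.map_idealUXZ_eq_zero hx hz hu⟩
    have h1 : ∀ q : Polynomial k, q.natDegree ≤ D.n j →
        δ (P.polyY j q) = Polynomial.aeval t q * AddMonoidAlgebra.single (0, {j}) 1 := by
      intro q hq
      rw [KWSystem.polyY_apply, map_sum, Polynomial.aeval_eq_sum_range' (Nat.lt_succ_of_le hq),
        Finset.sum_mul]
      refine Finset.sum_congr rfl fun i hi => ?_
      rw [map_smul, hy _ _ (by have := Finset.mem_range.1 hi; omega), smul_mul_assoc]
      rfl
    rw [powY, h1 _ (by simpa using he), map_pow, map_sub, Polynomial.aeval_X, Polynomial.aeval_C,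
      ht, add_sub_cancel_right, hσ, AddMonoidAlgebra.single_pow, one_pow,
      AddMonoidAlgebra.single_mul_single, mul_one]
    simp

/-! ### Colon ideals by free variables -/

end KWPresentation

/-- The image of a system under an algebra homomorphism. -/
def KWSystem.map {k T T' : Type*} [Field k] [CommRing T] [Algebra k T] [CommRing T'] [Algebra k T']
    {D : KWShape k} (E : KWSystem T D) (φ : T →ₐ[k] T') : KWSystem T' D where
  x a i := φ (E.x a i)
  y j i := φ (E.y j i)
  z l i := φ (E.z l i)
  x_zero a := by rw [E.x_zero, map_zero]
  x_top a i h := by rw [E.x_top a i h, map_zero]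
  z_top l i h := by rw [E.z_top l i h, map_zero]
  minor := by
    have key : ∀ a b, IsKWColumn D (fun a i => φ (E.x a i)) (fun j i => φ (E.y j i))
        (fun l i => φ (E.z l i)) a b → ∃ a₀ b₀, IsKWColumn D E.x E.y E.z a₀ b₀ ∧ φ a₀ = a ∧
          φ b₀ = b := by
      rintro _ _ (⟨a, i, hi⟩ | ⟨j, i, hi⟩ | ⟨l, i, hi⟩)
      · exact ⟨_, _, .nil a i hi, rfl, rfl⟩
      · exact ⟨_, _, .scr j i hi, rfl, rfl⟩
      · exact ⟨_, _, .jor l i hi, rfl, by simp⟩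
    intro a b a' b' h h'
    obtain ⟨a₀, b₀, h₀, rfl, rfl⟩ := key a b h
    obtain ⟨a₁, b₁, h₁, rfl, rfl⟩ := key a' b' h'
    rw [← map_mul, E.minor _ _ _ _ h₀ h₁, map_mul]

/-- This ring models the Jordan blocks: the nilpotent shift becomes multiplication by a variable
with vanishing `e`-th power, and evaluation at `0` still factors through it. -/
lemma exists_truncation (k A : Type v) [Field k] [CommRing A] [Algebra k A] (e : ℕ) (he : 0 < e) :
    ∃ (T : Type v) (_ : CommRing T) (_ : Algebra k T) (π : Polynomial A →ₐ[k] T) (ev : T →ₐ[k] A),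
      Function.Surjective π ∧ (∀ q, π q = 0 ↔ Polynomial.X ^ e ∣ q) ∧
        ∀ q, ev (π q) = Polynomial.eval 0 q := by
  let ev₀ : Polynomial A →ₐ[k] A := (Polynomial.aeval (0 : A)).restrictScalars k
  have hev₀ : ∀ q : Polynomial A, ev₀ q = Polynomial.eval 0 q := fun q => by
    simp [ev₀, Polynomial.aeval_def, Polynomial.eval₂_eq_eval_map]
  refine ⟨Polynomial A ⧸ Ideal.span {(Polynomial.X : Polynomial A) ^ e}, inferInstance,
    inferInstance, Ideal.Quotient.mkₐ k _, Ideal.Quotient.liftₐ _ ev₀ ?_,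
    Ideal.Quotient.mk_surjective, ?_, fun q => by rw [← hev₀]; rfl⟩
  · intro q hq
    obtain ⟨r, rfl⟩ := Ideal.mem_span_singleton.1 hq
    simp [hev₀, he.ne']
  · intro q
    rw [← Ideal.mem_span_singleton]
    exact Ideal.Quotient.eq_zero_iff_mem

namespace KWPresentation

variable {k : Type v} [Field k] {D : KWShape k} {U : Type} {R : Type v} [CommRing R]
  [Algebra k R] (P : KWPresentation D U R)

/-- Send `u b` to the variable of `R[X]`, the elements of `P.u '' s` to `0` and the other generators
to themselves. Substituting `u b` back recovers the class modulo the ideal, and multiplication by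
the variable is injective. -/
lemma colonElement_u (s : Set U) {b : U} (hb : b ∉ s) :
    colonElement (Ideal.span (P.u '' s)) (P.u b) = Ideal.span (P.u '' s) := by
  classical
  set J := Ideal.span (P.u '' s) with hJ
  apply le_antisymm
  swap
  · intro r hr
    exact mem_colonElement.2 (Ideal.mul_mem_right _ _ hr)
  intro f hf
  rw [mem_colonElement, smul_eq_mul] at hf
  let ι : R →ₐ[k] Polynomial R := IsScalarTower.toAlgHom k R (Polynomial R)
  obtain ⟨δ, hx, hy, hz, hu⟩ := P.exists_lift (Polynomial R) (P.toKWSystem.map ι)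
    (fun c => if c ∈ s then 0 else if c = b then Polynomial.X else ι (P.u c))
  let ev : Polynomial R →ₐ[k] R := (Polynomial.aeval (P.u b)).restrictScalars k
  have hev : ∀ r, ev (ι r) = r := fun r => by simp [ev, ι]
  have h1 : ((Ideal.Quotient.mkₐ k J).comp ev).comp δ = Ideal.Quotient.mkₐ k J := by
    refine P.algHom_ext ?_ ?_ ?_ ?_
    · intro a i; simp [hx, KWSystem.map, hev]
    · intro j i hi; simp [hy j i hi, KWSystem.map, hev]
    · intro l i; simp [hz, KWSystem.map, hev]
    · intro c
      simp only [AlgHom.comp_apply, hu]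
      split_ifs with h2 h3
      · rw [map_zero, map_zero]
        have h4 : P.u c ∈ J := Ideal.subset_span ⟨c, h2, rfl⟩
        exact (Ideal.Quotient.eq_zero_iff_mem.2 h4).symm
      · simp [ev, h3]
      · rw [hev]
  have h2 : J ≤ RingHom.ker δ := by
    refine Ideal.span_le.2 ?_
    rintro _ ⟨c, hc, rfl⟩
    change δ (P.u c) = 0
    rw [hu, if_pos hc]
  have h3 : δ f * Polynomial.X = 0 := by
    have : δ (f * P.u b) = 0 := h2 hf
    rwa [map_mul, hu, if_neg hb, if_pos rfl] at this
  have h4 : δ f = 0 := by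
    ext i
    rw [← Polynomial.coeff_mul_X, h3, Polynomial.coeff_zero, Polynomial.coeff_zero]
  have h5 := congrArg (fun φ => φ f) h1
  simp only [AlgHom.comp_apply, h4, map_zero] at h5
  exact Ideal.Quotient.eq_zero_iff_mem.1 h5.symm

/-! ### Colon ideals by entries of Jordan blocks -/

/-- The ideal generated by the free variables, the entries of the nilpotent blocks and the entries
`z l i` with `c l ≤ i` of the Jordan blocks. -/
def idealVec (c : D.Jor → ℕ) : Ideal R :=
  P.idealUX ⊔ Ideal.span {r | ∃ l i, c l ≤ i ∧ r = P.z l i}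

lemma z_mem_idealVec {c : D.Jor → ℕ} {l : D.Jor} {i : ℕ} (h : c l ≤ i) : P.z l i ∈ P.idealVec c :=
  le_sup_right (a := P.idealUX) (Ideal.subset_span ⟨l, i, h, rfl⟩)

/-- The ideal generated by the coordinates `g j e` with `c j ≤ e ≤ n j`. -/
def idealCoord (g : D.Scr → ℕ → R) (c : D.Scr → ℕ) : Ideal R :=
  Ideal.span {r | ∃ j e, c j ≤ e ∧ e ≤ D.n j ∧ r = g j e}

lemma coord_mem_idealCoord {g : D.Scr → ℕ → R} {c : D.Scr → ℕ} {j : D.Scr} {e : ℕ} (h : c j ≤ e)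
    (he : e ≤ D.n j) : g j e ∈ idealCoord g c :=
  Ideal.subset_span ⟨j, e, h, he, rfl⟩

open Classical in
/-- The prime ideal of the fibre over an eigenvalue. -/
noncomputable def idealFibre (c : k) (Λ : Set D.Jor) : Ideal R :=
  P.idealVec (fun l => if l ∈ Λ then 1 else 0) ⊔ idealCoord (P.powY c) (fun _ => 1)

/-- Let `λ` be the eigenvalue of `l₀` and `Λ` the set of indices on the right. In the model `k[s_j,
w_l][X] / X ^ (e + 1)` put `y j i ↦ (X + λ) ^ i * s_j` and `z l i ↦ X ^ i * w_l` for `l ∈ Λ`, all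
other generators going to `0`. Then `P.idealVec c` dies, while `z l₀ e` becomes `X ^ e * w_{l₀}`,
which is killed only by multiples of `X`. Setting `X = 0` gives the fibre over `λ`. -/
lemma colonElement_z (c : D.Jor → ℕ) (hc : ∀ l, c l ≤ D.p l) (l₀ : D.Jor) (e : ℕ)
    (he : c l₀ = e + 1) :
    colonElement (P.idealVec c) (P.z l₀ e) =
      P.idealFibre (D.ev l₀) {l | D.ev l = D.ev l₀ ∧ e + 1 ≤ c l} := by
  classical
  set Λ : Set D.Jor := {l | D.ev l = D.ev l₀ ∧ e + 1 ≤ c l} with hΛ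
  set H := P.idealFibre (D.ev l₀) Λ with hH
  have hzH : ∀ l i, (l ∉ Λ ∨ 1 ≤ i) → P.z l i ∈ H := by
    intro l i h
    refine le_sup_left (a := P.idealVec _) (P.z_mem_idealVec ?_)
    split_ifs with h1
    · exact h.resolve_left (not_not.2 h1)
    · exact Nat.zero_le _
  have hUXH : P.idealUX ≤ H := le_sup_left.trans le_sup_left
  apply le_antisymm
  · intro f hf
    rw [mem_colonElement, smul_eq_mul] at hf
    obtain ⟨T, _, _, π, ev, hsurj, hπ, hevπ⟩ :=
      exists_truncation k (MvPolynomial (D.Scr ⊕ D.Jor) k) (e + 1) e.succ_pos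
    set t : T := π (Polynomial.X + algebraMap k _ (D.ev l₀)) with ht
    have hπX : ∀ i, e + 1 ≤ i → π (Polynomial.X ^ i) = 0 := by
      intro i hi
      exact (hπ _).2 (pow_dvd_pow _ hi)
    let E : KWSystem T D := KWSystem.ofRatio D 1 t (fun _ _ => 0)
      (fun j i => t ^ i * π (Polynomial.C (X (Sum.inl j))))
      (fun l i => if l ∈ Λ then π (Polynomial.X ^ i) * π (Polynomial.C (X (Sum.inr l))) else 0)
      (fun _ => rfl) (fun _ _ _ => rfl) (by
        -- Beyond the end of a block in `Λ` the exponent is at least `D.p l ≥ c l ≥ e + 1`, so the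
        -- truncation kills the entry.
        intro l i hi
        split_ifs with h
        · rw [hπX i ((h.2.trans (hc l)).trans hi), zero_mul]
        · rfl) (by
        rintro _ _ (⟨a, i, hi⟩ | ⟨j, i, hi⟩ | ⟨l, i, hi⟩)
        · exact ⟨0, by simp, by simp⟩
        · exact ⟨_, (one_mul _).symm, by rw [pow_succ', mul_assoc]⟩
        · refine ⟨_, (one_mul _).symm, ?_⟩
          split_ifs with h
          · rw [h.1, pow_succ, map_mul]
            rw [ht, map_add, AlgHom.commutes, Algebra.smul_def]
            ring
          · simp)
    obtain ⟨δ, hx, hy, hz, hu⟩ := P.exists_lift T E (fun _ => 0)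
    let sec : MvPolynomial (D.Scr ⊕ D.Jor) k →ₐ[k] R :=
      aeval (Sum.elim (fun j => P.y j 0) (fun l => P.z l 0))
    -- The model, evaluation at `0` and the section compose to the quotient map modulo `H`; hence `f
    -- ∈ H` as soon as the image of `f` vanishes at `0`.
    have h1 : (((Ideal.Quotient.mkₐ k H).comp sec).comp ev).comp δ = Ideal.Quotient.mkₐ k H := by
      have hmk : ∀ r ∈ H, (Ideal.Quotient.mkₐ k H) r = 0 := fun r hr =>
        Ideal.Quotient.eq_zero_iff_mem.2 hr
      refine P.algHom_ext ?_ ?_ ?_ ?_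
      · intro a i
        rw [hmk _ (hUXH (P.x_mem_idealUX a i)), AlgHom.comp_apply, hx]
        exact map_zero _
      · intro j i hi
        have hE : E.y j i = t ^ i * π (Polynomial.C (X (Sum.inl j))) := rfl
        rw [AlgHom.comp_apply, hy j i hi, hE, ← map_pow, ← map_mul, AlgHom.comp_apply, hevπ,
          P.y_eq_sum_powY (D.ev l₀) j hi, map_sum, Finset.sum_eq_single 0]
        · rw [powY_zero, map_smul, Polynomial.eval_mul, Polynomial.eval_pow, Polynomial.eval_add,
            Polynomial.eval_X, zero_add, Polynomial.algebraMap_apply, Polynomial.eval_C,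
            Polynomial.eval_C, map_mul, map_pow, AlgHom.commutes, Nat.sub_zero,
            Nat.choose_zero_right,
            Nat.cast_one, mul_one, AlgHom.comp_apply, aeval_X, ← map_pow, ← Algebra.smul_def]
          rfl
        · intro e' he' hne
          rw [map_smul, hmk, smul_zero]
          refine le_sup_right (a := P.idealVec _) (coord_mem_idealCoord (by omega) ?_)
          have := Finset.mem_range.1 he'
          omega
        · simp
      · intro l i
        have hE : E.z l i = if l ∈ Λ then π (Polynomial.X ^ i) *
          π (Polynomial.C (X (Sum.inr l))) else 0 := rfl
        rw [AlgHom.comp_apply, hz l i, hE]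
        split_ifs with h
        · rw [← map_mul, AlgHom.comp_apply, hevπ]
          rcases Nat.eq_zero_or_pos i with rfl | hi
          · simp [sec]
          · rw [hmk _ (hzH l i (Or.inr hi))]
            simp [hi.ne']
        · rw [hmk _ (hzH l i (Or.inl h)), map_zero]
      · intro b
        rw [hmk _ (hUXH (P.u_mem_idealUX b)), AlgHom.comp_apply, hu]
        exact map_zero _
    have h2 : P.idealVec c ≤ RingHom.ker δ := by
      refine sup_le (P.idealUX_le hu hx) (Ideal.span_le.2 ?_)
      rintro _ ⟨l, i, hi, rfl⟩
      change δ (P.z l i) = 0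
      rw [hz]
      change (if l ∈ Λ then _ else _) = _
      split_ifs with h
      · rw [hπX i (h.2.trans hi), zero_mul]
      · rfl
    have hl₀ : l₀ ∈ Λ := ⟨rfl, he.ge⟩
    have h3 : δ f * (π (Polynomial.X ^ e) * π (Polynomial.C (X (Sum.inr l₀)))) = 0 := by
      have : δ (f * P.z l₀ e) = 0 := h2 hf
      rw [map_mul, hz] at this
      change _ * (if l₀ ∈ Λ then _ else _) = _ at this
      rwa [if_pos hl₀] at this
    obtain ⟨q, hq⟩ := hsurj (δ f)
    rw [← hq, ← map_mul, ← map_mul] at h3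
    have h4 := (hπ _).1 h3
    -- The factor `X ^ e` is cancelled in the polynomial ring, before truncation.
    have h5 : (Polynomial.X : Polynomial (MvPolynomial (D.Scr ⊕ D.Jor) k)) ∣
        q * Polynomial.C (X (Sum.inr l₀)) := by
      rw [mul_left_comm, pow_succ] at h4
      exact (mul_dvd_mul_iff_left (pow_ne_zero e Polynomial.X_ne_zero)).1 h4
    have h6 : Polynomial.eval 0 q = 0 := by
      rw [Polynomial.X_dvd_iff, Polynomial.mul_coeff_zero, Polynomial.coeff_C_zero] at h5
      rw [← Polynomial.coeff_zero_eq_eval_zero]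
      exact (mul_eq_zero.1 h5).resolve_right (X_ne_zero _)
    have h7 := congrArg (fun φ => φ f) h1
    simp only [AlgHom.comp_apply, ← hq, hevπ, h6, map_zero] at h7
    exact Ideal.Quotient.eq_zero_iff_mem.1 h7.symm
  · have key : H ≤ colonElement (P.idealVec c) (P.z l₀ e) := by
      refine sup_le (sup_le ?_ (Ideal.span_le.2 ?_)) (Ideal.span_le.2 ?_)
      · intro r hr
        exact mem_colonElement.2 (Ideal.mul_mem_right _ _ (le_sup_left (a := P.idealUX) hr))
      · rintro _ ⟨l, i, hi, rfl⟩
        refine mem_colonElement.2 ?_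
        rw [smul_eq_mul, mul_comm]
        by_cases hev : D.ev l = D.ev l₀
        swap
        · rw [P.z_mul_z_of_ne (Ne.symm hev)]
          exact zero_mem _
        -- For `i = 0` the block lies outside `Λ`, so `c l ≤ e` and the product equals `z l₀ (e - c
        -- l) * z l (c l)`. For `i > 0` one unit of index moves to the factor `z l₀ e`.
        rcases Nat.eq_zero_or_pos i with rfl | hi'
        · have hl : l ∉ Λ := by
            intro h
            simp [h] at hi
          have hcl : c l ≤ e := by
            by_contra hlt
            exact hl ⟨hev, by omega⟩
          have := P.z_mul_z_add hev.symm (e - c l) 0 (c l)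
          rw [Nat.sub_add_cancel hcl, zero_add] at this
          rw [← this]
          exact Ideal.mul_mem_left _ _ (P.z_mem_idealVec le_rfl)
        · obtain ⟨i', rfl⟩ := Nat.exists_eq_succ_of_ne_zero hi'.ne'
          rw [Nat.succ_eq_add_one, P.z_mul_z_succ hev.symm]
          exact Ideal.mul_mem_right _ _ (P.z_mem_idealVec he.le)
      · rintro _ ⟨j, e', h1, h2, rfl⟩
        refine mem_colonElement.2 ?_
        obtain ⟨e'', rfl⟩ : ∃ e'', e' = 1 + e'' := Nat.exists_eq_add_of_le h1
        rw [smul_eq_mul, powY, add_comm 1, pow_succ',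
          P.polyY_sub_mul_z l₀ j (natDegree_X_sub_C_pow_lt (by omega))]
        exact Ideal.mul_mem_left _ _ (P.z_mem_idealVec he.le)
    exact key

end KWPresentation

namespace KWPresentation

variable {k : Type v} [Field k] {D : KWShape k} {U : Type} {R : Type v} [CommRing R]
  [Algebra k R] (P : KWPresentation D U R)

/-! ### Colon ideals by entries of nilpotent blocks -/

/-- The ideal generated by the free variables, the entries of the nilpotent blocks and the Jordan
blocks and the entries of the scroll blocks at the distance at least `i₀` from the end or at the
distance at least `q` from the beginning. -/
def idealEnds (i₀ q : ℕ) : Ideal R :=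
  P.idealUXZ ⊔ Ideal.span {r | ∃ j i, i ≤ D.n j ∧ (i + i₀ ≤ D.n j ∨ q ≤ i) ∧ r = P.y j i}

lemma y_mem_idealEnds {i₀ q : ℕ} {j : D.Scr} {i : ℕ} (hi : i ≤ D.n j)
    (h : i + i₀ ≤ D.n j ∨ q ≤ i) : P.y j i ∈ P.idealEnds i₀ q :=
  le_sup_right (a := P.idealUXZ) (Ideal.subset_span ⟨j, i, hi, h, rfl⟩)

/-- The ideal generated by all free variables and the entries of some of the nilpotent blocks. -/
def idealNil (s : Set D.Nil) : Ideal R :=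
  Ideal.span (Set.range P.u ∪ {r | ∃ a ∈ s, ∃ i, r = P.x a i})

lemma idealNil_le {s : Set D.Nil} {I : Ideal R} (hu : ∀ b, P.u b ∈ I)
    (hx : ∀ a ∈ s, ∀ i, P.x a i ∈ I) : P.idealNil s ≤ I := by
  refine Ideal.span_le.2 ?_
  rintro r (⟨b, rfl⟩ | ⟨a, ha, i, rfl⟩)
  · exact hu b
  · exact hx a ha i

lemma u_mem_idealNil (s : Set D.Nil) (b : U) : P.u b ∈ P.idealNil s :=
  Ideal.subset_span (Or.inl ⟨b, rfl⟩)

lemma x_mem_idealNil {s : Set D.Nil} {a : D.Nil} (ha : a ∈ s) (i : ℕ) :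
    P.x a i ∈ P.idealNil s :=
  Ideal.subset_span (Or.inr ⟨a, ha, i, rfl⟩)

/-- Exchanging the beginnings and the ends of the blocks. -/
def flipBlocks {S : Type*} (n : S → ℕ) (s : Multiset (S × ℕ)) : Multiset (S × ℕ) :=
  s.map fun q => (q.1, n q.1 - q.2)

lemma isAdmissible_flipBlocks {S : Type*} (n : S → ℕ) (s : Multiset (S × ℕ)) :
    IsAdmissible n (flipBlocks n s) := by
  intro q hq
  obtain ⟨q', -, rfl⟩ := Multiset.mem_map.1 hq
  exact Nat.sub_le _ _

lemma blockDegree_flipBlocks_snd {S : Type*} (n : S → ℕ) (s : Multiset (S × ℕ)) :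
    (blockDegree (flipBlocks n s)).2 = (blockDegree s).2 := by
  simp [blockDegree, flipBlocks]

lemma blockDegree_flipBlocks_fst {S : Type*} {n : S → ℕ} {s : Multiset (S × ℕ)}
    (hs : IsAdmissible n s) :
    (blockDegree (flipBlocks n s)).1 = ((blockDegree s).2.map n).sum - (blockDegree s).1 := by
  suffices (blockDegree (flipBlocks n s)).1 + (blockDegree s).1 = ((blockDegree s).2.map n).sum by
    omega
  induction s using Multiset.induction_on with
  | empty => rfl
  | cons q s ih =>
    rw [isAdmissible_cons] at hs
    have := ih hs.2
    simp only [blockDegree, flipBlocks, Multiset.map_cons, Multiset.sum_cons, Multiset.map_map,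
      Function.comp_def] at this ⊢
    omega

lemma blockProd_revY (s : Multiset (D.Scr × ℕ)) :
    blockProd P.revY s = blockProd P.y (flipBlocks D.n s) := by
  simp [blockProd, flipBlocks, revY]

lemma hasExchange_y : HasExchange D.n P.y := fun j j' _ _ h h' => P.y_mul_y_succ j j' h h'

/-- Exchange concentrates the index of a monomial in one of its blocks. The bounds `i₀ ≤ D.n j` and
`q ≤ D.n j` guarantee that this block has room for an entry of the required index. -/
lemma blockProd_revY_mem_idealEnds {i₀ q : ℕ} (h₀ : 0 < i₀) (hq : 0 < q) (hi₀ : ∀ j, i₀ ≤ D.n j)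
    (hqn : ∀ j, q ≤ D.n j) {s : Multiset (D.Scr × ℕ)} (hs : IsAdmissible D.n s)
    (h : i₀ ≤ (blockDegree s).1 ∨ q ≤ (blockDegree (flipBlocks D.n s)).1) :
    blockProd P.revY s ∈ P.idealEnds i₀ q := by
  obtain ⟨j, hj⟩ : ∃ j, j ∈ (blockDegree s).2 := by
    by_contra! hne
    have : s = 0 := by
      have h1 : (blockDegree s).2 = 0 := Multiset.eq_zero_of_forall_notMem hne
      simpa [blockDegree] using h1
    subst this
    simp [flipBlocks] at h
    omega
  rcases h with h | h
  · obtain ⟨e, he, hen, r, hr⟩ := exists_blockProd_eq_mul P.isScrollCoord_revY.exchange hs hj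
      (hi₀ j) h
    rw [hr]
    exact Ideal.mul_mem_left _ _ (P.y_mem_idealEnds (Nat.sub_le _ _) (Or.inl (by omega)))
  · rw [← blockDegree_flipBlocks_snd D.n] at hj
    obtain ⟨e, he, hen, r, hr⟩ := exists_blockProd_eq_mul P.hasExchange_y
      (isAdmissible_flipBlocks D.n s) hj (hqn j) h
    rw [blockProd_revY, hr]
    exact Ideal.mul_mem_left _ _ (P.y_mem_idealEnds hen (Or.inr he))

/-- The model is the toric ring with `y j i ↦ σ ^ (n j - i) * τ ^ i * s_j` and `x a₀ i ↦ σ ^ (m - i)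
* τ ^ i * ξ`, modulo `σ ^ m * ξ` and `τ ^ m * ξ`. A scroll monomial containing `σ ^ a * τ ^ b` kills
`x a₀ i₀ = σ ^ q * τ ^ i₀ * ξ` exactly if `i₀ ≤ a` or `q ≤ b`. -/
lemma colonElement_x_le {s : Set D.Nil} {a₀ : D.Nil} (ha₀ : a₀ ∉ s) {i₀ q : ℕ} (h₀ : 0 < i₀)
    (hq : 0 < q) (hm : i₀ + q = D.m a₀) (hi₀ : ∀ j, i₀ ≤ D.n j) (hqn : ∀ j, q ≤ D.n j) :
    colonElement (P.idealNil s) (P.x a₀ i₀) ≤ P.idealEnds i₀ q := by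
  classical
  intro f hf
  rw [mem_colonElement, smul_eq_mul] at hf
  -- The components are the exponents of `σ`, `τ`, `ξ` and the multiset of blocks.
  let bad : Set (ℕ × ℕ × ℕ × Multiset D.Scr) := {d | 1 ≤ d.2.2.1 ∧ (D.m a₀ ≤ d.1 ∨ D.m a₀ ≤ d.2.1)}
  obtain ⟨T, _, _, π, hπ⟩ : ∃ (T : Type v) (_ : CommRing T) (_ : Algebra k T)
      (π : AddMonoidAlgebra k (ℕ × ℕ × ℕ × Multiset D.Scr) →ₐ[k] T),
      ∀ w, π w = 0 ↔ w ∈ Ideal.span (AddMonoidAlgebra.of' k _ '' bad) :=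
    ⟨_ ⧸ Ideal.span (AddMonoidAlgebra.of' k _ '' bad), inferInstance, inferInstance,
      Ideal.Quotient.mkₐ k _, fun w => Ideal.Quotient.eq_zero_iff_mem⟩
  have hbad : ∀ d ∈ bad, π (AddMonoidAlgebra.single d 1) = 0 := fun d hd =>
    (hπ _).2 (Ideal.subset_span ⟨d, hd, rfl⟩)
  let E : KWSystem T D := KWSystem.ofRatio D (π (AddMonoidAlgebra.single (1, 0, 0, 0) 1))
    (π (AddMonoidAlgebra.single (0, 1, 0, 0) 1))
    (fun a i => if a = a₀ then π (AddMonoidAlgebra.single (D.m a - i, i, 1, 0) 1) else 0)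
    (fun j i => π (AddMonoidAlgebra.single (D.n j - i, i, 0, {j}) 1))
    (fun _ _ => 0) (by
      intro a
      split_ifs with h
      · subst h
        exact hbad _ ⟨le_rfl, Or.inl le_rfl⟩
      · rfl) (by
      intro a i hi
      split_ifs with h
      · subst h
        exact hbad _ ⟨le_rfl, Or.inr hi⟩
      · rfl) (fun _ _ _ => rfl) (by
      rintro _ _ (⟨a, i, hi⟩ | ⟨j, i, hi⟩ | ⟨l, i, hi⟩)
      · refine ⟨if a = a₀ then π (AddMonoidAlgebra.single (D.m a - (i + 1), i, 1, 0) 1) else 0,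
          ?_, ?_⟩
        · split_ifs
          · rw [← map_mul, AddMonoidAlgebra.single_mul_single, mul_one]
            exact congrArg (fun d => π (AddMonoidAlgebra.single d 1))
              (Prod.ext (by simp; try omega) (Prod.ext (by simp; try omega) (by simp)))
          · rw [mul_zero]
        · split_ifs
          · rw [← map_mul, AddMonoidAlgebra.single_mul_single, mul_one]
            exact congrArg (fun d => π (AddMonoidAlgebra.single d 1))
              (Prod.ext (by simp; try omega) (Prod.ext (by simp; try omega) (by simp)))
          · rw [mul_zero]
      · refine ⟨π (AddMonoidAlgebra.single (D.n j - (i + 1), i, 0, {j}) 1), ?_, ?_⟩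
        · rw [← map_mul, AddMonoidAlgebra.single_mul_single, mul_one]
          exact congrArg (fun d => π (AddMonoidAlgebra.single d 1))
              (Prod.ext (by simp; try omega) (Prod.ext (by simp; try omega) (by simp)))
        · rw [← map_mul, AddMonoidAlgebra.single_mul_single, mul_one]
          exact congrArg (fun d => π (AddMonoidAlgebra.single d 1))
              (Prod.ext (by simp; try omega) (Prod.ext (by simp; try omega) (by simp)))
      · exact ⟨0, by simp, by simp⟩)
  obtain ⟨δ, hx, hy, hz, hu⟩ := P.exists_lift T E (fun _ => 0)
  have hEx : ∀ a i, δ (P.x a i) =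
    if a = a₀ then π (AddMonoidAlgebra.single (D.m a - i, i, 1, 0) 1) else 0 := hx
  have hEy : ∀ j i, i ≤ D.n j →
    δ (P.y j i) = π (AddMonoidAlgebra.single (D.n j - i, i, 0, {j}) 1) := hy
  have hJ : P.idealNil s ≤ RingHom.ker δ := by
    refine P.idealNil_le hu fun a ha i => ?_
    change δ (P.x a i) = 0
    rw [hEx, if_neg (by rintro rfl; exact ha₀ ha)]
  have hδs : ∀ s, IsAdmissible D.n s → δ (blockProd P.revY s) =
      π (AddMonoidAlgebra.single ((blockDegree s).1, (blockDegree (flipBlocks D.n s)).1, 0,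
        (blockDegree s).2) 1) := by
    intro s
    induction s using Multiset.induction_on with
    | empty =>
      intro _
      rw [blockProd_zero, map_one]
      exact (map_one π).symm
    | cons q s ih =>
      intro hs
      rw [isAdmissible_cons] at hs
      rw [blockProd_cons, map_mul, ih hs.2, revY, hEy _ _ (Nat.sub_le _ _), ← map_mul,
        AddMonoidAlgebra.single_mul_single, mul_one, Nat.sub_sub_self hs.1]
      simp [blockDegree, flipBlocks]
  obtain ⟨Mon, l, hMon, hl, hfl⟩ := P.isScrollCoord_revY.exists_linearCombination f
  set f₀ := Finsupp.linearCombination k Mon l with hf₀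
  have hUXZ : ∀ r ∈ P.idealUXZ, δ (r * P.x a₀ i₀) = 0 := by
    have : P.idealUXZ ≤ colonElement (RingHom.ker δ) (P.x a₀ i₀) := by
      refine P.idealUXZ_le (fun b => ?_) (fun a i => ?_) (fun l i => ?_)
      · exact mem_colonElement.2 (Ideal.mul_mem_right _ _ (hu b))
      · rw [mem_colonElement, smul_eq_mul, P.x_mul_x]
        exact zero_mem _
      · rw [mem_colonElement, smul_eq_mul, P.z_mul_x]
        exact zero_mem _
    exact fun r hr => mem_colonElement.1 (this hr)
  -- `φ d` is the exponent of a scroll monomial of degree `d` times `x a₀ i₀`; injectivity of `φ`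
  -- excludes cancellation between different degrees.
  let φ : ℕ × Multiset D.Scr → ℕ × ℕ × ℕ × Multiset D.Scr := fun d =>
    (d.1 + q, (d.2.map D.n).sum - d.1 + i₀, 1, d.2)
  have hφ : Function.Injective φ := by
    rintro ⟨a, b⟩ ⟨a', b'⟩ h
    simp only [φ, Prod.mk.injEq] at h
    exact Prod.ext (by simpa using h.1) h.2.2.2
  have hδf₀ : δ (f₀ * P.x a₀ i₀) = π (AddMonoidAlgebra.ofCoeff (Finsupp.mapDomain φ l)) := by
    rw [hf₀, Finsupp.linearCombination_apply, Finsupp.sum_mul, map_finsuppSum, Finsupp.mapDomain,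
      AddMonoidAlgebra.ofCoeff_finsuppSum, map_finsuppSum]
    refine Finsupp.sum_congr fun d hd => ?_
    obtain ⟨s, hs, rfl⟩ := hl d hd
    rw [map_mul, map_smul, hMon s hs, hδs s hs, hEx, if_pos rfl, smul_mul_assoc, ← map_mul,
      AddMonoidAlgebra.single_mul_single, mul_one, ← map_smul]
    congr 1
    simp only [φ, blockDegree_flipBlocks_fst hs]
    simp [← hm]
  have h0 : π (AddMonoidAlgebra.ofCoeff (Finsupp.mapDomain φ l)) = 0 := by
    rw [← hδf₀]
    have h1 : δ (f * P.x a₀ i₀) = 0 := hJ hf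
    have h2 := hUXZ _ hfl
    rw [sub_mul, map_sub, h1, zero_sub, neg_eq_zero] at h2
    exact h2
  rw [hπ, AddMonoidAlgebra.mem_ideal_span_of'_image] at h0
  have hf₀H : f₀ ∈ P.idealEnds i₀ q := by
    rw [hf₀, Finsupp.linearCombination_apply]
    refine Ideal.sum_mem _ fun d hd => ?_
    obtain ⟨s, hs, rfl⟩ := hl d hd
    simp only
    rw [hMon s hs, Algebra.smul_def]
    refine Ideal.mul_mem_left _ _ (P.blockProd_revY_mem_idealEnds h₀ hq hi₀ hqn hs ?_)
    obtain ⟨d', hd', c, hc⟩ := h0 (φ (blockDegree s)) (by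
      rw [Finsupp.mem_support_iff] at hd ⊢
      rw [AddMonoidAlgebra.coeff_ofCoeff, Finsupp.mapDomain_apply hφ]
      exact hd)
    have e1 := congrArg (fun d => d.1) hc
    have e2 := congrArg (fun d => d.2.1) hc
    simp only [φ, Prod.fst_add, Prod.snd_add] at e1 e2
    rw [← blockDegree_flipBlocks_fst hs] at e2
    rcases hd'.2 with h | h
    · left; omega
    · right; omega
  have := add_mem (le_sup_left (a := P.idealUXZ) hfl) hf₀H
  rwa [sub_add_cancel] at this

lemma colonElement_x {s : Set D.Nil} {a₀ : D.Nil} (ha₀ : a₀ ∉ s) {i₀ q : ℕ} (h₀ : 0 < i₀)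
    (hq : 0 < q) (hm : i₀ + q = D.m a₀) (hi₀ : ∀ j, i₀ ≤ D.n j) (hqn : ∀ j, q ≤ D.n j) :
    colonElement (P.idealNil s) (P.x a₀ i₀) = P.idealEnds i₀ q := by
  refine le_antisymm (P.colonElement_x_le ha₀ h₀ hq hm hi₀ hqn) ?_
  refine sup_le (P.idealUXZ_le (fun b => ?_) (fun a i => ?_) (fun l i => ?_))
    (Ideal.span_le.2 ?_)
  · exact mem_colonElement.2 (Ideal.mul_mem_right _ _ (P.u_mem_idealNil s b))
  · rw [mem_colonElement, smul_eq_mul, P.x_mul_x]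
    exact zero_mem _
  · rw [mem_colonElement, smul_eq_mul, P.z_mul_x]
    exact zero_mem _
  · rintro _ ⟨j, i, hi, h, rfl⟩
    refine mem_colonElement.2 ?_
    rw [smul_eq_mul]
    rcases h with h | h
    · rw [P.y_mul_x_eq_zero_of_le j a₀ h]
      exact zero_mem _
    · rw [P.y_mul_x_eq_zero_of_ge j a₀ hi (by omega)]
      exact zero_mem _

/-! ### Colon ideals by entries of scroll blocks -/

-- A threshold above `D.n j` means that the block `j` contributes no generator. A monomial lies in
-- the coordinate ideal as soon as some block `j` in it has `β j ≤ D.n j` and the total index is at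
-- least `β j`. After multiplication by `g j₀ e₀`, the block `j₀` is present and lacks only one unit
-- of index, whereas any block `j` of the monomial itself lacks `β j - e₀`. The minimum of the two
-- bounds is the new threshold.
open Classical in
lemma IsScrollCoord.colonElement_coord {P : KWPresentation D U R} {g : D.Scr → ℕ → R}
    (hg : P.IsScrollCoord g) {J : Ideal R} (hJ : J ≤ P.idealUXZ) (β : D.Scr → ℕ) {j₀ : D.Scr}
    {e₀ : ℕ} (he₀ : β j₀ = e₀ + 1) (hn : e₀ ≤ D.n j₀) (hmul : ∀ r ∈ P.idealUXZ, r * g j₀ e₀ ∈ J) :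
    ∃ β' : D.Scr → ℕ, colonElement (J ⊔ idealCoord g β) (g j₀ e₀) =
      P.idealUXZ ⊔ idealCoord g β' := by
  refine ⟨fun j => min (if β j₀ ≤ D.n j₀ then 1 else D.n j + 1)
    (if β j ≤ D.n j then β j - e₀ else D.n j + 1), ?_⟩
  set β' : D.Scr → ℕ := fun j => min (if β j₀ ≤ D.n j₀ then 1 else D.n j + 1)
    (if β j ≤ D.n j then β j - e₀ else D.n j + 1) with hβ'
  have hβ : ∀ j e, e ≤ D.n j →
      (β' j ≤ e ↔ (β j₀ ≤ D.n j₀ ∧ 1 ≤ e) ∨ (β j ≤ D.n j ∧ β j ≤ e + e₀)) := by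
    intro j e he
    simp only [hβ']
    split_ifs <;> omega
  refine hg.colonElement_eq hn le_sup_left ?_
    {d | ∃ j ∈ d.2, β j ≤ D.n j ∧ β j ≤ d.1} ?_ ?_ ?_
  · have : P.idealUXZ ⊔ idealCoord g β' ≤ colonElement (J ⊔ idealCoord g β) (g j₀ e₀) := by
      refine sup_le (fun r hr => ?_) (Ideal.span_le.2 ?_)
      · exact mem_colonElement.2 (le_sup_left (a := J) (hmul r hr))
      · rintro _ ⟨j, e, he, hen, rfl⟩
        refine mem_colonElement.2 (le_sup_right (a := J) ?_)
        have hs : IsAdmissible D.n {(j, e), (j₀, e₀)} := by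
          intro q hq
          simp only [Multiset.insert_eq_cons, Multiset.mem_cons, Multiset.mem_singleton] at hq
          rcases hq with rfl | rfl
          · exact hen
          · exact hn
        have hp : g j e • g j₀ e₀ = blockProd g {(j, e), (j₀, e₀)} := by simp [blockProd]
        rw [hp]
        rcases (hβ j e hen).1 he with ⟨h1, h2⟩ | ⟨h1, h2⟩
        · obtain ⟨e', h3, h4, r, hr⟩ := exists_blockProd_eq_mul hg.exchange hs (j := j₀)
            (b := β j₀) (by simp [blockDegree]) h1 (by simp [blockDegree]; omega)
          rw [hr]
          exact Ideal.mul_mem_left _ _ (coord_mem_idealCoord h3 h4)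
        · obtain ⟨e', h3, h4, r, hr⟩ := exists_blockProd_eq_mul hg.exchange hs (j := j)
            (b := β j) (by simp [blockDegree]) h1 (by simp [blockDegree]; omega)
          rw [hr]
          exact Ideal.mul_mem_left _ _ (coord_mem_idealCoord h3 h4)
    intro r hr
    simpa using mem_colonElement.1 (this hr)
  · rintro d ⟨j, hj, h1, h2⟩ d'
    refine ⟨j, Multiset.mem_add.2 (Or.inr hj), h1, ?_⟩
    rw [Prod.fst_add]
    omega
  · refine ⟨_, sup_le_sup_right hJ _, ?_⟩
    rintro _ ⟨j, e, h1, h2, rfl⟩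
    exact ⟨j, e, h2, rfl, j, by simp, by omega, h1⟩
  · rintro s hs ⟨j, hj, h1, h2⟩
    refine le_sup_right (a := P.idealUXZ) ?_
    simp only [Prod.fst_add, Prod.snd_add, Multiset.mem_add, Multiset.mem_singleton] at hj h2
    have hcase : j ∈ (blockDegree s).2 ∨ (j = j₀ ∧ j ∉ (blockDegree s).2) := by tauto
    rcases hcase with hj | ⟨rfl, -⟩
    · obtain ⟨e', h3, h4, r, hr⟩ := exists_blockProd_eq_mul hg.exchange hs hj
        (b := β j - e₀) (by omega) (by omega)
      rw [hr]
      exact Ideal.mul_mem_left _ _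
        (coord_mem_idealCoord ((hβ j e' h4).2 (Or.inr ⟨h1, by omega⟩)) h4)
    · obtain ⟨⟨j', e'⟩, hq, hne⟩ : ∃ q ∈ s, q.2 ≠ 0 := by
        by_contra! h
        have : (blockDegree s).1 = 0 := Multiset.sum_eq_zero fun x hx => by
          obtain ⟨q, hq, rfl⟩ := Multiset.mem_map.1 hx
          exact h q hq
        omega
      obtain ⟨t, rfl⟩ := Multiset.exists_cons_of_mem hq
      have h5 := hs _ hq
      rw [blockProd_cons]
      exact Ideal.mul_mem_right _ _ (coord_mem_idealCoord
        ((hβ j' e' h5).2 (Or.inl ⟨h1, Nat.one_le_iff_ne_zero.2 hne⟩)) h5)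

end KWPresentation

/-! ### The Koszul filtration -/

/-- Descending induction from `b`, lowering one coordinate by one at a time; for thresholds of
ideals each such step adds one generator. -/
lemma forall_le_of_update {ι : Type*} [Finite ι] [DecidableEq ι] (b : ι → ℕ)
    (Q : (ι → ℕ) → Prop) (h0 : Q b)
    (hstep : ∀ c, c ≤ b → ∀ l e, c l = e + 1 → Q c → Q (Function.update c l e)) :
    ∀ c, c ≤ b → Q c := by
  have := Fintype.ofFinite ι
  intro c
  induction hN : ∑ l, (b l - c l) using Nat.strong_induction_on generalizing c with
  | _ N ih =>
    intro hc
    by_cases h : ∃ l, c l < b l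
    · obtain ⟨l, hl⟩ := h
      have hle : Function.update c l (c l + 1) ≤ b := by
        intro l'
        by_cases h : l' = l
        · subst h; simpa using hl
        · simpa [h] using hc l'
      have := hstep _ hle l (c l) (by simp) (ih _ ?_ (Function.update c l (c l + 1)) rfl hle)
      · simpa using this
      · rw [← hN]
        refine Finset.sum_lt_sum (fun l' _ => ?_) ⟨l, Finset.mem_univ _, ?_⟩
        · by_cases h : l' = l
          · subst h; simp; omega
          · simp [h]
        · simp; omega
    · push Not at h
      rwa [le_antisymm hc h]

/-! ### Adding elements that are annihilated by the maximal ideal -/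

section Flag

variable {k R : Type*} [Field k] [CommRing R] [Algebra k R]

/-- Either the colon ideal is `𝔪` itself, or it contains an element with nonzero constant part; in
the latter case `h` already belongs to `J` and nothing is added. -/
lemma IdealFlag.sup_span_singleton {F : Set (Ideal R)} {L : Submodule k R} {𝔪 J : Ideal R}
    (h𝔪 : 𝔪 ∈ F) (hres : ∀ r, ∃ c : k, r - algebraMap k R c ∈ 𝔪) (hJ : IdealFlag F L J) {h : R}
    (hL : h ∈ L) (hmul : ∀ r ∈ 𝔪, r * h ∈ J) : IdealFlag F L (J ⊔ Ideal.span {h}) := by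
  by_cases hle : colonElement J h ≤ 𝔪
  · refine .step J h hJ hL ?_
    rwa [le_antisymm hle fun r hr => mem_colonElement.2 (hmul r hr)]
  · obtain ⟨r, hr, hrm⟩ := SetLike.not_le_iff_exists.1 hle
    obtain ⟨c, hc⟩ := hres r
    have hc0 : c ≠ 0 := by
      rintro rfl
      rw [map_zero, sub_zero] at hc
      exact hrm hc
    have h1 : algebraMap k R c * h ∈ J := by
      have := sub_mem (mem_colonElement.1 hr) (hmul _ hc)
      rwa [smul_eq_mul, sub_mul, sub_sub_cancel] at this
    have h2 : h ∈ J := by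
      have := Ideal.mul_mem_left J (algebraMap k R c⁻¹) h1
      rwa [← mul_assoc, ← map_mul, inv_mul_cancel₀ hc0, map_one, one_mul] at this
    rwa [sup_eq_left.2 ((Ideal.span_singleton_le_iff_mem _).2 h2)]

lemma IdealFlag.sup_span_finite {F : Set (Ideal R)} {L : Submodule k R} {𝔪 J : Ideal R}
    (h𝔪 : 𝔪 ∈ F) (hres : ∀ r, ∃ c : k, r - algebraMap k R c ∈ 𝔪) (hJ : IdealFlag F L J) {G : Set R}
    (hG : G.Finite) (hL : G ⊆ L) (hmul : ∀ r ∈ 𝔪, ∀ h ∈ G, r * h ∈ J) :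
    IdealFlag F L (J ⊔ Ideal.span G) := by
  induction G, hG using Set.Finite.induction_on with
  | empty => simpa using hJ
  | @insert h G _ _ ih =>
    have h1 := ih (fun x hx => hL (Set.mem_insert_of_mem _ hx))
      fun r hr x hx => hmul r hr x (Set.mem_insert_of_mem _ hx)
    rw [Ideal.span_insert, sup_comm (Ideal.span {h}), ← sup_assoc]
    exact h1.sup_span_singleton h𝔪 hres (hL (Set.mem_insert _ _)) fun r hr =>
      le_sup_left (a := J) (hmul r hr h (Set.mem_insert _ _))

end Flag

namespace KWPresentation

variable {k : Type v} [Field k] {D : KWShape k} {U : Type} {R : Type v} [CommRing R]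
  [Algebra k R] (P : KWPresentation D U R)

/-- The ideals of the Koszul filtration. -/
inductive KoszulFamily : Ideal R → Prop
  | free (s : Set U) : KoszulFamily (Ideal.span (P.u '' s))
  | ends (i₀ q : ℕ) : 0 < i₀ → 0 < q → (∀ j, i₀ ≤ D.n j) → (∀ j, q ≤ D.n j) →
      KoszulFamily (P.idealEnds i₀ q)
  | fibre (c : k) (Λ : Set D.Jor) : (∀ l ∈ Λ, D.ev l = c) → KoszulFamily (P.idealFibre c Λ)
  | coord (g : D.Scr → ℕ → R) (β : D.Scr → ℕ) : P.IsScrollCoord g →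
      KoszulFamily (P.idealUXZ ⊔ idealCoord g β)

/-- The ideal generated by all the generators. -/
def idealMax : Ideal R := P.idealUXZ ⊔ idealCoord P.revY (fun _ => 0)

lemma idealMax_le {I : Ideal R} (hu : ∀ b, P.u b ∈ I) (hx : ∀ a i, P.x a i ∈ I)
    (hz : ∀ l i, P.z l i ∈ I) (hy : ∀ j i, i ≤ D.n j → P.y j i ∈ I) : P.idealMax ≤ I := by
  refine sup_le (P.idealUXZ_le hu hx hz) (Ideal.span_le.2 ?_)
  rintro _ ⟨j, e, -, he, rfl⟩
  exact hy j _ (Nat.sub_le _ _)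

lemma y_mem_idealMax {j : D.Scr} {i : ℕ} (hi : i ≤ D.n j) : P.y j i ∈ P.idealMax := by
  refine le_sup_right (a := P.idealUXZ) (Ideal.subset_span ⟨j, D.n j - i, Nat.zero_le _,
    Nat.sub_le _ _, ?_⟩)
  rw [revY, Nat.sub_sub_self hi]

lemma idealUXZ_le_idealMax : P.idealUXZ ≤ P.idealMax := le_sup_left

lemma exists_sub_algebraMap_mem_idealMax (r : R) : ∃ c : k, r - algebraMap k R c ∈ P.idealMax := by
  have hr : r ∈ (⊤ : Subalgebra k R) := trivial
  rw [← P.adjoin_eq_top] at hr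
  induction hr using Algebra.adjoin_induction with
  | mem r hr =>
    refine ⟨0, ?_⟩
    rw [map_zero, sub_zero]
    rcases hr with ((⟨a, i, rfl⟩ | ⟨j, i, hi, rfl⟩) | ⟨l, i, rfl⟩) | ⟨b, rfl⟩
    · exact P.idealUXZ_le_idealMax (P.idealUX_le_idealUXZ (P.x_mem_idealUX a i))
    · exact P.y_mem_idealMax hi
    · exact P.idealUXZ_le_idealMax (P.z_mem_idealUXZ l i)
    · exact P.idealUXZ_le_idealMax (P.idealUX_le_idealUXZ (P.u_mem_idealUX b))
  | algebraMap c => exact ⟨c, by rw [sub_self]; exact zero_mem _⟩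
  | add r r' _ _ h h' =>
    obtain ⟨c, hc⟩ := h
    obtain ⟨c', hc'⟩ := h'
    exact ⟨c + c', by rw [map_add, add_sub_add_comm]; exact add_mem hc hc'⟩
  | mul r r' _ _ h h' =>
    obtain ⟨c, hc⟩ := h
    obtain ⟨c', hc'⟩ := h'
    refine ⟨c * c', ?_⟩
    have : r * r' - algebraMap k R (c * c') =
        (r - algebraMap k R c) * r' + algebraMap k R c * (r' - algebraMap k R c') := by
      rw [map_mul]; ring
    rw [this]
    exact add_mem (Ideal.mul_mem_right _ _ hc) (Ideal.mul_mem_left _ _ hc')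

lemma koszulFamily_idealMax : P.KoszulFamily P.idealMax := .coord _ _ P.isScrollCoord_revY

/-- All the generators lie in the subspace `L`. -/
structure GeneratorsIn (L : Submodule k R) : Prop where
  u : ∀ b, P.u b ∈ L
  x : ∀ a i, P.x a i ∈ L
  y : ∀ j i, i ≤ D.n j → P.y j i ∈ L
  z : ∀ l i, P.z l i ∈ L

variable {P} {L : Submodule k R}

lemma IsScrollCoord.mem_of_generatorsIn {g : D.Scr → ℕ → R} (hg : P.IsScrollCoord g)
    (hL : P.GeneratorsIn L) {j : D.Scr} {e : ℕ} (he : e ≤ D.n j) : g j e ∈ L := by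
  refine (Submodule.span_le.2 ?_) (hg.mem_y j e he)
  rintro _ ⟨i, hi, rfl⟩
  exact hL.y j i hi

lemma idealFlag_free [Finite U] (hL : P.GeneratorsIn L) (s : Set U) :
    IdealFlag P.KoszulFamily L (Ideal.span (P.u '' s)) := by
  induction s, s.toFinite using Set.Finite.induction_on with
  | empty => simpa using IdealFlag.bot
  | @insert b s hb _ ih =>
    rw [Set.image_insert_eq, Ideal.span_insert, sup_comm]
    refine .step _ _ ih (hL.u b) ?_
    rw [P.colonElement_u s hb]
    exact .free s

/-- This is where the length condition acts. With `i₀ = D.m a / 2` and `q = D.m a - i₀`, both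
numbers are at most every `D.n j`, so the colon ideal by the middle entry is `P.idealEnds i₀ q`.
Modulo that entry the maximal ideal kills the rest of the block. -/
lemma idealFlag_idealNil [Finite U] (hL : P.GeneratorsIn L) (hmn : ∀ a j, D.m a ≤ 2 * D.n j)
    (s : Set D.Nil) : IdealFlag P.KoszulFamily L (P.idealNil s) := by
  induction s, s.toFinite using Set.Finite.induction_on with
  | empty =>
    have := idealFlag_free hL Set.univ
    simpa [idealNil] using this
  | @insert a s ha _ ih =>
    -- A block of length at most `1` has only zero entries.
    rcases le_or_gt (D.m a) 1 with hm | hm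
    · have : P.idealNil (insert a s) = P.idealNil s := by
        refine le_antisymm (P.idealNil_le (P.u_mem_idealNil s) ?_)
          (P.idealNil_le (P.u_mem_idealNil _) fun a ha i =>
            P.x_mem_idealNil (Set.mem_insert_of_mem _ ha) i)
        rintro a' (rfl | ha') i
        · rcases Nat.eq_zero_or_pos i with rfl | hi
          · rw [P.x_zero]; exact zero_mem _
          · rw [P.x_top _ _ (by omega)]; exact zero_mem _
        · exact P.x_mem_idealNil ha' i
      rwa [this]
    · set i₀ := D.m a / 2 with hi₀
      set q := D.m a - i₀ with hq
      have hi₀n : ∀ j, i₀ ≤ D.n j := fun j => by have := hmn a j; omega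
      have hqn : ∀ j, q ≤ D.n j := fun j => by have := hmn a j; omega
      have h1 : IdealFlag P.KoszulFamily L (P.idealNil s ⊔ Ideal.span {P.x a i₀}) := by
        refine .step _ _ ih (hL.x a i₀) ?_
        rw [P.colonElement_x ha (i₀ := i₀) (q := q) (by omega) (by omega) (by omega) hi₀n hqn]
        exact .ends i₀ q (by omega) (by omega) hi₀n hqn
      have h2 := h1.sup_span_finite P.koszulFamily_idealMax P.exists_sub_algebraMap_mem_idealMax
        (G := (fun i => P.x a i) '' Set.Iio (D.m a)) ((Set.finite_Iio _).image _)
        (by rintro _ ⟨i, -, rfl⟩; exact hL.x a i) (by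
          suffices H : ∀ i, P.idealMax ≤
              colonElement (P.idealNil s ⊔ Ideal.span {P.x a i₀}) (P.x a i) by
            rintro r hr _ ⟨i, -, rfl⟩
            exact mem_colonElement.1 (H i hr)
          intro i
          refine P.idealMax_le (fun b => ?_) (fun a' i' => ?_) (fun l i' => ?_)
            (fun j c hc => ?_)
          · exact mem_colonElement.2 (Ideal.mul_mem_right _ _
              (le_sup_left (a := P.idealNil s) (P.u_mem_idealNil s b)))
          · rw [mem_colonElement, smul_eq_mul, P.x_mul_x]
            exact zero_mem _
          · rw [mem_colonElement, smul_eq_mul, P.z_mul_x]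
            exact zero_mem _
          · rw [mem_colonElement, smul_eq_mul]
            have e1 := hi₀n j
            have e2 := hqn j
            by_cases h3 : c + i ≤ D.n j
            · rw [P.y_mul_x_eq_zero_of_le j a h3]
              exact zero_mem _
            by_cases h4 : D.m a ≤ c + i
            · rw [P.y_mul_x_eq_zero_of_ge j a hc h4]
              exact zero_mem _
            -- In the remaining range `D.n j < c + i < D.m a` the product shifts to a multiple of
            -- the middle entry; `i₀ ≤ D.n j` and `q ≤ D.n j` keep the index `c + i - i₀` between
            -- `0` and `D.n j`.
            have h5 : P.y j c * P.x a i = P.y j (c + i - i₀) * P.x a i₀ := by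
              rcases le_total i i₀ with h | h
              · have := P.y_add_mul_x j a (a := c + i - i₀) (c := i₀ - i) (by omega) i
                rwa [show c + i - i₀ + (i₀ - i) = c by omega,
                  show i + (i₀ - i) = i₀ by omega] at this
              · have := P.y_add_mul_x j a (a := c) (c := i - i₀) (by omega) i₀
                rw [show i₀ + (i - i₀) = i by omega] at this
                rw [← this]
                congr 2
                omega
            rw [h5]
            exact Ideal.mul_mem_left _ _ (le_sup_right (a := P.idealNil s)
              (Ideal.mem_span_singleton_self _)))
      convert h2 using 1
      apply le_antisymm
      · refine P.idealNil_le (fun b => ?_) ?_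
        · exact le_sup_left (a := P.idealNil s ⊔ Ideal.span {P.x a i₀})
            (le_sup_left (a := P.idealNil s) (P.u_mem_idealNil s b))
        · rintro a' (rfl | ha') i
          · rcases le_or_gt (D.m a') i with hi | hi
            · rw [P.x_top _ _ hi]
              exact zero_mem _
            · exact le_sup_right (a := P.idealNil s ⊔ Ideal.span {P.x a' i₀})
                (Ideal.subset_span ⟨i, hi, rfl⟩)
          · exact le_sup_left (a := P.idealNil s ⊔ Ideal.span {P.x a i₀})
              (le_sup_left (a := P.idealNil s) (P.x_mem_idealNil ha' i))
      · refine sup_le (sup_le ?_ ?_) (Ideal.span_le.2 ?_)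
        · exact P.idealNil_le (P.u_mem_idealNil _) fun a ha i =>
            P.x_mem_idealNil (Set.mem_insert_of_mem _ ha) i
        · rw [Ideal.span_singleton_le_iff_mem]
          exact P.x_mem_idealNil (Set.mem_insert _ _) _
        · rintro _ ⟨i, -, rfl⟩
          exact P.x_mem_idealNil (Set.mem_insert _ _) _

/-- On top of all free variables and nilpotent blocks, the Jordan entries are added from the end of
each block towards its beginning; the colon ideals are then the fibres of `colonElement_z`. -/
lemma idealFlag_idealVec [Finite U] (hL : P.GeneratorsIn L) (hmn : ∀ a j, D.m a ≤ 2 * D.n j)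
    (c : D.Jor → ℕ) : IdealFlag P.KoszulFamily L (P.idealVec c) := by
  classical
  -- Thresholds beyond the length of a block concern zero entries only, and `colonElement_z`
  -- requires `c ≤ D.p`.
  have hmin : P.idealVec c = P.idealVec (c ⊓ D.p) := by
    apply le_antisymm
    · refine sup_le le_sup_left (Ideal.span_le.2 ?_)
      rintro _ ⟨l, i, hi, rfl⟩
      exact P.z_mem_idealVec ((inf_le_left : (c ⊓ D.p) l ≤ c l).trans hi)
    · refine sup_le le_sup_left (Ideal.span_le.2 ?_)
      rintro _ ⟨l, i, hi, rfl⟩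
      rcases le_or_gt (D.p l) i with h | h
      · rw [P.z_top _ _ h]
        exact zero_mem _
      · refine P.z_mem_idealVec ?_
        simp only [Pi.inf_apply, inf_le_iff] at hi
        exact hi.resolve_right (by omega)
  rw [hmin]
  refine forall_le_of_update D.p (fun c => IdealFlag P.KoszulFamily L (P.idealVec c)) ?_ ?_ _
    inf_le_right
  · have : P.idealVec D.p = P.idealNil Set.univ := by
      have h1 : P.idealUX = P.idealNil Set.univ := by simp [idealUX, idealNil]
      rw [← h1]
      refine le_antisymm (sup_le le_rfl (Ideal.span_le.2 ?_)) le_sup_left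
      rintro _ ⟨l, i, hi, rfl⟩
      rw [P.z_top _ _ hi]
      exact zero_mem _
    rw [this]
    exact idealFlag_idealNil hL hmn _
  · intro c hc l e he hflag
    have : P.idealVec (Function.update c l e) = P.idealVec c ⊔ Ideal.span {P.z l e} := by
      apply le_antisymm
      · refine sup_le (le_sup_left.trans le_sup_left) (Ideal.span_le.2 ?_)
        rintro _ ⟨l', i, hi, rfl⟩
        by_cases h : c l' ≤ i
        · exact le_sup_left (a := P.idealVec c) (P.z_mem_idealVec h)
        · refine le_sup_right (a := P.idealVec c) ?_
          by_cases hl : l' = l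
          · subst hl
            rw [Function.update_self] at hi
            have : i = e := by omega
            rw [this]
            exact Ideal.mem_span_singleton_self _
          · rw [Function.update_of_ne hl] at hi
            exact absurd hi h
      · refine sup_le (sup_le le_sup_left (Ideal.span_le.2 ?_)) ?_
        · rintro _ ⟨l', i, hi, rfl⟩
          refine P.z_mem_idealVec (le_trans ?_ hi)
          by_cases hl : l' = l
          · subst hl
            rw [Function.update_self]
            omega
          · rw [Function.update_of_ne hl]
        · rw [Ideal.span_singleton_le_iff_mem]
          exact P.z_mem_idealVec (by rw [Function.update_self])
    rw [this]
    refine .step _ _ hflag (hL.z l e) ?_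
    rw [P.colonElement_z c hc l e he]
    exact .fibre _ _ fun l h => h.1

/-- Coordinates are added from the largest index downwards, the thresholds `D.n j + 1` being the
empty start. The bound `d` admits ideals `J` smaller than `P.idealUXZ` that absorb its products only
with coordinates of index at least `d`: `d = 0` serves for `P.idealUXZ` itself and `d = 1` for the
fibres. -/
lemma IsScrollCoord.idealFlag_sup_idealCoord {g : D.Scr → ℕ → R} (hg : P.IsScrollCoord g)
    (hL : P.GeneratorsIn L) {J : Ideal R} (hJ : J ≤ P.idealUXZ)
    (hflag : IdealFlag P.KoszulFamily L J) (d : ℕ)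
    (hmul : ∀ r ∈ P.idealUXZ, ∀ j e, d ≤ e → e ≤ D.n j → r * g j e ∈ J) (β : D.Scr → ℕ)
    (hβ : ∀ j, d ≤ β j) (hβn : ∀ j, β j ≤ D.n j + 1) :
    IdealFlag P.KoszulFamily L (J ⊔ idealCoord g β) := by
  classical
  refine forall_le_of_update (fun j => D.n j + 1)
    (fun β => (∀ j, d ≤ β j) → IdealFlag P.KoszulFamily L (J ⊔ idealCoord g β)) ?_ ?_ _ hβn hβ
  · intro _
    have : idealCoord (D := D) g (fun j => D.n j + 1) = ⊥ := by
      rw [eq_bot_iff]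
      refine Ideal.span_le.2 ?_
      rintro _ ⟨j, e, h1, h2, -⟩
      exact absurd (h1.trans h2) (by simp)
    rwa [this, sup_bot_eq]
  · intro c hc j e he ih hd
    have hde : d ≤ e := by simpa using hd j
    have hen : e ≤ D.n j := by have := hc j; simp only at this; omega
    have h1 := ih fun j' => by
      by_cases h : j' = j
      · subst h; omega
      · simpa [h] using hd j'
    have : J ⊔ idealCoord g (Function.update c j e) = J ⊔ idealCoord g c ⊔ Ideal.span {g j e} := by
      apply le_antisymm
      · refine sup_le (le_sup_left.trans le_sup_left) (Ideal.span_le.2 ?_)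
        rintro _ ⟨j', i, hi, hin, rfl⟩
        by_cases h : c j' ≤ i
        · exact le_sup_left (a := J ⊔ idealCoord g c)
            (le_sup_right (a := J) (coord_mem_idealCoord h hin))
        · refine le_sup_right (a := J ⊔ idealCoord g c) ?_
          by_cases hl : j' = j
          · subst hl
            rw [Function.update_self] at hi
            have : i = e := by omega
            rw [this]
            exact Ideal.mem_span_singleton_self _
          · rw [Function.update_of_ne hl] at hi
            exact absurd hi h
      · refine sup_le (sup_le le_sup_left (le_sup_of_le_right (Ideal.span_le.2 ?_))) ?_
        · rintro _ ⟨j', i, hi, hin, rfl⟩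
          refine coord_mem_idealCoord (le_trans ?_ hi) hin
          by_cases hl : j' = j
          · subst hl
            rw [Function.update_self]
            omega
          · rw [Function.update_of_ne hl]
        · rw [Ideal.span_singleton_le_iff_mem]
          exact le_sup_right (a := J) (coord_mem_idealCoord (by rw [Function.update_self]) hen)
    rw [this]
    refine .step _ _ h1 (hg.mem_of_generatorsIn hL hen) ?_
    obtain ⟨β', hβ'⟩ := hg.colonElement_coord hJ c he hen fun r hr => hmul r hr j e hde hen
    rw [hβ']
    exact .coord g β' hg

lemma IsScrollCoord.idealFlag_idealCoord [Finite U] {g : D.Scr → ℕ → R} (hg : P.IsScrollCoord g)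
    (hL : P.GeneratorsIn L) (hmn : ∀ a j, D.m a ≤ 2 * D.n j) (β : D.Scr → ℕ) :
    IdealFlag P.KoszulFamily L (P.idealUXZ ⊔ idealCoord g β) := by
  have h0 : P.idealVec (fun _ => 0) = P.idealUXZ := by simp [idealVec, idealUXZ]
  have h1 := idealFlag_idealVec hL hmn (fun _ => 0)
  rw [h0] at h1
  have h2 := hg.idealFlag_sup_idealCoord hL le_rfl h1 0
    (fun r hr _ _ _ _ => Ideal.mul_mem_right _ _ hr) (fun j => min (β j) (D.n j + 1))
    (fun _ => Nat.zero_le _) (fun _ => min_le_right _ _)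
  convert h2 using 2
  have : ∀ j e, (β j ≤ e ∧ e ≤ D.n j) ↔ (min (β j) (D.n j + 1) ≤ e ∧ e ≤ D.n j) := by
    intro j e
    omega
  simp only [idealCoord, ← and_assoc, this]

lemma idealFlag_idealFibre [Finite U] (hL : P.GeneratorsIn L) (hmn : ∀ a j, D.m a ≤ 2 * D.n j)
    {c : k} {Λ : Set D.Jor} (hΛ : ∀ l ∈ Λ, D.ev l = c) :
    IdealFlag P.KoszulFamily L (P.idealFibre c Λ) := by
  classical
  refine (P.isScrollCoord_powY c).idealFlag_sup_idealCoord hL ?_ (idealFlag_idealVec hL hmn _) 1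
    ?_ _ (fun _ => le_rfl) (fun _ => by omega)
  · refine sup_le P.idealUX_le_idealUXZ (Ideal.span_le.2 ?_)
    rintro _ ⟨l, i, -, rfl⟩
    exact P.z_mem_idealUXZ l i
  · intro r hr j e he hen
    suffices H : P.idealUXZ ≤
        colonElement (P.idealVec (fun l => if l ∈ Λ then 1 else 0)) (P.powY c j e) from
      mem_colonElement.1 (H hr)
    refine P.idealUXZ_le (fun b => ?_) (fun a i => ?_) (fun l i => ?_)
    · exact mem_colonElement.2 (Ideal.mul_mem_right _ _
        (le_sup_left (a := P.idealUX) (P.u_mem_idealUX b)))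
    · exact mem_colonElement.2 (Ideal.mul_mem_right _ _
        (le_sup_left (a := P.idealUX) (P.x_mem_idealUX a i)))
    · rw [mem_colonElement, smul_eq_mul]
      by_cases h : (if l ∈ Λ then 1 else 0) ≤ i
      · exact Ideal.mul_mem_right _ _ (P.z_mem_idealVec h)
      · have hl : l ∈ Λ := by
          by_contra hl
          simp [hl] at h
        -- One factor `X - c` passes to the Jordan entry and raises its index to at least `1`.
        obtain ⟨e', rfl⟩ : ∃ e', e = e' + 1 := ⟨e - 1, by omega⟩
        rw [mul_comm, powY, ← hΛ l hl, pow_succ',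
          P.polyY_sub_mul_z l j (natDegree_X_sub_C_pow_lt (by omega))]
        refine Ideal.mul_mem_left _ _ (P.z_mem_idealVec ?_)
        rw [if_pos hl]
        omega

/-! ### Flags of the ideals `idealEnds` -/

/-- The ideal generated by `idealUXZ`, the coordinates `revY j e` with `i₀ ≤ e`, and those with
`e + q ≤ n j` in some of the blocks. -/
def idealEndsPart (P : KWPresentation D U R) (i₀ q : ℕ) (Δ : Set D.Scr) : Ideal R :=
  P.idealUXZ ⊔ idealCoord P.revY (fun _ => i₀) ⊔
    Ideal.span {r | ∃ j ∈ Δ, ∃ e, e + q ≤ D.n j ∧ r = P.revY j e}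

/-- Only the sum of the indices matters. If it is at least `i₀`, a coordinate of index at least `i₀`
splits off; if it is smaller, the second factor can carry all of it, which leaves `P.revY j 0` as
the first. -/
lemma revY_mul_mem_of_idealCoord_le {i₀ : ℕ} (hi₀ : ∀ j, i₀ ≤ D.n j) {j j' : D.Scr}
    {e e' : ℕ} (he : e ≤ D.n j) (he' : e' ≤ D.n j') {J : Ideal R}
    (hJ : idealCoord P.revY (fun _ => i₀) ≤ J) (h0 : P.revY j 0 ∈ J) :
    P.revY j e * P.revY j' e' ∈ J := by
  have hex := P.isScrollCoord_revY.exchange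
  have hs : IsAdmissible D.n {(j, e), (j', e')} := by
    intro q hq
    simp only [Multiset.insert_eq_cons, Multiset.mem_cons, Multiset.mem_singleton] at hq
    rcases hq with rfl | rfl
    · exact he
    · exact he'
  have hp : P.revY j e * P.revY j' e' = blockProd P.revY {(j, e), (j', e')} := by simp [blockProd]
  rw [hp]
  rcases le_or_gt i₀ (e + e') with h | h
  · obtain ⟨e'', h3, h4, r, hr⟩ := exists_blockProd_eq_mul hex hs (j := j) (b := i₀)
      (by simp [blockDegree]) (hi₀ j) (by simpa [blockDegree] using h)
    rw [hr]
    exact hJ (Ideal.mul_mem_left _ _ (coord_mem_idealCoord h3 h4))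
  · have hs' : IsAdmissible D.n {(j, 0), (j', e + e')} := by
      intro q hq
      simp only [Multiset.insert_eq_cons, Multiset.mem_cons, Multiset.mem_singleton] at hq
      rcases hq with rfl | rfl
      · exact Nat.zero_le _
      · have := hi₀ j'
        simp only
        omega
    rw [blockProd_eq_of_blockDegree_eq hex hs hs' (by simp [blockDegree]), Multiset.insert_eq_cons,
      blockProd_cons]
    exact Ideal.mul_mem_right _ _ h0

/-- Multiplication by `P.revY j₀ 0` adds a block outside `Δ` but no index. So a monomial must either
have index at least `i₀` by itself or meet a block of `Δ`; in the latter case every index is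
allowed, by `revY_mul_mem_of_idealCoord_le`. -/
lemma colonElement_idealEndsPart {i₀ q : ℕ} (h₀ : 0 < i₀) (hi₀ : ∀ j, i₀ ≤ D.n j)
    (hqn : ∀ j, q ≤ D.n j) {Δ : Set D.Scr} {j₀ : D.Scr} (hj₀ : j₀ ∉ Δ) :
    ∃ β, colonElement (P.idealEndsPart i₀ q Δ) (P.revY j₀ 0) =
      P.idealUXZ ⊔ idealCoord P.revY β := by
  classical
  refine ⟨fun j => if j ∈ Δ then 0 else i₀, ?_⟩
  refine P.isScrollCoord_revY.colonElement_eq (Nat.zero_le _) le_sup_left ?_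
    {d | (d.2 ≠ 0 ∧ i₀ ≤ d.1) ∨ ∃ j ∈ d.2, j ∈ Δ} ?_ ?_ ?_
  · have hJ : idealCoord P.revY (fun _ => i₀) ≤ P.idealEndsPart i₀ q Δ :=
      le_sup_right.trans le_sup_left
    have : P.idealUXZ ⊔ idealCoord P.revY (fun j => if j ∈ Δ then 0 else i₀) ≤
        colonElement (P.idealEndsPart i₀ q Δ) (P.revY j₀ 0) := by
      refine sup_le (fun r hr => ?_) (Ideal.span_le.2 ?_)
      · exact mem_colonElement.2 (Ideal.mul_mem_right _ _ ((le_sup_left.trans le_sup_left :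
          P.idealUXZ ≤ P.idealEndsPart i₀ q Δ) hr))
      · rintro _ ⟨j, e, he, hen, rfl⟩
        refine mem_colonElement.2 ?_
        by_cases hj : j ∈ Δ
        · refine revY_mul_mem_of_idealCoord_le hi₀ hen (Nat.zero_le _) hJ ?_
          exact le_sup_right (a := P.idealUXZ ⊔ idealCoord P.revY (fun _ => i₀))
            (Ideal.subset_span ⟨j, hj, 0, by simpa using hqn j, rfl⟩)
        · simp only [if_neg hj] at he
          exact Ideal.mul_mem_right _ _ (hJ (coord_mem_idealCoord he hen))
    exact fun r hr => mem_colonElement.1 (this hr)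
  · rintro d (⟨h1, h2⟩ | ⟨j, h1, h2⟩) d'
    · refine Or.inl ⟨?_, ?_⟩
      · simp only [Prod.snd_add, ne_eq, add_eq_zero, not_and]
        exact fun _ => h1
      · rw [Prod.fst_add]; omega
    · exact Or.inr ⟨j, Multiset.mem_add.2 (Or.inr h1), h2⟩
  · refine ⟨{r | ∃ j e, i₀ ≤ e ∧ e ≤ D.n j ∧ r = P.revY j e} ∪
      {r | ∃ j ∈ Δ, ∃ e, e + q ≤ D.n j ∧ r = P.revY j e}, ?_, ?_⟩
    · rw [Ideal.span_union, ← sup_assoc]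
      exact le_rfl
    · rintro _ (⟨j, e, h1, h2, rfl⟩ | ⟨j, hj, e, h1, rfl⟩)
      · exact ⟨j, e, h2, rfl, Or.inl ⟨by simp, h1⟩⟩
      · exact ⟨j, e, by omega, rfl, Or.inr ⟨j, by simp, hj⟩⟩
  · intro s hs h
    refine le_sup_right (a := P.idealUXZ) ?_
    rcases h with ⟨-, h⟩ | ⟨j, h1, h2⟩
    · rw [Prod.fst_add, add_zero] at h
      obtain ⟨⟨j, e⟩, hq⟩ : ∃ q, q ∈ s := by
        by_contra! hne
        rw [Multiset.eq_zero_of_forall_notMem hne] at h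
        simp at h
        omega
      obtain ⟨e', h3, h4, r, hr⟩ := exists_blockProd_eq_mul P.isScrollCoord_revY.exchange hs
        (j := j) (b := i₀) (Multiset.mem_map.2 ⟨_, hq, rfl⟩) (hi₀ j) h
      rw [hr]
      refine Ideal.mul_mem_left _ _ (coord_mem_idealCoord ?_ h4)
      split_ifs
      · exact Nat.zero_le _
      · exact h3
    · have hj : j ∈ (blockDegree s).2 := by
        rw [Prod.snd_add] at h1
        rcases Multiset.mem_add.1 h1 with h | h
        · exact h
        · rw [Multiset.mem_singleton.1 h] at h2
          exact absurd h2 hj₀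
      obtain ⟨e', h3, h4, r, hr⟩ := exists_blockProd_eq_mul P.isScrollCoord_revY.exchange hs
        hj (b := 0) (Nat.zero_le _) (Nat.zero_le _)
      rw [hr]
      refine Ideal.mul_mem_left _ _ (coord_mem_idealCoord ?_ h4)
      rw [if_pos h2]
      exact Nat.zero_le _

/-- In each block `P.revY j 0`, the last entry of the block, goes first. Afterwards the maximal
ideal multiplies every coordinate of the block into the ideal already reached. -/
lemma idealFlag_idealEndsPart [Finite U] (hL : P.GeneratorsIn L)
    (hmn : ∀ a j, D.m a ≤ 2 * D.n j) {i₀ q : ℕ} (h₀ : 0 < i₀) (hi₀ : ∀ j, i₀ ≤ D.n j)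
    (hqn : ∀ j, q ≤ D.n j) (Δ : Set D.Scr) :
    IdealFlag P.KoszulFamily L (P.idealEndsPart i₀ q Δ) := by
  induction Δ, Δ.toFinite using Set.Finite.induction_on with
  | empty =>
    have := P.isScrollCoord_revY.idealFlag_idealCoord hL hmn (fun _ => i₀)
    simpa [idealEndsPart] using this
  | @insert j Δ hj _ ih =>
    set J := P.idealEndsPart i₀ q Δ ⊔ Ideal.span {P.revY j 0} with hJ
    have h1 : IdealFlag P.KoszulFamily L J := by
      refine .step _ _ ih (P.isScrollCoord_revY.mem_of_generatorsIn hL (Nat.zero_le _)) ?_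
      obtain ⟨β, hβ⟩ := colonElement_idealEndsPart (P := P) h₀ hi₀ hqn hj
      rw [hβ]
      exact .coord _ _ P.isScrollCoord_revY
    have hK : P.idealUXZ ≤ J := (le_sup_left.trans le_sup_left).trans le_sup_left
    have hC : idealCoord P.revY (fun _ => i₀) ≤ J :=
      (le_sup_right.trans le_sup_left).trans le_sup_left
    have h0 : P.revY j 0 ∈ J := le_sup_right (a := P.idealEndsPart i₀ q Δ)
      (Ideal.mem_span_singleton_self _)
    have h2 := h1.sup_span_finite P.koszulFamily_idealMax P.exists_sub_algebraMap_mem_idealMax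
        (G := (fun e => P.revY j e) '' Set.Iic (D.n j - q)) ((Set.finite_Iic _).image _)
        (by
          rintro _ ⟨i, hi, rfl⟩
          exact P.isScrollCoord_revY.mem_of_generatorsIn hL (le_trans hi (Nat.sub_le _ _))) (by
          rintro r hr _ ⟨e, he, rfl⟩
          have hen : e ≤ D.n j := le_trans he (Nat.sub_le _ _)
          suffices H : P.idealMax ≤ colonElement J (P.revY j e) from mem_colonElement.1 (H hr)
          refine sup_le (fun r hr => ?_) (Ideal.span_le.2 ?_)
          · exact mem_colonElement.2 (Ideal.mul_mem_right _ _ (hK hr))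
          · rintro _ ⟨j', e', -, he', rfl⟩
            refine mem_colonElement.2 ?_
            rw [smul_eq_mul, mul_comm]
            exact revY_mul_mem_of_idealCoord_le hi₀ hen he' hC h0)
    convert h2 using 1
    apply le_antisymm
    · refine sup_le (sup_le (hK.trans le_sup_left) (hC.trans le_sup_left)) (Ideal.span_le.2 ?_)
      rintro _ ⟨j', (rfl | hj'), e, he, rfl⟩
      · exact le_sup_right (a := J) (Ideal.subset_span ⟨e, by simp; omega, rfl⟩)
      · exact le_sup_left (a := J) (le_sup_left (a := P.idealEndsPart i₀ q Δ)
          (le_sup_right (a := P.idealUXZ ⊔ idealCoord P.revY (fun _ => i₀))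
            (Ideal.subset_span ⟨j', hj', e, he, rfl⟩)))
    · have hmem : ∀ e, e + q ≤ D.n j → P.revY j e ∈ P.idealEndsPart i₀ q (insert j Δ) :=
        fun e he => le_sup_right (a := P.idealUXZ ⊔ idealCoord P.revY (fun _ => i₀))
          (Ideal.subset_span ⟨j, Set.mem_insert _ _, e, he, rfl⟩)
      refine sup_le (sup_le (sup_le le_sup_left (le_sup_of_le_right (Ideal.span_mono ?_))) ?_)
        (Ideal.span_le.2 ?_)
      · rintro _ ⟨j', hj', e, he, rfl⟩
        exact ⟨j', Set.mem_insert_of_mem _ hj', e, he, rfl⟩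
      · rw [Ideal.span_singleton_le_iff_mem]
        exact hmem 0 (by simpa using hqn j)
      · rintro _ ⟨e, he, rfl⟩
        have := hqn j
        simp only [Set.mem_Iic] at he
        exact hmem e (by omega)

lemma idealEndsPart_univ (i₀ q : ℕ) :
    P.idealEndsPart i₀ q Set.univ = P.idealEnds i₀ q := by
  apply le_antisymm
  · refine sup_le (sup_le le_sup_left (Ideal.span_le.2 ?_)) (Ideal.span_le.2 ?_)
    · rintro _ ⟨j, e, h1, h2, rfl⟩
      simp only at h1
      exact P.y_mem_idealEnds (Nat.sub_le _ _) (Or.inl (by omega))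
    · rintro _ ⟨j, -, e, h1, rfl⟩
      exact P.y_mem_idealEnds (Nat.sub_le _ _) (Or.inr (by omega))
  · refine sup_le (le_sup_left.trans le_sup_left) (Ideal.span_le.2 ?_)
    rintro _ ⟨j, i, hi, h, rfl⟩
    have h1 : P.y j i = P.revY j (D.n j - i) := by rw [revY, Nat.sub_sub_self hi]
    rw [h1]
    rcases h with h | h
    · refine le_sup_left (a := P.idealUXZ ⊔ idealCoord P.revY (fun _ => i₀))
        (le_sup_right (a := P.idealUXZ) (coord_mem_idealCoord ?_ (Nat.sub_le _ _)))
      omega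
    · exact le_sup_right (a := P.idealUXZ ⊔ idealCoord P.revY (fun _ => i₀))
        (Ideal.subset_span ⟨j, trivial, _, by omega, rfl⟩)

theorem isKoszulAlgebra [Finite U] {𝒜 : ℕ → Submodule k R} (h𝒜 : HasLinearLifts (𝒜 1))
    (hL : P.GeneratorsIn (𝒜 1)) (hmax : gradedMaximalIdeal 𝒜 = P.idealMax)
    (hmn : ∀ a j, D.m a ≤ 2 * D.n j) : IsKoszulAlgebra 𝒜 := by
  refine isKoszulAlgebra_of_idealFlag (F := P.KoszulFamily) h𝒜 ?_
    (by rw [hmax]; exact P.koszulFamily_idealMax)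
  rintro _ (⟨s⟩ | ⟨i₀, q, h1, h2, h3, h4⟩ | ⟨c, Λ, h⟩ | ⟨g, β, hg⟩)
  · exact idealFlag_free hL s
  · rw [← idealEndsPart_univ]
    exact idealFlag_idealEndsPart hL hmn h1 h3 h4 _
  · exact idealFlag_idealFibre hL hmn h
  · exact hg.idealFlag_idealCoord hL hmn β

end KWPresentation

/-! ### The presentation given by a normal form -/

section Minors

variable {S : Type*} [CommRing S] {e : ℕ}

lemma idealOfMinors_le_iff {Y : Matrix (Fin 2) (Fin e) S} {I : Ideal S} :
    idealOfMinors Y ≤ I ↔ ∀ c c', Y 0 c * Y 1 c' - Y 0 c' * Y 1 c ∈ I := by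
  rw [idealOfMinors, Ideal.span_le, Set.range_subset_iff]
  constructor
  · intro h c c'
    simpa [Matrix.det_fin_two] using h ![c, c']
  · intro h c
    simpa [Matrix.det_fin_two] using h (c 0) (c 1)

lemma minor_mem_idealOfMinors (Y : Matrix (Fin 2) (Fin e) S) (c c' : Fin e) :
    Y 0 c * Y 1 c' - Y 0 c' * Y 1 c ∈ idealOfMinors Y :=
  idealOfMinors_le_iff.1 le_rfl c c'

/-- By multilinearity the minors of the product are combinations of those of `Y`. Used for a change
of rows and columns and for its inverse, this shows that the normal form defines the same ideal. -/
lemma idealOfMinors_mul_mul_le (A : Matrix (Fin 2) (Fin 2) S) (Y : Matrix (Fin 2) (Fin e) S)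
    (B : Matrix (Fin e) (Fin e) S) : idealOfMinors (A * Y * B) ≤ idealOfMinors Y := by
  refine idealOfMinors_le_iff.2 fun c c' => ?_
  rw [Matrix.mul_assoc]
  have hA : ∀ r c, (A * (Y * B)) r c = A r 0 * (Y * B) 0 c + A r 1 * (Y * B) 1 c := fun r c => by
    rw [Matrix.mul_apply, Fin.sum_univ_two]
  have h1 : (Y * B) 0 c * (Y * B) 1 c' - (Y * B) 0 c' * (Y * B) 1 c ∈ idealOfMinors Y := by
    simp only [Matrix.mul_apply]
    rw [Finset.sum_mul_sum, mul_comm (∑ i, Y 0 i * B i c'), Finset.sum_mul_sum,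
      ← Finset.sum_sub_distrib]
    refine Ideal.sum_mem _ fun i _ => ?_
    rw [← Finset.sum_sub_distrib]
    refine Ideal.sum_mem _ fun i' _ => ?_
    have := Ideal.mul_mem_left _ (B i c * B i' c') (minor_mem_idealOfMinors Y i i')
    convert this using 1
    ring
  rw [hA, hA, hA, hA]
  convert Ideal.mul_mem_left _ (A 0 0 * A 1 1 - A 0 1 * A 1 0) h1 using 1
  ring

end Minors

/-! ### The three types of blocks -/

namespace KWBlock

variable {k S : Type*} [CommRing S]

/-- The eigenvalue of a Jordan block. -/
def eigenvalue [Zero k] : KWBlock k → k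
  | jordan _ a => a
  | _ => 0

/-- The block is nilpotent. -/
def IsNilpotentBlock (B : KWBlock k) : Prop := ∃ m, B = nilpotent m

/-- The block is a scroll block. -/
def IsScrollBlock (B : KWBlock k) : Prop := ∃ n, B = scroll n

/-- The block is a Jordan block. -/
def IsJordanBlock (B : KWBlock k) : Prop := ∃ p a, B = jordan p a

lemma matrix_of_isNilpotentBlock [SMul k S] {B : KWBlock k} (hB : B.IsNilpotentBlock)
    (w : Fin B.numForms → S) (j : Fin B.length) :
    B.matrix w 0 j = (if (j : ℕ) = 0 then 0 else extendZero w ((j : ℕ) - 1)) ∧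
      B.matrix w 1 j = extendZero w j := by
  obtain ⟨m, rfl⟩ := hB
  exact ⟨rfl, rfl⟩

lemma matrix_of_isScrollBlock [SMul k S] {B : KWBlock k} (hB : B.IsScrollBlock)
    (w : Fin B.numForms → S) (j : Fin B.length) :
    B.matrix w 0 j = extendZero w j ∧ B.matrix w 1 j = extendZero w (j + 1) := by
  obtain ⟨m, rfl⟩ := hB
  exact ⟨rfl, rfl⟩

lemma matrix_of_isJordanBlock [Zero k] [SMul k S] {B : KWBlock k} (hB : B.IsJordanBlock)
    (w : Fin B.numForms → S) (j : Fin B.length) :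
    B.matrix w 0 j = extendZero w j ∧
      B.matrix w 1 j = extendZero w (j + 1) + B.eigenvalue • extendZero w j := by
  obtain ⟨m, a, rfl⟩ := hB
  exact ⟨rfl, rfl⟩

lemma numForms_of_isNilpotentBlock {B : KWBlock k} (hB : B.IsNilpotentBlock) :
    B.numForms = B.length - 1 := by
  obtain ⟨m, rfl⟩ := hB
  rfl

lemma numForms_of_isScrollBlock {B : KWBlock k} (hB : B.IsScrollBlock) :
    B.numForms = B.length + 1 := by
  obtain ⟨m, rfl⟩ := hB
  rfl

lemma numForms_of_isJordanBlock {B : KWBlock k} (hB : B.IsJordanBlock) :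
    B.numForms = B.length := by
  obtain ⟨m, a, rfl⟩ := hB
  rfl

lemma block_cases (B : KWBlock k) :
    B.IsNilpotentBlock ∨ B.IsScrollBlock ∨ B.IsJordanBlock := by
  cases B with
  | nilpotent m => exact Or.inl ⟨m, rfl⟩
  | scroll n => exact Or.inr (Or.inl ⟨n, rfl⟩)
  | jordan p a => exact Or.inr (Or.inr ⟨p, a, rfl⟩)

lemma not_isNilpotentBlock_of_isScrollBlock {B : KWBlock k} (hB : B.IsScrollBlock) :
    ¬ B.IsNilpotentBlock := by
  obtain ⟨n, rfl⟩ := hB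
  rintro ⟨m, h⟩
  cases h

lemma not_isNilpotentBlock_of_isJordanBlock {B : KWBlock k} (hB : B.IsJordanBlock) :
    ¬ B.IsNilpotentBlock := by
  obtain ⟨n, a, rfl⟩ := hB
  rintro ⟨m, h⟩
  cases h

lemma not_isScrollBlock_of_isJordanBlock {B : KWBlock k} (hB : B.IsJordanBlock) :
    ¬ B.IsScrollBlock := by
  obtain ⟨n, a, rfl⟩ := hB
  rintro ⟨m, h⟩
  cases h

lemma extendZero_of_lt {r : ℕ} (w : Fin r → S) {j : ℕ} (h : j < r) :
    extendZero w j = w ⟨j, h⟩ := dif_pos h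

lemma extendZero_of_le {r : ℕ} (w : Fin r → S) {j : ℕ} (h : r ≤ j) :
    extendZero w j = 0 := dif_neg (by omega)

end KWBlock

namespace KWNormalForm

variable {k : Type v} [Field k] {N e : ℕ} {X : Matrix (Fin 2) (Fin e) (MvPolynomial (Fin N) k)}
  (F : KWNormalForm X)

/-- The matrix in normal form. -/
noncomputable def normalMatrix : Matrix (Fin 2) (Fin e) (MvPolynomial (Fin N) k) :=
  Matrix.of fun r j => (F.block (F.column j).1).matrix (F.form (F.column j).1) r (F.column j).2

lemma idealOfMinors_normalMatrix : idealOfMinors F.normalMatrix = idealOfMinors X := by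
  have hmat := F.eq_concatenation
  apply le_antisymm
  · rw [normalMatrix, ← hmat]
    exact idealOfMinors_mul_mul_le _ _ _
  · have h1 := idealOfMinors_mul_mul_le
      (((F.rowChange⁻¹ : GL (Fin 2) k) : Matrix (Fin 2) (Fin 2) k).map
        (C : k →+* MvPolynomial (Fin N) k)) F.normalMatrix
      (((F.colChange⁻¹ : GL (Fin e) k) : Matrix (Fin e) (Fin e) k).map
        (C : k →+* MvPolynomial (Fin N) k))
    convert h1 using 2
    rw [normalMatrix, ← hmat, Matrix.mul_assoc, Matrix.mul_assoc, Matrix.mul_assoc,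
      ← Matrix.map_mul, ← Units.val_mul, mul_inv_cancel, ← Matrix.mul_assoc, ← Matrix.map_mul,
      ← Units.val_mul, inv_mul_cancel, Units.val_one, Units.val_one,
      Matrix.map_one _ (map_zero C) (map_one C), Matrix.map_one _ (map_zero C) (map_one C),
      Matrix.one_mul, Matrix.mul_one]

lemma normalMatrix_column_symm (r : Fin 2) (i : Fin F.numBlocks) (t : Fin (F.block i).length) :
    F.normalMatrix r (F.column.symm ⟨i, t⟩) = (F.block i).matrix (F.form i) r t := by
  simp only [normalMatrix, Matrix.of_apply]
  rw [Equiv.apply_symm_apply]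

/-- The linear forms of a block, extended by zero. -/
noncomputable def entry (i : Fin F.numBlocks) (t : ℕ) : MvPolynomial (Fin N) k :=
  KWBlock.extendZero (F.form i) t

lemma isHomogeneous_entry (i : Fin F.numBlocks) (t : ℕ) : (F.entry i t).IsHomogeneous 1 := by
  rw [entry, KWBlock.extendZero]
  split_ifs
  · exact F.form_linear _ _
  · exact isHomogeneous_zero _ _ _

/-- The linear forms in the blocks can be completed to a system of coordinates. -/
lemma exists_coordinates : ∃ (c : ℕ) (u : Fin c → MvPolynomial (Fin N) k),
    (∀ b, (u b).IsHomogeneous 1) ∧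
    Submodule.span k ((Set.range fun a : Σ i, Fin (F.block i).numForms => F.form a.1 a.2) ∪
      Set.range u) = homogeneousSubmodule (Fin N) k 1 ∧
    ∀ (T : Type v) [CommRing T] [Algebra k T] (val : (Σ i, Fin (F.block i).numForms) → T)
      (w : Fin c → T), ∃ ψ : MvPolynomial (Fin N) k →ₐ[k] T,
        (∀ a, ψ (F.form a.1 a.2) = val a) ∧ ∀ b, ψ (u b) = w b := by
  classical
  let V := homogeneousSubmodule (Fin N) k 1
  have : Module.Finite k V := Module.Finite.iff_fg.2 (homogeneousSubmodule_fg (Fin N) k 1)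
  let g : (Σ i, Fin (F.block i).numForms) → V := fun a => ⟨F.form a.1 a.2, F.form_linear _ _⟩
  have hg : LinearIndependent k g :=
    LinearIndependent.of_comp V.subtype F.form_independent
  let b₀ := Module.Basis.sumExtend hg
  have hfin : Finite ((Σ i, Fin (F.block i).numForms) ⊕ Module.Basis.sumExtendIndex hg) :=
    Module.Finite.finite_basis b₀
  have hfin' : Finite (Module.Basis.sumExtendIndex hg) :=
    Finite.of_injective (Sum.inr : _ → (Σ i, Fin (F.block i).numForms) ⊕ _) Sum.inr_injective
  obtain ⟨c, ⟨σ⟩⟩ := Finite.exists_equiv_fin (Module.Basis.sumExtendIndex hg)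
  let b := b₀.reindex ((Equiv.refl _).sumCongr σ)
  have hb : ∀ a, b (Sum.inl a) = g a := by
    intro a
    simp [b, b₀, Module.Basis.sumExtend]
    rfl
  refine ⟨c, fun i => (b (Sum.inr i) : MvPolynomial (Fin N) k), fun i => (b (Sum.inr i)).2, ?_, ?_⟩
  · have h1 := congrArg (Submodule.map V.subtype) b.span_eq
    rw [Submodule.map_span, Submodule.map_subtype_top, ← Set.range_comp] at h1
    refine Eq.trans ?_ h1
    congr 1
    rw [Sum.range_eq]
    congr 1
    congr 1
    ext a
    simp [hb, g]
  · intro T _ _ val w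
    -- Values on a basis of the space of linear forms determine a linear map, and the algebra
    -- homomorphism with the same values on the variables agrees with it on all linear forms.
    let ℓ : V →ₗ[k] T := b.constr k (Sum.elim val w)
    have hℓ : ∀ f : V, aeval (fun i => ℓ ⟨MvPolynomial.X i, isHomogeneous_X k i⟩)
        (f : MvPolynomial (Fin N) k) = ℓ f := by
      rintro ⟨f, hf⟩
      have hf' := hf
      change f ∈ homogeneousSubmodule _ _ _ at hf'
      rw [homogeneousSubmodule_one_eq_span_X] at hf'
      have hfx : ∀ x ∈ Submodule.span k (Set.range (MvPolynomial.X : Fin N → _)), x ∈ V :=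
        fun x hx => by rwa [← homogeneousSubmodule_one_eq_span_X] at hx
      induction hf' using Submodule.span_induction with
      | mem x h =>
        obtain ⟨i, rfl⟩ := h
        simp
      | zero =>
        rw [map_zero]
        exact (map_zero ℓ).symm
      | add x y hx hy h1 h2 =>
        rw [map_add, h1 (hfx x hx), h2 (hfx y hy), ← map_add]
        rfl
      | smul a x hx h1 =>
        rw [map_smul, h1 (hfx x hx), ← map_smul]
        rfl
    refine ⟨aeval fun i => ℓ ⟨MvPolynomial.X i, isHomogeneous_X k i⟩, fun a => ?_, fun i => ?_⟩
    · have := hℓ (g a)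
      rw [← hb, Module.Basis.constr_basis] at this
      rw [hb] at this
      exact this
    · rw [hℓ, Module.Basis.constr_basis]
      rfl

/-- The shape of a normal form. -/
abbrev shape : KWShape k where
  Nil := {i : Fin F.numBlocks // (F.block i).IsNilpotentBlock}
  Scr := {i : Fin F.numBlocks // (F.block i).IsScrollBlock}
  Jor := {i : Fin F.numBlocks // (F.block i).IsJordanBlock}
  m i := (F.block i.1).length
  n i := (F.block i.1).length
  p i := (F.block i.1).length
  ev i := (F.block i.1).eigenvalue
  finite_nil := inferInstance
  finite_scr := inferInstance
  finite_jor := inferInstance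

/-- The system of elements of the determinantal ring given by a normal form. -/
noncomputable def system : KWSystem (DeterminantalRing X) F.shape where
  -- The index is shifted by one, so that `x a 0` is the zero in the upper left corner of the block.
  x a i := if i = 0 then 0 else Ideal.Quotient.mk _ (F.entry a.1 (i - 1))
  y j i := Ideal.Quotient.mk _ (F.entry j.1 i)
  z l i := Ideal.Quotient.mk _ (F.entry l.1 i)
  x_zero a := if_pos rfl
  x_top a i hi := by
    have h1 := F.length_pos a.1
    change (F.block a.1).length ≤ i at hi
    rw [if_neg (by omega), entry, KWBlock.extendZero_of_le, map_zero]
    rw [KWBlock.numForms_of_isNilpotentBlock a.2]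
    omega
  z_top l i hi := by
    change (F.block l.1).length ≤ i at hi
    rw [entry, KWBlock.extendZero_of_le, map_zero]
    rwa [KWBlock.numForms_of_isJordanBlock l.2]
  minor := by
    have key : ∀ a b, IsKWColumn F.shape
        (fun a i => if i = 0 then 0 else Ideal.Quotient.mk (idealOfMinors X) (F.entry a.1 (i - 1)))
        (fun j i => Ideal.Quotient.mk (idealOfMinors X) (F.entry j.1 i))
        (fun l i => Ideal.Quotient.mk (idealOfMinors X) (F.entry l.1 i)) a b →
        ∃ c, a = Ideal.Quotient.mk (idealOfMinors X) (F.normalMatrix 0 c) ∧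
          b = Ideal.Quotient.mk (idealOfMinors X) (F.normalMatrix 1 c) := by
      rintro _ _ (⟨a, i, hi⟩ | ⟨j, i, hi⟩ | ⟨l, i, hi⟩)
      · refine ⟨F.column.symm ⟨a.1, ⟨i, hi⟩⟩, ?_, ?_⟩
        · rw [normalMatrix_column_symm, (KWBlock.matrix_of_isNilpotentBlock a.2 _ _).1]
          split_ifs
          · rw [map_zero]
          · rfl
        · rw [normalMatrix_column_symm, (KWBlock.matrix_of_isNilpotentBlock a.2 _ _).2,
            if_neg (by omega)]
          rfl
      · refine ⟨F.column.symm ⟨j.1, ⟨i, hi⟩⟩, ?_, ?_⟩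
        · rw [normalMatrix_column_symm, (KWBlock.matrix_of_isScrollBlock j.2 _ _).1]
          rfl
        · rw [normalMatrix_column_symm, (KWBlock.matrix_of_isScrollBlock j.2 _ _).2]
          rfl
      · refine ⟨F.column.symm ⟨l.1, ⟨i, hi⟩⟩, ?_, ?_⟩
        · rw [normalMatrix_column_symm, (KWBlock.matrix_of_isJordanBlock l.2 _ _).1]
          rfl
        · rw [normalMatrix_column_symm, (KWBlock.matrix_of_isJordanBlock l.2 _ _).2]
          rfl
    intro a b a' b' h h'
    obtain ⟨c, rfl, rfl⟩ := key _ _ h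
    obtain ⟨c', rfl, rfl⟩ := key _ _ h'
    rw [← map_mul, ← map_mul, Ideal.Quotient.eq, ← F.idealOfMinors_normalMatrix]
    exact minor_mem_idealOfMinors _ _ _

open Classical in
/-- The values of the linear forms of the blocks prescribed by a system. -/
noncomputable def formValue {T : Type*} [CommRing T] [Algebra k T] (E : KWSystem T F.shape)
    (i : Fin F.numBlocks) (t : ℕ) : T :=
  if h : (F.block i).IsNilpotentBlock then E.x ⟨i, h⟩ (t + 1)
  else if h : (F.block i).IsScrollBlock then E.y ⟨i, h⟩ t
  else if h : (F.block i).IsJordanBlock then E.z ⟨i, h⟩ t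
  else 0

section formValue

variable {T : Type*} [CommRing T] [Algebra k T] (E : KWSystem T F.shape)

lemma formValue_nil (a : F.shape.Nil) (t : ℕ) : F.formValue E a.1 t = E.x a (t + 1) :=
  dif_pos a.2

lemma formValue_scr (j : F.shape.Scr) (t : ℕ) : F.formValue E j.1 t = E.y j t := by
  rw [formValue, dif_neg (KWBlock.not_isNilpotentBlock_of_isScrollBlock j.2), dif_pos j.2]

lemma formValue_jor (l : F.shape.Jor) (t : ℕ) : F.formValue E l.1 t = E.z l t := by
  rw [formValue, dif_neg (KWBlock.not_isNilpotentBlock_of_isJordanBlock l.2),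
    dif_neg (KWBlock.not_isScrollBlock_of_isJordanBlock l.2), dif_pos l.2]

variable {E} {ψ : MvPolynomial (Fin N) k →ₐ[k] T}

lemma map_entry_of_lt (hψ : ∀ i t, ψ (F.form i t) = F.formValue E i t)
    {i : Fin F.numBlocks} {t : ℕ} (h : t < (F.block i).numForms) :
    ψ (F.entry i t) = F.formValue E i t := by
  rw [entry, KWBlock.extendZero_of_lt _ h, hψ]

lemma map_entry_nil (hψ : ∀ i t, ψ (F.form i t) = F.formValue E i t)
    (a : F.shape.Nil) (t : ℕ) : ψ (F.entry a.1 t) = E.x a (t + 1) := by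
  rcases lt_or_ge t (F.block a.1).numForms with h | h
  · rw [F.map_entry_of_lt hψ h, formValue_nil]
  · rw [entry, KWBlock.extendZero_of_le _ h, map_zero, E.x_top]
    rw [KWBlock.numForms_of_isNilpotentBlock a.2] at h
    change (F.block a.1).length ≤ t + 1
    omega

lemma map_entry_scr (hψ : ∀ i t, ψ (F.form i t) = F.formValue E i t)
    (j : F.shape.Scr) {t : ℕ} (ht : t ≤ F.shape.n j) :
    ψ (F.entry j.1 t) = E.y j t := by
  rw [F.map_entry_of_lt hψ, formValue_scr]
  rw [KWBlock.numForms_of_isScrollBlock j.2]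
  exact Nat.lt_succ_of_le ht

lemma map_entry_jor (hψ : ∀ i t, ψ (F.form i t) = F.formValue E i t)
    (l : F.shape.Jor) (t : ℕ) : ψ (F.entry l.1 t) = E.z l t := by
  rcases lt_or_ge t (F.block l.1).numForms with h | h
  · rw [F.map_entry_of_lt hψ h, formValue_jor]
  · rw [entry, KWBlock.extendZero_of_le _ h, map_zero, E.z_top]
    rwa [KWBlock.numForms_of_isJordanBlock l.2] at h

lemma isKWColumn_map (hψ : ∀ i t, ψ (F.form i t) = F.formValue E i t) (c : Fin e) :
    IsKWColumn F.shape E.x E.y E.z (ψ (F.normalMatrix 0 c)) (ψ (F.normalMatrix 1 c)) := by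
  obtain ⟨⟨i, t⟩, rfl⟩ := F.column.symm.surjective c
  rw [normalMatrix_column_symm, normalMatrix_column_symm]
  have ht := t.2
  rcases (F.block i).block_cases with h | h | h
  · obtain ⟨h1, h2⟩ := KWBlock.matrix_of_isNilpotentBlock h (F.form i) t
    have h3 : ψ ((F.block i).matrix (F.form i) 0 t) = E.x ⟨i, h⟩ t := by
      rw [h1]
      split_ifs with h0
      · rw [h0, E.x_zero, map_zero]
      · have := F.map_entry_nil hψ ⟨i, h⟩ ((t : ℕ) - 1)
        rwa [Nat.sub_add_cancel (Nat.one_le_iff_ne_zero.2 h0)] at this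
    rw [h3, h2]
    have := F.map_entry_nil hψ ⟨i, h⟩ t
    rw [entry] at this
    rw [this]
    exact .nil (D := F.shape) ⟨i, h⟩ t ht
  · obtain ⟨h1, h2⟩ := KWBlock.matrix_of_isScrollBlock h (F.form i) t
    have e1 := F.map_entry_scr hψ ⟨i, h⟩ (t := t) ht.le
    have e2 := F.map_entry_scr hψ ⟨i, h⟩ (t := t + 1) ht
    rw [entry] at e1 e2
    rw [h1, h2, e1, e2]
    exact .scr (D := F.shape) ⟨i, h⟩ t ht
  · obtain ⟨h1, h2⟩ := KWBlock.matrix_of_isJordanBlock h (F.form i) t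
    have e1 := F.map_entry_jor hψ ⟨i, h⟩ t
    have e2 := F.map_entry_jor hψ ⟨i, h⟩ (t + 1)
    rw [entry] at e1 e2
    rw [h1, h2, map_add, map_smul, e1, e2]
    exact .jor (D := F.shape) ⟨i, h⟩ t ht

lemma map_idealOfMinors_eq_zero (hψ : ∀ i t, ψ (F.form i t) = F.formValue E i t) :
    ∀ f ∈ idealOfMinors X, ψ f = 0 := by
  have : idealOfMinors X ≤ RingHom.ker ψ := by
    rw [← F.idealOfMinors_normalMatrix, idealOfMinors_le_iff]
    intro c c'
    change ψ _ = 0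
    rw [map_sub, map_mul, map_mul, sub_eq_zero]
    exact E.minor _ _ _ _ (F.isKWColumn_map hψ c) (F.isKWColumn_map hψ c')
  exact this

end formValue

lemma range_form_subset : (Set.range fun a : Σ i, Fin (F.block i).numForms =>
      Ideal.Quotient.mk (idealOfMinors X) (F.form a.1 a.2)) ⊆
    {r | ∃ a i, r = F.system.x a i} ∪ {r | ∃ j i, i ≤ F.shape.n j ∧ r = F.system.y j i} ∪
    {r | ∃ l i, r = F.system.z l i} := by
  rintro _ ⟨⟨i, t⟩, rfl⟩
  have hent : F.form i t = F.entry i t := by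
    rw [entry, KWBlock.extendZero_of_lt _ t.2]
  simp only [hent]
  have ht := t.2
  rcases (F.block i).block_cases with h | h | h
  · exact Or.inl (Or.inl ⟨⟨i, h⟩, t + 1, rfl⟩)
  · have h1 := KWBlock.numForms_of_isScrollBlock h
    exact Or.inl (Or.inr ⟨⟨i, h⟩, t, Nat.le_of_lt_succ (ht.trans_eq h1), rfl⟩)
  · exact Or.inr ⟨⟨i, h⟩, t, rfl⟩

/-- A system in `T` prescribes values of the coordinates under which every column of the normal form
becomes a column of the system. Thus the minors vanish and the homomorphism descends to the
determinantal ring. -/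
lemma exists_presentation : ∃ (c : ℕ) (P : KWPresentation F.shape (Fin c) (DeterminantalRing X)),
    P.toKWSystem = F.system ∧
    Submodule.span k ({r | ∃ a i, r = P.x a i} ∪ {r | ∃ j i, i ≤ F.shape.n j ∧ r = P.y j i} ∪
      {r | ∃ l i, r = P.z l i} ∪ Set.range P.u) = determinantalGrading X 1 := by
  obtain ⟨c, u, hu, hspan, hlift⟩ := F.exists_coordinates
  have hspan' : Submodule.span k ({r | ∃ a i, r = F.system.x a i} ∪
      {r | ∃ j i, i ≤ F.shape.n j ∧ r = F.system.y j i} ∪ {r | ∃ l i, r = F.system.z l i} ∪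
      Set.range fun b => Ideal.Quotient.mk (idealOfMinors X) (u b)) = determinantalGrading X 1 := by
    apply le_antisymm
    · refine Submodule.span_le.2 ?_
      rintro r (((⟨a, i, rfl⟩ | ⟨j, i, hi, rfl⟩) | ⟨l, i, rfl⟩) | ⟨b, rfl⟩)
      · simp only [system]
        split_ifs
        · exact zero_mem _
        · exact mem_determinantalGrading.2 ⟨_, F.isHomogeneous_entry _ _, rfl⟩
      · exact mem_determinantalGrading.2 ⟨_, F.isHomogeneous_entry _ _, rfl⟩
      · exact mem_determinantalGrading.2 ⟨_, F.isHomogeneous_entry _ _, rfl⟩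
      · exact mem_determinantalGrading.2 ⟨_, hu b, rfl⟩
    · rw [determinantalGrading, ← hspan, Submodule.map_span, Set.image_union, ← Set.range_comp,
        ← Set.range_comp]
      exact Submodule.span_mono (Set.union_subset_union_left _ F.range_form_subset)
  refine ⟨c, { F.system with
    u := fun b => Ideal.Quotient.mk _ (u b)
    adjoin_eq_top := ?_
    exists_lift := ?_ }, rfl, hspan'⟩
  · rw [eq_top_iff]
    intro r _
    obtain ⟨f, rfl⟩ := Ideal.Quotient.mk_surjective r
    have h1 : (Algebra.adjoin k (Set.range (MvPolynomial.X : Fin N → MvPolynomial (Fin N) k))).map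
        (Ideal.Quotient.mkₐ k (idealOfMinors X)) ≤
        Algebra.adjoin k ({r | ∃ a i, r = F.system.x a i} ∪
      {r | ∃ j i, i ≤ F.shape.n j ∧ r = F.system.y j i} ∪ {r | ∃ l i, r = F.system.z l i} ∪
      Set.range fun b => Ideal.Quotient.mk (idealOfMinors X) (u b)) := by
      rw [AlgHom.map_adjoin]
      refine Algebra.adjoin_le ?_
      rintro _ ⟨_, ⟨i, rfl⟩, rfl⟩
      have h2 : Ideal.Quotient.mk (idealOfMinors X) (MvPolynomial.X i) ∈ determinantalGrading X 1 :=
        mem_determinantalGrading.2 ⟨_, isHomogeneous_X k i, rfl⟩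
      rw [← hspan'] at h2
      exact Algebra.span_le_adjoin k _ h2
    refine h1 ⟨f, ?_, rfl⟩
    rw [adjoin_range_X]
    trivial
  · intro T _ _ E w
    obtain ⟨ψ, hψ, hψu⟩ := hlift T (fun a => F.formValue E a.1 a.2) w
    have hψ' : ∀ i t, ψ (F.form i t) = F.formValue E i t := fun i t => hψ ⟨i, t⟩
    refine ⟨Ideal.Quotient.liftₐ (idealOfMinors X) ψ (F.map_idealOfMinors_eq_zero hψ'),
      fun a i => ?_, fun j i hi => ?_, fun l i => ?_, fun b => hψu b⟩
    · change Ideal.Quotient.liftₐ (idealOfMinors X) ψ _ (if i = 0 then 0 else _) = _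
      split_ifs with h
      · rw [map_zero, h, E.x_zero]
      · have := F.map_entry_nil hψ' a (i - 1)
        rw [Nat.sub_add_cancel (Nat.one_le_iff_ne_zero.2 h)] at this
        exact this
    · exact F.map_entry_scr hψ' j hi
    · exact F.map_entry_jor hψ' l i

lemma LengthCondition.length_le {F : KWNormalForm X} (hF : F.LengthCondition) (a : F.shape.Nil)
    (j : F.shape.Scr) : F.shape.m a ≤ 2 * F.shape.n j := by
  have hlen : ∀ i m, F.block i = KWBlock.nilpotent m → (F.block i).length = m := by
    intro i m h
    rw [h]; rfl
  have hlen' : ∀ i m, F.block i = KWBlock.scroll m → (F.block i).length = m := by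
    intro i m h
    rw [h]; rfl
  have hfin : F.nilpotentLengths.Finite := by
    refine (Set.finite_range fun i => (F.block i).length).subset ?_
    rintro m ⟨i, h⟩
    exact ⟨i, hlen i m h⟩
  obtain ⟨ma, hma⟩ := a.2
  obtain ⟨nj, hnj⟩ := j.2
  obtain ⟨m, hm, hmax⟩ := hfin.exists_maximal ⟨ma, a.1, hma⟩
  have hm' : IsGreatest F.nilpotentLengths m := ⟨hm, fun b hb => by
    rcases le_total b m with h | h
    · exact h
    · exact hmax hb h⟩
  have hn' : IsLeast F.scrollLengths (sInf F.scrollLengths) :=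
    ⟨Nat.sInf_mem ⟨nj, j.1, hnj⟩, fun b hb => Nat.sInf_le hb⟩
  have h1 := hF m _ hm' hn'
  have h2 : (F.block a.1).length ≤ m := by
    rw [hlen _ _ hma]
    exact hm'.2 ⟨a.1, hma⟩
  have h3 : sInf F.scrollLengths ≤ (F.block j.1).length := by
    rw [hlen' _ _ hnj]
    exact hn'.2 ⟨j.1, hnj⟩
  change (F.block a.1).length ≤ 2 * (F.block j.1).length
  omega

theorem LengthCondition.isKoszulAlgebra {F : KWNormalForm X} (hF : F.LengthCondition)
    (hX : ∀ i j, (X i j).IsHomogeneous 1) : IsKoszulAlgebra (determinantalGrading X) := by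
  obtain ⟨c, P, -, hspan⟩ := F.exists_presentation
  have hmem : ∀ r ∈ {r | ∃ a i, r = P.x a i} ∪ {r | ∃ j i, i ≤ F.shape.n j ∧ r = P.y j i} ∪
      {r | ∃ l i, r = P.z l i} ∪ Set.range P.u, r ∈ determinantalGrading X 1 := by
    intro r hr
    rw [← hspan]
    exact Submodule.subset_span hr
  refine KWPresentation.isKoszulAlgebra (P := P) (hasLinearLifts_determinantalGrading hX)
    ⟨fun b => hmem _ (Or.inr ⟨b, rfl⟩), fun a i => hmem _ (Or.inl (Or.inl (Or.inl ⟨a, i, rfl⟩))),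
      fun j i hi => hmem _ (Or.inl (Or.inl (Or.inr ⟨j, i, hi, rfl⟩))),
      fun l i => hmem _ (Or.inl (Or.inr ⟨l, i, rfl⟩))⟩ ?_ hF.length_le
  rw [gradedMaximalIdeal_determinantalGrading hspan]
  apply le_antisymm
  · refine Ideal.span_le.2 ?_
    rintro r (((⟨a, i, rfl⟩ | ⟨j, i, hi, rfl⟩) | ⟨l, i, rfl⟩) | ⟨b, rfl⟩)
    · exact P.idealUXZ_le_idealMax (P.idealUX_le_idealUXZ (P.x_mem_idealUX a i))
    · exact P.y_mem_idealMax hi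
    · exact P.idealUXZ_le_idealMax (P.z_mem_idealUXZ l i)
    · exact P.idealUXZ_le_idealMax (P.idealUX_le_idealUXZ (P.u_mem_idealUX b))
  · exact P.idealMax_le (fun b => Ideal.subset_span (Or.inr ⟨b, rfl⟩))
      (fun a i => Ideal.subset_span (Or.inl (Or.inl (Or.inl ⟨a, i, rfl⟩))))
      (fun l i => Ideal.subset_span (Or.inl (Or.inr ⟨l, i, rfl⟩)))
      (fun j i hi => Ideal.subset_span (Or.inl (Or.inl (Or.inr ⟨j, i, hi, rfl⟩))))

end KWNormalForm

/-! ### Linear resolutions over the polynomial ring -/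

section Lifts

variable {k : Type*} [Field k] {N e : ℕ} {X : Matrix (Fin 2) (Fin e) (MvPolynomial (Fin N) k)}

/-- The ideal of minors contains no nonzero linear form, so in degree `1` the congruence is an
equality, with the constant terms as coefficients. -/
lemma exists_C_of_sub_mem {ι : Type*} [Fintype ι] (hX : ∀ i j, (X i j).IsHomogeneous 1)
    {d : ι → MvPolynomial (Fin N) k} (hd : ∀ r, (d r).IsHomogeneous 1)
    {f : MvPolynomial (Fin N) k} (hf : f.IsHomogeneous 1) {a : ι → MvPolynomial (Fin N) k}
    (h : f - ∑ r, a r * d r ∈ idealOfMinors X) :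
    f = ∑ r, C (coeff 0 (a r)) * d r := by
  have h1 := homogeneousComponent_mem_idealOfMinors hX h 1
  have h2 := eq_zero_of_mem_idealOfMinors hX h1 (homogeneousComponent_isHomogeneous _ _) (by omega)
  rw [map_sub, map_sum, homogeneousComponent_eq_self hf, sub_eq_zero] at h2
  rw [h2]
  refine Finset.sum_congr rfl fun r _ => ?_
  have := homogeneousComponent_mul_of_isHomogeneous (a r) (hd r) 0
  rwa [zero_add, homogeneousComponent_zero] at this

/-- The first three differentials of a linear resolution, lifted to the polynomial ring. -/
lemma IsKoszulAlgebra.exists_lifts (hX : ∀ i j, (X i j).IsHomogeneous 1)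
    (h : IsKoszulAlgebra (determinantalGrading X)) :
    ∃ (b₁ b₂ b₃ : ℕ) (d₀ : Fin b₁ → MvPolynomial (Fin N) k)
      (d₁ : Fin b₁ → Fin b₂ → MvPolynomial (Fin N) k)
      (d₂ : Fin b₂ → Fin b₃ → MvPolynomial (Fin N) k),
      (∀ r, (d₀ r).IsHomogeneous 1) ∧ (∀ r s, (d₁ r s).IsHomogeneous 1) ∧
      (∀ s q, (d₂ s q).IsHomogeneous 1) ∧
      (∀ s, ∑ r, d₁ r s * d₀ r ∈ idealOfMinors X) ∧
      (∀ r q, ∑ s, d₂ s q * d₁ r s ∈ idealOfMinors X) ∧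
      (∀ f : MvPolynomial (Fin N) k, f.IsHomogeneous 1 →
        ∃ a : Fin b₁ → k, f = ∑ r, C (a r) * d₀ r) ∧
      (∀ f : Fin b₁ → MvPolynomial (Fin N) k, (∀ r, (f r).IsHomogeneous 1) →
        ∑ r, f r * d₀ r ∈ idealOfMinors X → ∃ a : Fin b₂ → k, ∀ r, f r = ∑ s, C (a s) * d₁ r s) ∧
      (∀ z : Fin b₂ → MvPolynomial (Fin N) k, (∀ r, ∑ s, z s * d₁ r s ∈ idealOfMinors X) →
        ∃ a : Fin b₃ → MvPolynomial (Fin N) k,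
          ∀ s, z s - ∑ q, a q * d₂ s q ∈ idealOfMinors X) := by
  obtain ⟨L⟩ := h
  have h0 : 0 < L.rank 0 := by rw [L.rank_zero]; exact one_pos
  let r₀ : Fin (L.rank 0) := ⟨0, h0⟩
  have hr₀ : ∀ r, r = r₀ := fun r => by
    have := r.2
    have h1 := L.rank_zero
    ext
    simp only [r₀]
    omega
  choose d₀ hd₀ hd₀' using fun r => mem_determinantalGrading.1 (L.linear 0 r₀ r)
  choose d₁ hd₁ hd₁' using fun r s => mem_determinantalGrading.1 (L.linear 1 r s)
  choose d₂ hd₂ hd₂' using fun r s => mem_determinantalGrading.1 (L.linear 2 r s)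
  have e₀ : ∀ v : Fin (L.rank 1) → MvPolynomial (Fin N) k,
      (L.d 0).mulVecLin (fun r => Ideal.Quotient.mk _ (v r)) =
        fun _ => Ideal.Quotient.mk _ (∑ r, v r * d₀ r) := by
    intro v
    ext r
    rw [hr₀ r, Matrix.mulVecLin_apply, Matrix.mulVec, dotProduct, map_sum]
    refine Finset.sum_congr rfl fun i _ => ?_
    rw [map_mul, hd₀', mul_comm]
  have e₁ : ∀ v : Fin (L.rank 2) → MvPolynomial (Fin N) k,
      (L.d 1).mulVecLin (fun r => Ideal.Quotient.mk _ (v r)) =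
        fun r => Ideal.Quotient.mk _ (∑ s, v s * d₁ r s) := by
    intro v
    ext r
    rw [Matrix.mulVecLin_apply, Matrix.mulVec, dotProduct, map_sum]
    refine Finset.sum_congr rfl fun i _ => ?_
    rw [map_mul, hd₁', mul_comm]
  have e₂ : ∀ v : Fin (L.rank 3) → MvPolynomial (Fin N) k,
      (L.d 2).mulVecLin (fun r => Ideal.Quotient.mk _ (v r)) =
        fun r => Ideal.Quotient.mk _ (∑ s, v s * d₂ r s) := by
    intro v
    ext r
    rw [Matrix.mulVecLin_apply, Matrix.mulVec, dotProduct, map_sum]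
    refine Finset.sum_congr rfl fun i _ => ?_
    rw [map_mul, hd₂', mul_comm]
  have hlift : ∀ {b : ℕ} (v : Fin b → DeterminantalRing X),
      ∃ V : Fin b → MvPolynomial (Fin N) k, v = fun r => Ideal.Quotient.mk _ (V r) := by
    intro b v
    choose V hV using fun r => Ideal.Quotient.mk_surjective (v r)
    exact ⟨V, funext fun r => (hV r).symm⟩
  refine ⟨_, _, _, d₀, d₁, d₂, hd₀, hd₁, hd₂, fun s => ?_, fun r q => ?_, fun f hf => ?_,
    fun f hf hf0 => ?_, fun z hz => ?_⟩
  · have h1 := (L.exact_succ 0 _).2 ⟨fun r => Ideal.Quotient.mk _ (if r = s then 1 else 0), rfl⟩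
    rw [e₁, e₀] at h1
    have h2 := Ideal.Quotient.eq_zero_iff_mem.1 (congrFun h1 r₀)
    simpa [Finset.sum_ite_eq'] using h2
  · have h1 := (L.exact_succ 1 _).2 ⟨fun r => Ideal.Quotient.mk _ (if r = q then 1 else 0), rfl⟩
    rw [e₂, e₁] at h1
    have h2 := Ideal.Quotient.eq_zero_iff_mem.1 (congrFun h1 r)
    simpa [Finset.sum_ite_eq'] using h2
  · have h1 : (fun _ => Ideal.Quotient.mk _ f) ∈ LinearMap.range (L.d 0).mulVecLin := by
      rw [L.exact_zero, Submodule.mem_pi]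
      intro _ _
      refine Ideal.subset_span ?_
      simp only [Set.mem_iUnion, Set.mem_Ioi]
      exact ⟨1, one_pos, mem_determinantalGrading.2 ⟨f, hf, rfl⟩⟩
    obtain ⟨v, hv⟩ := h1
    obtain ⟨V, rfl⟩ := hlift v
    rw [e₀] at hv
    exact ⟨_, exists_C_of_sub_mem hX hd₀ hf (Ideal.Quotient.eq.1 (congrFun hv r₀).symm)⟩
  · have h1 : (L.d 0).mulVecLin (fun r => Ideal.Quotient.mk _ (f r)) = 0 := by
      rw [e₀]
      ext r
      exact Ideal.Quotient.eq_zero_iff_mem.2 hf0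
    obtain ⟨v, hv⟩ := (L.exact_succ 0 _).1 h1
    obtain ⟨V, rfl⟩ := hlift v
    rw [e₁] at hv
    exact ⟨fun s => coeff 0 (V s), fun r => exists_C_of_sub_mem hX (hd₁ r) (hf r)
      (Ideal.Quotient.eq.1 (congrFun hv r).symm)⟩
  · have h1 : (L.d 1).mulVecLin (fun r => Ideal.Quotient.mk _ (z r)) = 0 := by
      rw [e₁]
      ext r
      exact Ideal.Quotient.eq_zero_iff_mem.2 (hz r)
    obtain ⟨v, hv⟩ := (L.exact_succ 1 _).1 h1
    obtain ⟨V, rfl⟩ := hlift v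
    rw [e₂] at hv
    exact ⟨V, fun s => Ideal.Quotient.eq.1 (congrFun hv s).symm⟩

end Lifts

/-! ### The relations between the entries of a nilpotent block and a scroll block -/

section Theta

variable {k : Type*} [Field k]

/-- The map `e i ↦ s ξ i - t ξ (i - 1)`, where `ξ i = 0` unless `1 ≤ i < m`. -/
noncomputable def theta (k : Type*) [Field k] (m : ℕ) :
    (ℕ → MvPolynomial (Fin 2) k) →ₗ[MvPolynomial (Fin 2) k] (ℕ → MvPolynomial (Fin 2) k) where
  toFun F i := if 1 ≤ i ∧ i < m then MvPolynomial.X 0 * F i - MvPolynomial.X 1 * F (i + 1) else 0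
  map_add' F G := by
    ext1 i
    simp only [Pi.add_apply]
    split_ifs
    · ring
    · rw [add_zero]
  map_smul' c F := by
    ext1 i
    simp only [Pi.smul_apply, smul_eq_mul, RingHom.id_apply]
    split_ifs
    · ring
    · rw [mul_zero]

lemma theta_apply (m : ℕ) (F : ℕ → MvPolynomial (Fin 2) k) (i : ℕ) : theta k m F i =
    if 1 ≤ i ∧ i < m then MvPolynomial.X 0 * F i - MvPolynomial.X 1 * F (i + 1) else 0 := rfl

/-- Write `s`, `t` for the two variables. In the kernel `s * F i = t * F (i + 1)` for `1 ≤ i < m`, a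
geometric progression of ratio `s / t`; as `t` is prime and does not divide `s`, the power `t ^ (m -
1)` divides its first term. -/
lemma exists_of_theta_eq_zero {m : ℕ} {F : ℕ → MvPolynomial (Fin 2) k} (h : theta k m F = 0) :
    ∃ g, ∀ i, 1 ≤ i → i ≤ m →
      F i = g * (MvPolynomial.X 0 ^ (i - 1) * MvPolynomial.X 1 ^ (m - i)) := by
  rcases Nat.eq_zero_or_pos m with rfl | hm
  · exact ⟨0, fun i h1 h2 => by omega⟩
  have h1 : ∀ i, i + 1 ≤ m →
      (MvPolynomial.X 0 : MvPolynomial (Fin 2) k) ^ i * F 1 = MvPolynomial.X 1 ^ i * F (i + 1) := by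
    intro i hi
    induction i with
    | zero => simp
    | succ i ih =>
      have h2 := congrFun h (i + 1)
      rw [theta_apply, if_pos ⟨by omega, by omega⟩, Pi.zero_apply, sub_eq_zero] at h2
      rw [pow_succ', mul_assoc, ih (by omega), mul_left_comm, h2, pow_succ]
      ring
  have hp : Prime (MvPolynomial.X 1 : MvPolynomial (Fin 2) k) := X_prime
  have h2 : (MvPolynomial.X 1 : MvPolynomial (Fin 2) k) ^ (m - 1) ∣ F 1 := by
    refine hp.pow_dvd_of_dvd_mul_left (m - 1) (a := MvPolynomial.X 0 ^ (m - 1)) ?_ ?_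
    · intro h3
      have := hp.dvd_of_dvd_pow h3
      rw [X_dvd_X] at this
      simp at this
    · rw [h1 (m - 1) (by omega)]
      exact dvd_mul_right _ _
  obtain ⟨g, hg⟩ := h2
  refine ⟨g, fun i hi1 him => ?_⟩
  have h3 := h1 (i - 1) (by omega)
  rw [Nat.sub_add_cancel hi1, hg] at h3
  have h4 : (MvPolynomial.X 1 : MvPolynomial (Fin 2) k) ^ (i - 1) ≠ 0 := pow_ne_zero _ (X_ne_zero _)
  refine mul_left_cancel₀ h4 ?_
  rw [← h3, show m - 1 = (i - 1) + (m - i) by omega, pow_add]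
  ring

/-- The vector generating the kernel has degree `m - 1`, so nothing survives in smaller degrees. The
coordinates outside `1, …, m` are not constrained by `theta`. -/
lemma eq_zero_of_theta_eq_zero {m d : ℕ} {F : ℕ → MvPolynomial (Fin 2) k} (h : theta k m F = 0)
    (hF : ∀ i, (F i).IsHomogeneous d) (hd : d + 1 < m) {i : ℕ} (h1 : 1 ≤ i) (him : i ≤ m) :
    F i = 0 := by
  obtain ⟨g, hg⟩ := exists_of_theta_eq_zero h
  rw [← homogeneousComponent_eq_self (hF i), hg i h1 him]
  refine homogeneousComponent_mul_of_isHomogeneous_of_lt g (j := i - 1 + (m - i)) ?_ (by omega)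
  exact (isHomogeneous_X_pow _ _).mul (isHomogeneous_X_pow _ _)

/-- The standard basis vectors `ξ i`, where `ξ i = 0` unless `1 ≤ i < m`. -/
noncomputable def nilVector (k : Type*) [Field k] (m i : ℕ) : ℕ → MvPolynomial (Fin 2) k :=
  if 1 ≤ i ∧ i < m then Pi.single i 1 else 0

lemma theta_single (m i : ℕ) :
    theta k m (Pi.single (i + 1) 1) =
      (MvPolynomial.X 0 : MvPolynomial (Fin 2) k) • nilVector k m (i + 1) -
        (MvPolynomial.X 1 : MvPolynomial (Fin 2) k) • nilVector k m i := by
  ext1 j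
  have h1 : ∀ l, nilVector k m l j = if 1 ≤ j ∧ j < m then (Pi.single l 1 : ℕ → _) j else 0 := by
    intro l
    rw [nilVector]
    by_cases hl : j = l
    · subst hl
      split_ifs <;> simp
    · split_ifs <;> simp [Pi.single_eq_of_ne hl]
  rw [theta_apply, Pi.sub_apply, Pi.smul_apply, Pi.smul_apply, h1, h1, smul_eq_mul, smul_eq_mul]
  have h2 : (Pi.single (i + 1) 1 : ℕ → MvPolynomial (Fin 2) k) (j + 1) =
      (Pi.single i 1 : ℕ → MvPolynomial (Fin 2) k) j := by
    simp [Pi.single_apply]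
  rw [h2]
  split_ifs
  · rfl
  · simp

end Theta

/-! ### A derivation along the curve of a scroll block -/

namespace KWNormalForm

variable {k : Type v} [Field k] {N e : ℕ} {X : Matrix (Fin 2) (Fin e) (MvPolynomial (Fin N) k)}
  (F : KWNormalForm X)

/-- A homomorphism to the polynomial ring in two variables which does not vanish on a scroll block
only, with a derivation along it which does not vanish on a nilpotent block only. -/
structure NilScrollDerivation (i₁ i₂ : Fin F.numBlocks) (m n : ℕ) where
  /-- The homomorphism. -/
  β : MvPolynomial (Fin N) k →ₐ[k] MvPolynomial (Fin 2) k
  /-- The derivation. -/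
  D : MvPolynomial (Fin N) k →ₗ[k] (ℕ → MvPolynomial (Fin 2) k)
  leibniz : ∀ f g, D (f * g) = β f • D g + β g • D f
  β_scroll : ∀ t, t ≤ n → β (F.entry i₂ t) = MvPolynomial.X 0 ^ (n - t) * MvPolynomial.X 1 ^ t
  D_scroll : ∀ t, t ≤ n → D (F.entry i₂ t) = 0
  β_nil : ∀ t, β (F.entry i₁ t) = 0
  D_nil : ∀ t, D (F.entry i₁ t) = nilVector k m (t + 1)
  β_other : ∀ i, i ≠ i₁ → i ≠ i₂ → ∀ t, β (F.entry i t) = 0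
  D_other : ∀ i, i ≠ i₁ → i ≠ i₂ → ∀ t, D (F.entry i t) = 0
  isHomogeneous_β : ∀ f, f.IsHomogeneous 1 → (β f).IsHomogeneous n

/-- A homomorphism together with a derivation along it is a homomorphism to a trivial square-zero
extension, and values on the coordinates determine one. -/
lemma exists_nilScrollDerivation {i₁ i₂ : Fin F.numBlocks} {m n : ℕ}
    (h₁ : F.block i₁ = KWBlock.nilpotent m) (h₂ : F.block i₂ = KWBlock.scroll n) :
    Nonempty (F.NilScrollDerivation i₁ i₂ m n) := by
  have hne : i₁ ≠ i₂ := by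
    rintro rfl
    rw [h₁] at h₂
    cases h₂
  have hn₁ : (F.block i₁).numForms = m - 1 := by rw [h₁]; rfl
  have hn₂ : (F.block i₂).numForms = n + 1 := by rw [h₂]; rfl
  obtain ⟨c, u, hu, hspan, hlift⟩ := F.exists_coordinates
  obtain ⟨ψ, hψ, hψu⟩ := hlift
    (TrivSqZeroExt (MvPolynomial (Fin 2) k) (ℕ → MvPolynomial (Fin 2) k))
    (fun a => if a.1 = i₁ then TrivSqZeroExt.inr (nilVector k m (a.2 + 1)) else if a.1 = i₂ then
      TrivSqZeroExt.inl (MvPolynomial.X 0 ^ (n - a.2) * MvPolynomial.X 1 ^ (a.2 : ℕ)) else 0)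
    (fun _ => 0)
  have hent : ∀ i t, (h : t < (F.block i).numForms) → ψ (F.entry i t) = if i = i₁ then
      TrivSqZeroExt.inr (nilVector k m (t + 1)) else if i = i₂ then
      TrivSqZeroExt.inl (MvPolynomial.X 0 ^ (n - t) * MvPolynomial.X 1 ^ t) else 0 := by
    intro i t h
    rw [entry, KWBlock.extendZero_of_lt _ h]
    exact hψ ⟨i, ⟨t, h⟩⟩
  have hent₁ : ∀ t, ψ (F.entry i₁ t) = TrivSqZeroExt.inr (nilVector k m (t + 1)) := by
    intro t
    rcases lt_or_ge t (F.block i₁).numForms with h | h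
    · rw [hent _ _ h, if_pos rfl]
    · rw [entry, KWBlock.extendZero_of_le _ h, map_zero, nilVector, if_neg (by omega),
        TrivSqZeroExt.inr_zero]
  have hent₂ : ∀ t, t ≤ n → ψ (F.entry i₂ t) =
      TrivSqZeroExt.inl (MvPolynomial.X 0 ^ (n - t) * MvPolynomial.X 1 ^ t) := by
    intro t ht
    rw [hent _ _ (by omega), if_neg hne.symm, if_pos rfl]
  have hent₃ : ∀ i, i ≠ i₁ → i ≠ i₂ → ∀ t, ψ (F.entry i t) = 0 := by
    intro i h1 h2 t
    rcases lt_or_ge t (F.block i).numForms with h | h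
    · rw [hent _ _ h, if_neg h1, if_neg h2]
    · rw [entry, KWBlock.extendZero_of_le _ h, map_zero]
  refine ⟨{
    β := (TrivSqZeroExt.fstHom k _ _).comp ψ
    D := ((TrivSqZeroExt.sndHom (MvPolynomial (Fin 2) k) _).restrictScalars k).comp ψ.toLinearMap
    leibniz := fun f g => ?_
    β_scroll := fun t ht => ?_
    D_scroll := fun t ht => ?_
    β_nil := fun t => ?_
    D_nil := fun t => ?_
    β_other := fun i hi hi' t => ?_
    D_other := fun i hi hi' t => ?_
    isHomogeneous_β := fun f hf => ?_ }⟩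
  · simp [TrivSqZeroExt.snd_mul]
  · simp [hent₂ t ht]
  · simp [hent₂ t ht]
  · simp [hent₁ t]
  · simp [hent₁ t]
  · simp [hent₃ i hi hi' t]
  · simp [hent₃ i hi hi' t]
  · rw [← mem_homogeneousSubmodule, ← hspan] at hf
    have : Submodule.span k ((Set.range fun a : Σ i, Fin (F.block i).numForms => F.form a.1 a.2) ∪
        Set.range u) ≤ (homogeneousSubmodule (Fin 2) k n).comap
          ((TrivSqZeroExt.fstHom k _ _).comp ψ).toLinearMap := by
      refine Submodule.span_le.2 ?_
      rintro _ (⟨⟨i, t⟩, rfl⟩ | ⟨b, rfl⟩)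
      · change ((TrivSqZeroExt.fstHom k _ _) (ψ (F.form i t))).IsHomogeneous n
        rw [hψ ⟨i, t⟩]
        simp only
        split_ifs with h1 h2
        · simpa using isHomogeneous_zero _ _ _
        · subst h2
          have ht := t.2
          have : n = n - t + t := by omega
          rw [TrivSqZeroExt.fstHom_apply, TrivSqZeroExt.fst_inl]
          conv => arg 2; rw [this]
          exact (isHomogeneous_X_pow _ _).mul (isHomogeneous_X_pow _ _)
        · simpa using isHomogeneous_zero _ _ _
      · change ((TrivSqZeroExt.fstHom k _ _) (ψ (u b))).IsHomogeneous n
        rw [hψu, map_zero]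
        exact isHomogeneous_zero _ _ _
    exact this hf

variable {F} {i₁ i₂ : Fin F.numBlocks} {m n : ℕ} (Δ : F.NilScrollDerivation i₁ i₂ m n)

namespace NilScrollDerivation

lemma D_C_mul (a : k) (f : MvPolynomial (Fin N) k) :
    Δ.D (C a * f) = (C a : MvPolynomial (Fin 2) k) • Δ.D f := by
  rw [← smul_eq_C_mul, map_smul]
  ext1 i
  rw [Pi.smul_apply, Pi.smul_apply, smul_eq_mul, smul_eq_C_mul]

/-- On the curve every column is proportional to `(s, t)`, with factor `p`. For a column `(a, b)`
the vector `s * D b - t * D a` measures the first-order deviation from this; on a nilpotent column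
it is the value of `theta` on a basis vector, and on all other columns it is zero. -/
lemma exists_column (h₁ : F.block i₁ = KWBlock.nilpotent m) (h₂ : F.block i₂ = KWBlock.scroll n)
    (c : Fin e) : ∃ (p : MvPolynomial (Fin 2) k) (E : ℕ → MvPolynomial (Fin 2) k),
      p.IsHomogeneous (n - 1) ∧ (∀ i, (E i).IsHomogeneous 0) ∧
      Δ.β (F.normalMatrix 0 c) = MvPolynomial.X 0 * p ∧
      Δ.β (F.normalMatrix 1 c) = MvPolynomial.X 1 * p ∧
      (MvPolynomial.X 0 : MvPolynomial (Fin 2) k) • Δ.D (F.normalMatrix 1 c) -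
        (MvPolynomial.X 1 : MvPolynomial (Fin 2) k) • Δ.D (F.normalMatrix 0 c) = theta k m E := by
  obtain ⟨⟨i, t⟩, rfl⟩ := F.column.symm.surjective c
  rw [normalMatrix_column_symm, normalMatrix_column_symm]
  by_cases hi₁ : i = i₁
  · subst hi₁
    obtain ⟨e1, e2⟩ := KWBlock.matrix_of_isNilpotentBlock ⟨m, h₁⟩ (F.form i) t
    change _ = F.entry i t at e2
    have e1' : Δ.β ((F.block i).matrix (F.form i) 0 t) = 0 ∧
        Δ.D ((F.block i).matrix (F.form i) 0 t) = nilVector k m t := by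
      rw [e1]
      split_ifs with h0
      · rw [map_zero, map_zero, nilVector, if_neg (by omega)]
        exact ⟨rfl, rfl⟩
      · refine ⟨Δ.β_nil _, ?_⟩
        have := Δ.D_nil ((t : ℕ) - 1)
        rwa [Nat.sub_add_cancel (Nat.one_le_iff_ne_zero.2 h0)] at this
    refine ⟨0, Pi.single (t + 1) 1, isHomogeneous_zero _ _ _, fun j => ?_, ?_, ?_, ?_⟩
    · rw [Pi.single_apply]
      split_ifs
      · exact isHomogeneous_one _ _
      · exact isHomogeneous_zero _ _ _
    · rw [e1'.1, mul_zero]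
    · rw [e2, Δ.β_nil, mul_zero]
    · rw [e1'.2, e2, Δ.D_nil, theta_single]
  by_cases hi₂ : i = i₂
  · subst hi₂
    obtain ⟨e1, e2⟩ := KWBlock.matrix_of_isScrollBlock ⟨n, h₂⟩ (F.form i) t
    change _ = F.entry i t at e1
    change _ = F.entry i (t + 1) at e2
    have ht : (t : ℕ) < n := by
      have h3 := t.2
      have h4 : (F.block i).length = n := by rw [h₂]; rfl
      omega
    refine ⟨MvPolynomial.X 0 ^ (n - 1 - t) * MvPolynomial.X 1 ^ (t : ℕ), 0, ?_,
      fun j => isHomogeneous_zero _ _ _, ?_, ?_, ?_⟩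
    · have : n - 1 = n - 1 - t + t := by omega
      conv => arg 2; rw [this]
      exact (isHomogeneous_X_pow _ _).mul (isHomogeneous_X_pow _ _)
    · rw [e1, Δ.β_scroll _ ht.le, show n - t = n - 1 - t + 1 by omega]
      ring
    · rw [e2, Δ.β_scroll _ ht, show n - (t + 1) = n - 1 - t by omega, pow_succ]
      ring
    · rw [e1, e2, Δ.D_scroll _ ht.le, Δ.D_scroll _ ht]
      simp
  have hβ := Δ.β_other i hi₁ hi₂
  have hD := Δ.D_other i hi₁ hi₂
  have key : ∀ r, Δ.β ((F.block i).matrix (F.form i) r t) = 0 ∧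
      Δ.D ((F.block i).matrix (F.form i) r t) = 0 := by
    have h0 : ∀ r : Fin 2, r = 0 ∨ r = 1 := by decide
    rcases (F.block i).block_cases with h | h | h
    · obtain ⟨e1, e2⟩ := KWBlock.matrix_of_isNilpotentBlock h (F.form i) t
      intro r
      rcases h0 r with rfl | rfl
      · rw [e1]
        split_ifs
        · exact ⟨map_zero _, map_zero _⟩
        · exact ⟨hβ _, hD _⟩
      · rw [e2]
        exact ⟨hβ _, hD _⟩
    · obtain ⟨e1, e2⟩ := KWBlock.matrix_of_isScrollBlock h (F.form i) t
      intro r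
      rcases h0 r with rfl | rfl
      · rw [e1]
        exact ⟨hβ _, hD _⟩
      · rw [e2]
        exact ⟨hβ _, hD _⟩
    · obtain ⟨e1, e2⟩ := KWBlock.matrix_of_isJordanBlock h (F.form i) t
      change _ = F.entry i t at e1
      change _ = F.entry i (t + 1) + _ • F.entry i t at e2
      intro r
      rcases h0 r with rfl | rfl
      · rw [e1]
        exact ⟨hβ _, hD _⟩
      · rw [e2, map_add, map_add, map_smul, map_smul, hβ, hβ, hD, hD]
        simp
  refine ⟨0, 0, isHomogeneous_zero _ _ _, fun j => isHomogeneous_zero _ _ _, ?_, ?_, ?_⟩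
  · rw [(key 0).1, mul_zero]
  · rw [(key 1).1, mul_zero]
  · rw [(key 0).2, (key 1).2]
    simp

/-- For columns `(a, b)`, `(a', b')` with factors `p`, `p'`, the Leibniz rule turns the minor into
`p * (s * D b' - t * D a') - p' * (s * D b - t * D a)`, a value of `theta` on a vector of degree `n
- 1`. -/
lemma map_minor (h₁ : F.block i₁ = KWBlock.nilpotent m) (h₂ : F.block i₂ = KWBlock.scroll n)
    (c : Fin 2 → Fin e) : Δ.β (F.normalMatrix.submatrix id c).det = 0 ∧
      ∃ E : ℕ → MvPolynomial (Fin 2) k, (∀ i, (E i).IsHomogeneous (n - 1)) ∧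
        Δ.D (F.normalMatrix.submatrix id c).det = theta k m E := by
  obtain ⟨p, E, hp, hE, e1, e2, e3⟩ := Δ.exists_column h₁ h₂ (c 0)
  obtain ⟨p', E', hp', hE', e1', e2', e3'⟩ := Δ.exists_column h₁ h₂ (c 1)
  rw [Matrix.det_fin_two]
  simp only [Matrix.submatrix_apply, id_eq]
  constructor
  · rw [map_sub, map_mul, map_mul, e1, e2, e1', e2']
    ring
  · refine ⟨p • E' - p' • E, fun i => ?_, ?_⟩
    · have h3 := hp.mul (hE' i)
      have h4 := hp'.mul (hE i)
      rw [add_zero] at h3 h4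
      exact h3.sub h4
    · rw [(theta k m).map_sub, (theta k m).map_smul, (theta k m).map_smul, ← e3, ← e3',
        map_sub, Δ.leibniz, Δ.leibniz, e1, e2, e1', e2']
      simp only [smul_sub, smul_smul]
      rw [mul_comm p, mul_comm p, mul_comm p', mul_comm p']
      abel

lemma β_eq_zero (h₁ : F.block i₁ = KWBlock.nilpotent m) (h₂ : F.block i₂ = KWBlock.scroll n)
    {f : MvPolynomial (Fin N) k} (hf : f ∈ idealOfMinors X) : Δ.β f = 0 := by
  rw [← F.idealOfMinors_normalMatrix] at hf
  obtain ⟨a, rfl⟩ := exists_eq_sum_minors hf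
  rw [map_sum]
  refine Finset.sum_eq_zero fun c _ => ?_
  rw [map_mul, (Δ.map_minor h₁ h₂ c).1, mul_zero]

lemma D_mul (h₁ : F.block i₁ = KWBlock.nilpotent m) (h₂ : F.block i₂ = KWBlock.scroll n)
    {f : MvPolynomial (Fin N) k} (hf : f ∈ idealOfMinors X) (g : MvPolynomial (Fin N) k) :
    Δ.D (g * f) = Δ.β g • Δ.D f := by
  rw [Δ.leibniz, Δ.β_eq_zero h₁ h₂ hf, zero_smul, add_zero]

lemma exists_D_eq (h₁ : F.block i₁ = KWBlock.nilpotent m) (h₂ : F.block i₂ = KWBlock.scroll n)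
    {f : MvPolynomial (Fin N) k} (hf : f ∈ idealOfMinors X) :
    ∃ E : ℕ → MvPolynomial (Fin 2) k, Δ.D f = theta k m E := by
  rw [← F.idealOfMinors_normalMatrix] at hf
  obtain ⟨a, rfl⟩ := exists_eq_sum_minors hf
  choose h0 E hE hED using Δ.map_minor h₁ h₂
  refine ⟨∑ c, Δ.β (a c) • E c, ?_⟩
  rw [map_sum, map_sum]
  refine Finset.sum_congr rfl fun c _ => ?_
  rw [Δ.leibniz, h0, zero_smul, add_zero, hED, map_smul]

lemma isHomogeneous_normalMatrix (F : KWNormalForm X) (r : Fin 2) (c : Fin e) :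
    (F.normalMatrix r c).IsHomogeneous 1 := by
  obtain ⟨⟨i, t⟩, rfl⟩ := F.column.symm.surjective c
  rw [normalMatrix_column_symm]
  have h0 : r = 0 ∨ r = 1 := by fin_cases r <;> simp
  rcases (F.block i).block_cases with h | h | h
  · obtain ⟨e1, e2⟩ := KWBlock.matrix_of_isNilpotentBlock h (F.form i) t
    rcases h0 with rfl | rfl
    · rw [e1]
      split_ifs
      · exact isHomogeneous_zero _ _ _
      · exact F.isHomogeneous_entry _ _
    · rw [e2]
      exact F.isHomogeneous_entry _ _
  · obtain ⟨e1, e2⟩ := KWBlock.matrix_of_isScrollBlock h (F.form i) t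
    rcases h0 with rfl | rfl
    · rw [e1]
      exact F.isHomogeneous_entry _ _
    · rw [e2]
      exact F.isHomogeneous_entry _ _
  · obtain ⟨e1, e2⟩ := KWBlock.matrix_of_isJordanBlock h (F.form i) t
    rcases h0 with rfl | rfl
    · rw [e1]
      exact F.isHomogeneous_entry _ _
    · rw [e2]
      exact (F.isHomogeneous_entry _ _).add
        ((homogeneousSubmodule _ _ _).smul_mem _ (F.isHomogeneous_entry _ _))

lemma exists_D_eq_of_isHomogeneous (h₁ : F.block i₁ = KWBlock.nilpotent m)
    (h₂ : F.block i₂ = KWBlock.scroll n) {f : MvPolynomial (Fin N) k} (hf : f ∈ idealOfMinors X)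
    (hf2 : f.IsHomogeneous 2) : ∃ E : ℕ → MvPolynomial (Fin 2) k,
      (∀ i, (E i).IsHomogeneous (n - 1)) ∧ Δ.D f = theta k m E := by
  rw [← F.idealOfMinors_normalMatrix] at hf
  obtain ⟨a, rfl⟩ := exists_eq_sum_minors_of_isHomogeneous (isHomogeneous_normalMatrix F) hf hf2
  choose h0 E hE hED using Δ.map_minor h₁ h₂
  refine ⟨∑ c, (C (a c) : MvPolynomial (Fin 2) k) • E c, fun i => ?_, ?_⟩
  · rw [Finset.sum_apply]
    refine IsHomogeneous.sum _ _ _ fun c _ => ?_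
    exact (hE c i).C_mul (a c)
  · rw [map_sum, map_sum]
    refine Finset.sum_congr rfl fun c _ => ?_
    rw [Δ.D_C_mul, hED, map_smul]

end NilScrollDerivation

end KWNormalForm

namespace KWNormalForm

variable {k : Type v} [Field k] {N e : ℕ} {X : Matrix (Fin 2) (Fin e) (MvPolynomial (Fin N) k)}
  {F : KWNormalForm X} {i₁ i₂ : Fin F.numBlocks} {m n : ℕ}

/-! ### Algebras with a long nilpotent block are not Koszul -/

namespace NilScrollDerivation

variable (Δ : F.NilScrollDerivation i₁ i₂ m n)

/-- The obstruction to the exactness of a linear complex: the pairing of a cycle with the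
relations between the nilpotent block and the scroll block is divisible. -/
lemma exists_pairing_eq (h₁ : F.block i₁ = KWBlock.nilpotent m)
    (h₂ : F.block i₂ = KWBlock.scroll n) (hn : 0 < n) (hmn : 2 * n < m) {b₁ b₂ b₃ : ℕ}
    {d₀ : Fin b₁ → MvPolynomial (Fin N) k} {d₁ : Fin b₁ → Fin b₂ → MvPolynomial (Fin N) k}
    {d₂ : Fin b₂ → Fin b₃ → MvPolynomial (Fin N) k} (hd₀ : ∀ r, (d₀ r).IsHomogeneous 1)
    (hd₁ : ∀ r s, (d₁ r s).IsHomogeneous 1) (hd₂ : ∀ s q, (d₂ s q).IsHomogeneous 1)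
    (h01 : ∀ s, ∑ r, d₁ r s * d₀ r ∈ idealOfMinors X)
    (h12 : ∀ r q, ∑ s, d₂ s q * d₁ r s ∈ idealOfMinors X)
    {E : Fin b₂ → ℕ → MvPolynomial (Fin 2) k} (hE : ∀ s i, (E s i).IsHomogeneous (n - 1))
    (hED : ∀ s, Δ.D (∑ r, d₁ r s * d₀ r) = theta k m (E s))
    {z : Fin b₂ → MvPolynomial (Fin N) k} (hz : ∀ r, ∑ s, z s * d₁ r s = 0)
    {a : Fin b₃ → MvPolynomial (Fin N) k} (ha : ∀ s, z s - ∑ q, a q * d₂ s q ∈ idealOfMinors X) :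
    ∃ g : Fin b₁ → MvPolynomial (Fin 2) k,
      ∑ s, Δ.β (z s) * E s 1 = (∑ r, g r * Δ.β (d₀ r)) * MvPolynomial.X 1 ^ (m - 1) := by
  choose E' hE' hED' using fun r q => Δ.exists_D_eq_of_isHomogeneous h₁ h₂ (h12 r q)
    (IsHomogeneous.sum _ _ _ fun s _ => (hd₂ s q).mul (hd₁ r s))
  choose E'' hED'' using fun s => Δ.exists_D_eq h₁ h₂ (ha s)
  have hβa : ∀ s, Δ.β (z s) = ∑ q, Δ.β (a q) * Δ.β (d₂ s q) := by
    intro s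
    have := Δ.β_eq_zero h₁ h₂ (ha s)
    rw [map_sub, sub_eq_zero, map_sum] at this
    rw [this]
    exact Finset.sum_congr rfl fun q _ => map_mul _ _ _
  -- The two vectors have the same image under `theta`, and their degree `n + (n - 1)` is below `m -
  -- 1`. This is the decisive use of `2 * n < m`.
  have hcol : ∀ q, ∑ s, Δ.β (d₂ s q) * E s 1 = ∑ r, Δ.β (d₀ r) * E' r q 1 := by
    intro q
    have h3 : theta k m (∑ s, Δ.β (d₂ s q) • E s - ∑ r, Δ.β (d₀ r) • E' r q) = 0 := by
      rw [map_sub, map_sum, map_sum, sub_eq_zero]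
      have e1 : ∀ s, theta k m (Δ.β (d₂ s q) • E s) = Δ.D (d₂ s q * ∑ r, d₁ r s * d₀ r) := by
        intro s
        rw [map_smul, ← hED, Δ.D_mul h₁ h₂ (h01 s)]
      have e2 : ∀ r, theta k m (Δ.β (d₀ r) • E' r q) = Δ.D (d₀ r * ∑ s, d₂ s q * d₁ r s) := by
        intro r
        rw [map_smul, ← hED', Δ.D_mul h₁ h₂ (h12 r q)]
      simp only [e1, e2]
      rw [← map_sum, ← map_sum]
      congr 1
      simp only [Finset.mul_sum]
      rw [Finset.sum_comm]
      refine Finset.sum_congr rfl fun r _ => Finset.sum_congr rfl fun s _ => ?_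
      ring
    have h4 := eq_zero_of_theta_eq_zero h3 (d := n + (n - 1)) (fun i => ?_) (by omega) le_rfl
      (by omega : 1 ≤ m)
    · simpa [sub_eq_zero] using h4
    · simp only [Pi.sub_apply, Finset.sum_apply, Pi.smul_apply, smul_eq_mul]
      exact (IsHomogeneous.sum _ _ _ fun s _ => (Δ.isHomogeneous_β _ (hd₂ s q)).mul (hE s i)).sub
        (IsHomogeneous.sum _ _ _ fun r _ => (Δ.isHomogeneous_β _ (hd₀ r)).mul (hE' r q i))
  -- Since `z` is a syzygy of `d₁` in the polynomial ring itself, the contributions of `d₁ d₂` and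
  -- of `z - d₂ a` add up to a vector in the kernel of `theta`, whose first coordinate is divisible
  -- by `t ^ (m - 1)`.
  have hrow : ∀ r, ∃ g, ∑ q, Δ.β (a q) * E' r q 1 + ∑ s, Δ.β (d₁ r s) * E'' s 1 =
      g * MvPolynomial.X 1 ^ (m - 1) := by
    intro r
    have h3 : theta k m (∑ q, Δ.β (a q) • E' r q + ∑ s, Δ.β (d₁ r s) • E'' s) = 0 := by
      rw [map_add, map_sum, map_sum]
      have e1 : ∀ q, theta k m (Δ.β (a q) • E' r q) = Δ.D (a q * ∑ s, d₂ s q * d₁ r s) := by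
        intro q
        rw [map_smul, ← hED', Δ.D_mul h₁ h₂ (h12 r q)]
      have e2 : ∀ s, theta k m (Δ.β (d₁ r s) • E'' s) =
          Δ.D (d₁ r s * (z s - ∑ q, a q * d₂ s q)) := by
        intro s
        rw [map_smul, ← hED'', Δ.D_mul h₁ h₂ (ha s)]
      simp only [e1, e2]
      rw [← map_sum, ← map_sum, ← map_add]
      have e3 : ∑ q, a q * ∑ s, d₂ s q * d₁ r s + ∑ s, d₁ r s * (z s - ∑ q, a q * d₂ s q) =
          ∑ s, z s * d₁ r s := by
        simp only [Finset.mul_sum, mul_sub, Finset.sum_sub_distrib]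
        rw [Finset.sum_comm, add_sub_left_comm]
        have : ∑ s, ∑ q, a q * (d₂ s q * d₁ r s) = ∑ s, ∑ q, d₁ r s * (a q * d₂ s q) :=
          Finset.sum_congr rfl fun s _ => Finset.sum_congr rfl fun q _ => by ring
        rw [this, sub_self, add_zero]
        exact Finset.sum_congr rfl fun s _ => mul_comm _ _
      rw [e3, hz r, map_zero]
    obtain ⟨g, hg⟩ := exists_of_theta_eq_zero h3
    refine ⟨g, ?_⟩
    have := hg 1 le_rfl (by omega)
    simpa using this
  choose g hg using hrow
  refine ⟨g, ?_⟩
  -- This removes the unknown vectors `E''` from the final sum.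
  have h01' : ∀ s, ∑ r, Δ.β (d₀ r) * Δ.β (d₁ r s) = 0 := by
    intro s
    have := Δ.β_eq_zero h₁ h₂ (h01 s)
    rw [map_sum] at this
    rw [← this]
    exact Finset.sum_congr rfl fun r _ => by rw [map_mul, mul_comm]
  calc ∑ s, Δ.β (z s) * E s 1
      = ∑ q, Δ.β (a q) * ∑ s, Δ.β (d₂ s q) * E s 1 := by
        simp only [hβa, Finset.sum_mul, Finset.mul_sum]
        rw [Finset.sum_comm]
        exact Finset.sum_congr rfl fun s _ => Finset.sum_congr rfl fun q _ => by ring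
    _ = ∑ r, Δ.β (d₀ r) * ∑ q, Δ.β (a q) * E' r q 1 := by
        simp only [hcol, Finset.mul_sum]
        rw [Finset.sum_comm]
        exact Finset.sum_congr rfl fun s _ => Finset.sum_congr rfl fun q _ => by ring
    _ = ∑ r, Δ.β (d₀ r) * (g r * MvPolynomial.X 1 ^ (m - 1) - ∑ s, Δ.β (d₁ r s) * E'' s 1) := by
        refine Finset.sum_congr rfl fun r _ => ?_
        rw [← hg r, add_sub_cancel_right]
    _ = (∑ r, g r * Δ.β (d₀ r)) * MvPolynomial.X 1 ^ (m - 1) -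
          ∑ s, (∑ r, Δ.β (d₀ r) * Δ.β (d₁ r s)) * E'' s 1 := by
        simp only [mul_sub, Finset.sum_sub_distrib, Finset.sum_mul, Finset.mul_sum]
        congr 1
        · exact Finset.sum_congr rfl fun r _ => by ring
        · rw [Finset.sum_comm]
          exact Finset.sum_congr rfl fun s _ => Finset.sum_congr rfl fun q _ => by ring
    _ = (∑ r, g r * Δ.β (d₀ r)) * MvPolynomial.X 1 ^ (m - 1) := by
        simp [h01']

end NilScrollDerivation

lemma entry_mul_sub_mem (h₁ : F.block i₁ = KWBlock.nilpotent m)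
    (h₂ : F.block i₂ = KWBlock.scroll n) {x : ℕ → MvPolynomial (Fin N) k}
    (hx : ∀ i, x i = if i = 0 then 0 else F.entry i₁ (i - 1)) {i a : ℕ} (hi : i < m) (ha : a < n) :
    F.entry i₂ a * x (i + 1) - F.entry i₂ (a + 1) * x i ∈ idealOfMinors X := by
  have l₁ : (F.block i₁).length = m := by rw [h₁]; rfl
  have l₂ : (F.block i₂).length = n := by rw [h₂]; rfl
  rw [← F.idealOfMinors_normalMatrix]
  have := minor_mem_idealOfMinors F.normalMatrix (F.column.symm ⟨i₂, ⟨a, by omega⟩⟩)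
    (F.column.symm ⟨i₁, ⟨i, by omega⟩⟩)
  obtain ⟨e1, e2⟩ := KWBlock.matrix_of_isNilpotentBlock ⟨m, h₁⟩ (F.form i₁) ⟨i, by omega⟩
  obtain ⟨e1', e2'⟩ := KWBlock.matrix_of_isScrollBlock ⟨n, h₂⟩ (F.form i₂) ⟨a, by omega⟩
  simp only [normalMatrix_column_symm] at this
  rw [e1, e2, e1', e2'] at this
  rw [hx, hx, if_neg (by omega), Nat.add_sub_cancel, mul_comm (F.entry i₂ (a + 1))]
  exact this

-- The relations between neighbouring entries of the two blocks are combined into a cycle that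
-- telescopes from `x 0 = 0` to `x m = 0`. Its pairing is a power of `t`. Divided by `t ^ (m - 1)`
-- it has degree less than `n`, whereas the cofactor in `exists_pairing_eq` lies in an ideal
-- generated by forms of degree `n`.
set_option maxHeartbeats 1000000 in
theorem length_le_of_isKoszulAlgebra (hX : ∀ i j, (X i j).IsHomogeneous 1)
    (hK : IsKoszulAlgebra (determinantalGrading X)) (h₁ : F.block i₁ = KWBlock.nilpotent m)
    (h₂ : F.block i₂ = KWBlock.scroll n) : m ≤ 2 * n := by
  by_contra! hmn
  have hn : 0 < n := by
    have := F.length_pos i₂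
    rwa [h₂] at this
  obtain ⟨Δ⟩ := F.exists_nilScrollDerivation h₁ h₂
  obtain ⟨b₁, b₂, b₃, d₀, d₁, d₂, hd₀, hd₁, hd₂, h01, h12, hex₀, hex₁, hex₂⟩ := hK.exists_lifts hX
  choose E hE hED using fun s => Δ.exists_D_eq_of_isHomogeneous h₁ h₂ (h01 s)
    (IsHomogeneous.sum _ _ _ fun r _ => (hd₁ r s).mul (hd₀ r))
  obtain ⟨x, hx⟩ : ∃ x : ℕ → MvPolynomial (Fin N) k,
    ∀ i, x i = if i = 0 then 0 else F.entry i₁ (i - 1) := ⟨_, fun _ => rfl⟩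
  have hxD : ∀ i, Δ.D (x i) = nilVector k m i := by
    intro i
    rw [hx]
    split_ifs with h
    · rw [map_zero, nilVector, if_neg (by omega)]
    · rw [Δ.D_nil, Nat.sub_add_cancel (Nat.one_le_iff_ne_zero.2 h)]
  have hxβ : ∀ i, Δ.β (x i) = 0 := by
    intro i
    rw [hx]
    split_ifs
    · exact map_zero _
    · exact Δ.β_nil _
  have hxh : ∀ i, (x i).IsHomogeneous 1 := by
    intro i
    rw [hx]
    split_ifs
    · exact isHomogeneous_zero _ _ _
    · exact F.isHomogeneous_entry _ _
  have hx0 : ∀ i, ¬ (1 ≤ i ∧ i < m) → x i = 0 := by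
    intro i hi
    rw [hx]
    split_ifs with h
    · rfl
    · rw [entry, KWBlock.extendZero_of_le]
      have : (F.block i₁).numForms = m - 1 := by rw [h₁]; rfl
      omega
  set y : ℕ → MvPolynomial (Fin N) k := F.entry i₂ with hy
  have hyh : ∀ i, (y i).IsHomogeneous 1 := F.isHomogeneous_entry i₂
  -- Where `x i` vanishes by position the coefficients are taken to be `0`, so that the boundary
  -- terms of the telescoping sum disappear.
  have hlam : ∀ i, ∃ l : Fin b₁ → k, x i = ∑ r, C (l r) * d₀ r ∧ (¬ (1 ≤ i ∧ i < m) → l = 0) := by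
    intro i
    by_cases hi : 1 ≤ i ∧ i < m
    · obtain ⟨l, hl⟩ := hex₀ (x i) (hxh i)
      exact ⟨l, hl, fun h => absurd hi h⟩
    · exact ⟨0, by rw [hx0 i hi]; simp, fun _ => rfl⟩
  choose lam hlam hlam0 using hlam
  have hw : ∀ i, i < m → ∀ a, a < n → ∃ w : Fin b₂ → k,
      ∀ r, y a * C (lam (i + 1) r) - y (a + 1) * C (lam i r) = ∑ s, C (w s) * d₁ r s := by
    intro i hi a ha
    refine hex₁ _ (fun r => ?_) ?_
    · have e1 := (hyh a).mul (isHomogeneous_C (Fin N) (lam (i + 1) r))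
      have e2 := (hyh (a + 1)).mul (isHomogeneous_C (Fin N) (lam i r))
      exact e1.sub e2
    · convert entry_mul_sub_mem h₁ h₂ hx hi ha using 1
      rw [hlam (i + 1), hlam i, Finset.mul_sum, Finset.mul_sum, ← Finset.sum_sub_distrib]
      refine Finset.sum_congr rfl fun r _ => ?_
      ring
  have hpos : ∀ i, n - 1 - i % n < n := fun i => by omega
  -- The `i`-th relation uses the scroll column `n - 1 - i % n`: the columns are traversed
  -- backwards, again and again.
  choose! w hw using fun i hi => hw i hi (n - 1 - i % n) (hpos i)
  -- These factors make consecutive terms match: `α` is constant during one traversal, and at its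
  -- end a factor `y n` is replaced by `y 0`.
  let α : ℕ → MvPolynomial (Fin N) k := fun i => y 0 ^ (i / n) * y n ^ ((m - 1) / n - i / n)
  let A : ℕ → MvPolynomial (Fin N) k := fun i => α i * y (n - i % n)
  have hA : ∀ i, i + 1 < m → α i * y (n - 1 - i % n) = A (i + 1) := by
    intro i hi
    have hmod := Nat.mod_lt i hn
    simp only [A, α]
    rcases Nat.lt_or_ge (i % n + 1) n with h | h
    · have e1 : (i + 1) % n = i % n + 1 := by
        rw [Nat.add_mod, Nat.mod_eq_of_lt (show 1 < n by omega), Nat.mod_eq_of_lt h]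
      have e2 : (i + 1) / n = i / n := by
        rw [Nat.add_div hn, Nat.mod_eq_of_lt (show 1 < n by omega), if_neg (by omega),
          Nat.div_eq_of_lt (show 1 < n by omega)]
        rfl
      rw [e1, e2, show n - (i % n + 1) = n - 1 - i % n by omega]
    · have e0 : i + 1 = n * (i / n + 1) := by
        have := Nat.div_add_mod i n
        rw [mul_add, mul_one]
        omega
      have e1 : (i + 1) % n = 0 := by rw [e0, Nat.mul_mod_right]
      have e2 : (i + 1) / n = i / n + 1 := by rw [e0, Nat.mul_div_cancel_left _ hn]
      have e3 : (i + 1) / n ≤ (m - 1) / n := Nat.div_le_div_right (by omega)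
      rw [e1, e2, Nat.sub_zero, show n - 1 - i % n = 0 by omega,
        show (m - 1) / n - i / n = (m - 1) / n - (i / n + 1) + 1 by omega, pow_succ, pow_succ]
      ring
  let z : Fin b₂ → MvPolynomial (Fin N) k := fun s => ∑ i ∈ Finset.range m, α i * C (w i s)
  have hz : ∀ r, ∑ s, z s * d₁ r s = 0 := by
    intro r
    have e1 : ∑ s, z s * d₁ r s = ∑ i ∈ Finset.range m,
        (A (i + 1) * C (lam (i + 1) r) - A i * C (lam i r)) := by
      simp only [z, Finset.sum_mul]
      rw [Finset.sum_comm]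
      refine Finset.sum_congr rfl fun i hi => ?_
      have him := Finset.mem_range.1 hi
      have e2 : ∑ s, α i * C (w i s) * d₁ r s = α i * ∑ s, C (w i s) * d₁ r s := by
        rw [Finset.mul_sum]
        exact Finset.sum_congr rfl fun s _ => mul_assoc _ _ _
      have hmod := Nat.mod_lt i hn
      rw [e2, ← hw i him, show n - 1 - i % n + 1 = n - i % n by omega, mul_sub, ← mul_assoc,
        ← mul_assoc]
      congr 1
      by_cases h : i + 1 < m
      · rw [hA i h]
      · rw [hlam0 (i + 1) (by omega)]
        simp
    rw [e1, Finset.sum_range_sub (fun i => A i * C (lam i r)), hlam0 m (by omega),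
      hlam0 0 (by omega)]
    simp
  obtain ⟨a, ha⟩ := hex₂ z fun r => by rw [hz r]; exact zero_mem _
  obtain ⟨g, hg⟩ := Δ.exists_pairing_eq h₁ h₂ hn hmn hd₀ hd₁ hd₂ h01 h12 hE hED hz ha
  -- `D` maps the `i`-th relation to `theta` of a monomial `p` times the basis vector of index `i +
  -- 1`, and in degree `n - 1` the coordinates `1, …, m` are determined by the image under `theta`.
  -- Only `i = 0` contributes to coordinate `1`.
  have hpair : ∀ i, i < m → ∑ s, C (w i s) * E s 1 =
      MvPolynomial.X 0 ^ (n - 1 - (n - 1 - i % n)) * MvPolynomial.X 1 ^ (n - 1 - i % n) *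
        (Pi.single (i + 1) 1 : ℕ → MvPolynomial (Fin 2) k) 1 := by
    intro i hi
    set c := n - 1 - i % n with hc
    have hcn : c < n := hpos i
    set p : MvPolynomial (Fin 2) k := MvPolynomial.X 0 ^ (n - 1 - c) * MvPolynomial.X 1 ^ c with hp
    have h3 : theta k m (∑ s, (C (w i s) : MvPolynomial (Fin 2) k) • E s -
        p • Pi.single (i + 1) 1) = 0 := by
      rw [map_sub, map_sum, sub_eq_zero, map_smul, theta_single]
      have e1 : ∀ s, theta k m ((C (w i s) : MvPolynomial (Fin 2) k) • E s) =
          Δ.D (C (w i s) * ∑ r, d₁ r s * d₀ r) := by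
        intro s
        rw [map_smul, ← hED, Δ.D_C_mul]
      simp only [e1]
      rw [← map_sum]
      have e2 : ∑ s, C (w i s) * ∑ r, d₁ r s * d₀ r = y c * x (i + 1) - y (c + 1) * x i := by
        rw [hlam (i + 1), hlam i, Finset.mul_sum, Finset.mul_sum, ← Finset.sum_sub_distrib]
        simp only [Finset.mul_sum]
        rw [Finset.sum_comm]
        refine Finset.sum_congr rfl fun r _ => ?_
        have := congrArg (fun f => f * d₀ r) (hw i hi r)
        simp only [Finset.sum_mul, sub_mul] at this
        simp only [mul_assoc] at this ⊢
        exact this.symm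
      rw [e2, map_sub, Δ.leibniz, Δ.leibniz, hxβ, hxβ, hxD, hxD, zero_smul, zero_smul, add_zero,
        add_zero, hy, Δ.β_scroll _ hcn.le, Δ.β_scroll _ hcn, smul_sub, smul_smul, smul_smul, hp,
        show n - c = n - 1 - c + 1 by omega, show n - (c + 1) = n - 1 - c by omega]
      congr 2
      · ring
      · rw [pow_succ]
        ring
    have h4 := eq_zero_of_theta_eq_zero h3 (d := n - 1) (fun j => ?_) (by omega) le_rfl
      (by omega : 1 ≤ m)
    · simpa [sub_eq_zero] using h4
    · simp only [Pi.sub_apply, Finset.sum_apply, Pi.smul_apply, smul_eq_mul]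
      refine (IsHomogeneous.sum _ _ _ fun s _ => (hE s j).C_mul _).sub ?_
      have hph : p.IsHomogeneous (n - 1) := by
        have : n - 1 = n - 1 - c + c := by omega
        conv => arg 2; rw [this]
        exact (isHomogeneous_X_pow _ _).mul (isHomogeneous_X_pow _ _)
      rw [Pi.single_apply]
      split_ifs
      · rw [mul_one]
        exact hph
      · rw [mul_zero]
        exact isHomogeneous_zero _ _ _
  have hlhs : ∑ s, Δ.β (z s) * E s 1 = MvPolynomial.X 1 ^ (n * ((m - 1) / n) + (n - 1)) := by
    have e1 : ∑ s, Δ.β (z s) * E s 1 =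
        ∑ i ∈ Finset.range m, Δ.β (α i) * ∑ s, C (w i s) * E s 1 := by
      simp only [z, map_sum, Finset.sum_mul, Finset.mul_sum]
      rw [Finset.sum_comm]
      refine Finset.sum_congr rfl fun i _ => Finset.sum_congr rfl fun s _ => ?_
      rw [map_mul, ← algebraMap_eq, AlgHom.commutes, algebraMap_eq]
      ring
    rw [e1, Finset.sum_eq_single 0]
    · rw [hpair 0 (by omega)]
      simp only [α, Nat.zero_div, pow_zero, one_mul, Nat.sub_zero, Nat.zero_mod, zero_add,
        Pi.single_eq_same, mul_one, Nat.sub_self]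
      rw [map_pow, hy, Δ.β_scroll n le_rfl, Nat.sub_self, pow_zero, one_mul, ← pow_mul, ← pow_add]
    · intro i hi hi0
      rw [hpair i (Finset.mem_range.1 hi), Pi.single_eq_of_ne (by omega), mul_zero, mul_zero]
    · intro h
      exact absurd (Finset.mem_range.2 (by omega)) h
  rw [hlhs] at hg
  have hdm := Nat.div_add_mod (m - 1) n
  have hmod := Nat.mod_lt (m - 1) hn
  -- Here `c = n - 1 - (m - 1) % n`, hence `c < n`.
  obtain ⟨c, hc⟩ : ∃ c, n * ((m - 1) / n) + (n - 1) = c + (m - 1) :=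
    ⟨n * ((m - 1) / n) + (n - 1) - (m - 1), by omega⟩
  rw [hc, pow_add] at hg
  have hg' := mul_right_cancel₀ (pow_ne_zero _ (X_ne_zero _)) hg
  have h5 : homogeneousComponent c ((MvPolynomial.X 1 : MvPolynomial (Fin 2) k) ^ c) = 0 := by
    rw [hg', map_sum]
    refine Finset.sum_eq_zero fun r _ => ?_
    exact homogeneousComponent_mul_of_isHomogeneous_of_lt _ (Δ.isHomogeneous_β _ (hd₀ r)) (by omega)
  rw [homogeneousComponent_eq_self (isHomogeneous_X_pow _ _)] at h5
  exact pow_ne_zero _ (X_ne_zero _) h5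

theorem isKoszulAlgebra_iff_lengthCondition (F : KWNormalForm X)
    (hX : ∀ i j, (X i j).IsHomogeneous 1) :
    IsKoszulAlgebra (determinantalGrading X) ↔ F.LengthCondition := by
  constructor
  · rintro hK m n ⟨⟨i₁, h₁⟩, -⟩ ⟨⟨i₂, h₂⟩, -⟩
    exact length_le_of_isKoszulAlgebra hX hK h₁ h₂
  · exact fun h => h.isKoszulAlgebra hX

end KWNormalForm

/-! ### Jordan bases -/

/-- Over an algebraically closed field every endomorphism has a basis of Jordan chains. -/
theorem exists_jordan_chains {k V : Type v} [Field k] [IsAlgClosed k] [AddCommGroup V] [Module k V]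
    [FiniteDimensional k V] (c : V →ₗ[k] V) :
    ∃ (ι : Type v) (_ : Fintype ι) (p : ι → ℕ) (lam : ι → k) (v : ι → ℕ → V),
      (∀ i, 0 < p i) ∧ (∀ i j, c (v i j) = v i (j + 1) + lam i • v i j) ∧
      (∀ i j, p i ≤ j → v i j = 0) ∧
      ⊤ ≤ Submodule.span k {x | ∃ i j, j < p i ∧ v i j = x} ∧
      ∑ i, p i = Module.finrank k V := by
  classical
  -- As a torsion `k[X]`-module the space is a sum of cyclic modules `k[X] / q i ^ p i`, and each
  -- irreducible `q i` is associated to some `X - lam i`.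
  obtain ⟨ι, _, q, hq, p, ⟨l⟩⟩ := Module.equiv_directSum_of_isTorsion
    (Module.AEval.isTorsion_of_finiteDimensional k V (a := c))
  have hroot : ∀ i, ∃ x, Associated (Polynomial.X - Polynomial.C x) (q i) := by
    intro i
    obtain ⟨x, hx⟩ := IsAlgClosed.exists_root (q i)
      (by rw [IsAlgClosed.degree_eq_one_of_irreducible k (hq i)]; exact one_ne_zero)
    exact ⟨x, (Polynomial.irreducible_X_sub_C x).associated_of_dvd (hq i)
      (Polynomial.dvd_iff_isRoot.2 hx)⟩
  choose lam hlam using hroot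
  let g : ∀ i, Module.AEval' c := fun i => l.symm (DirectSum.lof (Polynomial k) ι _ i
    (Ideal.Quotient.mk _ (1 : Polynomial k)))
  have hg : ∀ i (f : Polynomial k), f • g i = l.symm (DirectSum.lof (Polynomial k) ι
      (fun i => Polynomial k ⧸ Submodule.span (Polynomial k) {q i ^ p i}) i
        (Ideal.Quotient.mk _ f)) := by
    intro i f
    rw [← map_smul, ← map_smul]
    congr 2
    change Ideal.Quotient.mk _ (f * 1) = _
    rw [mul_one]
  let v : ι → ℕ → V := fun i j => (Module.AEval'.of c).symm
    ((Polynomial.X - Polynomial.C (lam i)) ^ j • g i)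
  have hv0 : ∀ i j, p i ≤ j → v i j = 0 := by
    intro i j hj
    have : Ideal.Quotient.mk (Submodule.span (Polynomial k) {q i ^ p i})
        ((Polynomial.X - Polynomial.C (lam i)) ^ j) = 0 := by
      rw [Ideal.Quotient.eq_zero_iff_mem]
      exact Ideal.mem_span_singleton.2
        ((((hlam i).pow_pow (n := p i)).symm.dvd).trans (pow_dvd_pow _ hj))
    simp only [v]
    rw [hg, this, map_zero, map_zero, map_zero]
  have hspan : ⊤ ≤ Submodule.span k {x | ∃ i j, j < p i ∧ v i j = x} := by
    have key : ∀ x : Module.AEval' c,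
        (Module.AEval'.of c).symm x ∈ Submodule.span k {x | ∃ i j, j < p i ∧ v i j = x} := by
      intro x
      obtain ⟨y, rfl⟩ := l.symm.surjective x
      induction y using DirectSum.induction_on with
      | zero => simp
      | add a b ha hb => rw [map_add, map_add]; exact add_mem ha hb
      | of i a =>
        obtain ⟨f, rfl⟩ := Ideal.Quotient.mk_surjective a
        have h1 := hg i f
        rw [DirectSum.lof_eq_of] at h1
        -- Taylor expansion at the eigenvalue writes `f • g i` in terms of the chain.
        rw [← h1, ← Polynomial.sum_taylor_eq f (lam i), Polynomial.sum, Finset.sum_smul, map_sum]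
        refine sum_mem fun n _ => ?_
        rw [mul_smul, Module.AEval.C_smul, map_smul]
        refine Submodule.smul_mem _ _ ?_
        by_cases hn : n < p i
        · exact Submodule.subset_span ⟨i, n, hn, rfl⟩
        · have := hv0 i n (by omega)
          simp only [v] at this
          rw [this]
          exact zero_mem _
    intro x _
    simpa using key (Module.AEval'.of c x)
  have hsum : ∑ i, p i = Module.finrank k V := by
    have hfin : ∀ i, Module.Finite k (Polynomial k ⧸ Submodule.span (Polynomial k) {q i ^ p i}) :=
      fun i => (AdjoinRoot.powerBasis (pow_ne_zero (p i) (hq i).ne_zero)).finite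
    rw [((Module.AEval'.of c).trans (l.restrictScalars k)).finrank_eq, Module.finrank_directSum]
    refine Finset.sum_congr rfl fun i _ => ?_
    have := finrank_quotient_span_eq_natDegree (f := q i ^ p i)
    have hdeg : (q i).natDegree = 1 := Polynomial.natDegree_eq_of_degree_eq_some
      (IsAlgClosed.degree_eq_one_of_irreducible k (hq i))
    rw [Polynomial.natDegree_pow, hdeg, mul_one] at this
    exact this.symm
  -- Summands with exponent `0` are trivial and are dropped.
  refine ⟨{i // 0 < p i}, inferInstance, fun i => p i, fun i => lam i, fun i => v i, fun i => i.2,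
    ?_, fun i => hv0 i, ?_, ?_⟩
  · intro i j
    apply (Module.AEval'.of c).injective
    rw [← Module.AEval'.X_smul_of, map_add, map_smul]
    simp only [v, LinearEquiv.apply_symm_apply]
    rw [pow_succ', ← Module.AEval.C_smul, ← mul_smul, ← mul_smul, ← add_smul]
    congr 1
    ring
  · refine hspan.trans (Submodule.span_mono ?_)
    rintro _ ⟨i, j, hj, rfl⟩
    exact ⟨⟨i, by omega⟩, j, hj, rfl⟩
  · rw [← hsum]
    rw [← Finset.sum_subtype (Finset.univ.filter fun i => 0 < p i) (by simp) p, Finset.sum_filter]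
    refine Finset.sum_congr rfl fun i _ => ?_
    split_ifs <;> omega

/-! ### Chain decompositions of pencils -/

lemma Submodule.finrank_map_add_finrank_inf_ker {k V W : Type*} [Field k] [AddCommGroup V]
    [Module k V] [AddCommGroup W] [Module k W] (f : V →ₗ[k] W) (P : Submodule k V)
    [FiniteDimensional k P] :
    Module.finrank k (P.map f) + Module.finrank k (P ⊓ LinearMap.ker f : Submodule k V) =
      Module.finrank k P := by
  have h := LinearMap.finrank_range_add_finrank_ker (f.domRestrict P)
  rw [LinearMap.range_domRestrict, LinearMap.ker_domRestrict] at h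
  rw [← h]
  congr 1
  rw [← Submodule.finrank_map_subtype_eq, Submodule.map_comap_subtype]

/-- The number of nilpotent blocks in a single block. -/
def KWBlock.nilCount {k : Type*} : KWBlock k → ℕ
  | nilpotent _ => 1
  | scroll _ => 0
  | jordan _ _ => 0

section

variable {k V W : Type v} [Field k] [AddCommGroup V] [Module k V] [AddCommGroup W] [Module k W]

/-- A sequence of vectors on which the pencil `a, b` acts as on the columns of a block. -/
def IsPencilChain (a b : V →ₗ[k] W) : KWBlock k → (ℕ → V) → Prop
  | .nilpotent m, v => a (v 0) = 0 ∧ (∀ j, a (v (j + 1)) = b (v j)) ∧ ∀ j, m ≤ j → v j = 0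
  | .scroll n, v => ∀ j, j + 1 < n → a (v (j + 1)) = b (v j)
  | .jordan p l, v => (∀ j, b (v j) = a (v (j + 1)) + l • a (v j)) ∧ ∀ j, p ≤ j → v j = 0

/-- A decomposition of a pencil of linear maps into chains, with the counts that make the vectors
of the chains, those of the kernel, and their images bases. -/
structure PencilDecomposition (a b : V →ₗ[k] W) where
  /-- The set of chains. -/
  ι : Type v
  [fintype : Fintype ι]
  /-- The types of the chains. -/
  block : ι → KWBlock k
  /-- The vectors of the chains. -/
  vec : ι → ℕ → V
  length_pos : ∀ i, 0 < (block i).length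
  isChain : ∀ i, IsPencilChain a b (block i) (vec i)
  top_le_span : ⊤ ≤ Submodule.span k {x | ∃ i j, j < (block i).length ∧ vec i j = x}
  sum_length : ∑ i, (block i).length = Module.finrank k V
  ker_le_span : LinearMap.ker a ≤
    Submodule.span k {x | ∃ i m, block i = .nilpotent m ∧ vec i 0 = x}
  sum_nilCount : ∑ i, (block i).nilCount = Module.finrank k (LinearMap.ker a)
  sum_numForms : ∑ i, (block i).numForms =
    Module.finrank k (LinearMap.range a ⊔ LinearMap.range b : Submodule k W)

attribute [instance] PencilDecomposition.fintype

/-- The map `a` has the maximal rank among the maps `a + t b`. -/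
def HasMaximalRank (a b : V →ₗ[k] W) : Prop :=
  ∀ t : k, Module.finrank k (LinearMap.range (a + t • b)) ≤ Module.finrank k (LinearMap.range a)

variable [FiniteDimensional k V]

lemma hasMaximalRank_of_injective {a : V →ₗ[k] W} (ha : Function.Injective a) (b : V →ₗ[k] W) :
    HasMaximalRank a b := fun t => by
  rw [LinearMap.finrank_range_of_inj ha]
  exact LinearMap.finrank_range_le _

/-- For `t ≠ 0` a nonzero kernel vector is an eigenvector of `N` for `-t⁻¹`, and there are only
finitely many eigenvalues. -/
lemma exists_ne_zero_injective_one_add_smul [Infinite k] (N : V →ₗ[k] V) :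
    ∃ t : k, t ≠ 0 ∧ Function.Injective (LinearMap.id + t • N : V →ₗ[k] V) := by
  obtain ⟨μ, hμ⟩ := ((Module.End.finite_hasEigenvalue N).union
    (Set.finite_singleton (0 : k))).exists_notMem
  simp only [Set.mem_union, Set.mem_singleton_iff, not_or] at hμ
  refine ⟨-μ⁻¹, neg_ne_zero.2 (inv_ne_zero hμ.2), ?_⟩
  rw [← LinearMap.ker_eq_bot, LinearMap.ker_eq_bot']
  intro x hx
  by_contra hx0
  refine hμ.1 (Module.End.hasEigenvalue_of_hasEigenvector ⟨Module.End.mem_eigenspace_iff.2 ?_, hx0⟩)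
  simp only [LinearMap.add_apply, LinearMap.id_apply, neg_smul] at hx
  rw [eq_comm, ← sub_eq_zero, ← smul_right_injective V (inv_ne_zero hμ.2) |>.eq_iff]
  simp only [smul_sub, smul_zero, inv_smul_smul₀ hμ.2]
  rw [sub_eq_add_neg]
  exact hx

/-- If `b x` with `a x = 0` were outside the range of `a`, then `a` on a complement of its kernel,
together with `b x`, would be injective. This persists for `a + t • b` with some `t ≠ 0`, whose
range contains `b x`; so its rank would exceed that of `a`. -/
lemma HasMaximalRank.map_ker_le_range [Infinite k] {a b : V →ₗ[k] W} (h : HasMaximalRank a b) :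
    (LinearMap.ker a).map b ≤ LinearMap.range a := by
  rintro _ ⟨x, hx, rfl⟩
  by_contra hbx
  obtain ⟨D, hD⟩ := Submodule.exists_isCompl (LinearMap.ker a)
  let f : k → (D × k →ₗ[k] W) := fun t =>
    ((a + t • b).comp D.subtype).coprod (LinearMap.toSpanSingleton k W (b x))
  have hf0 : LinearMap.ker (f 0) = ⊥ := by
    rw [LinearMap.ker_eq_bot']
    rintro ⟨y, s⟩ hy
    simp only [f, LinearMap.coprod_apply, LinearMap.comp_apply, zero_smul, add_zero,
      LinearMap.toSpanSingleton_apply, Submodule.subtype_apply] at hy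
    have hs : s = 0 := by
      by_contra hs
      refine hbx ⟨-s⁻¹ • (y : V), ?_⟩
      rw [map_smul, eq_neg_of_add_eq_zero_left hy, smul_neg, neg_smul, neg_neg,
        inv_smul_smul₀ hs]
    subst hs
    rw [zero_smul, add_zero] at hy
    have : (y : V) = 0 := Submodule.disjoint_def.1 hD.disjoint _ hy y.2
    ext <;> simp [this]
  -- A left inverse of `f 0` turns `f t` into a perturbation of the identity.
  obtain ⟨g, hg⟩ := LinearMap.exists_leftInverse_of_injective _ hf0
  let h' : D × k →ₗ[k] W := (b.comp D.subtype).comp (LinearMap.fst k D k)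
  have hft : ∀ t, f t = f 0 + t • h' := by
    intro t
    ext <;> simp [f, h']
  obtain ⟨t, ht, hinj⟩ := exists_ne_zero_injective_one_add_smul (g.comp h')
  have hgf : g.comp (f t) = LinearMap.id + t • g.comp h' := by
    rw [hft, LinearMap.comp_add, hg, LinearMap.comp_smul]
  have hfinj : Function.Injective (f t) := by
    rw [← hgf] at hinj
    exact Function.Injective.of_comp hinj
  have h1 := LinearMap.finrank_range_of_inj hfinj
  have h2 : LinearMap.range (f t) ≤ LinearMap.range (a + t • b) := by
    rintro _ ⟨⟨y, s⟩, rfl⟩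
    refine ⟨y + (s * t⁻¹) • x, ?_⟩
    have hx' : a x = 0 := hx
    simp only [f, LinearMap.coprod_apply, LinearMap.comp_apply, Submodule.subtype_apply,
      LinearMap.toSpanSingleton_apply, map_add, map_smul, LinearMap.add_apply,
      LinearMap.smul_apply, hx', zero_add, smul_smul]
    rw [mul_assoc, inv_mul_cancel₀ ht, mul_one]
  have h3 := Submodule.finrank_mono h2
  have h4 := h t
  have h5 := LinearMap.finrank_range_add_finrank_ker a
  have h6 := Submodule.finrank_add_eq_of_isCompl hD
  rw [Module.finrank_prod, Module.finrank_self] at h1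
  omega

/-- Since `b` is `a` composed with `c`, the Jordan chains of `c` are chains of the pencil. -/
theorem nonempty_pencilDecomposition_of_comp [IsAlgClosed k] {a b : V →ₗ[k] W}
    (ha : Function.Injective a) {c : V →ₗ[k] V} (hc : ∀ x, a (c x) = b x) :
    Nonempty (PencilDecomposition a b) := by
  obtain ⟨ι, _, p, lam, v, hp, hv, hv0, hspan, hsum⟩ := exists_jordan_chains c
  have hker := LinearMap.ker_eq_bot.2 ha
  refine ⟨{ ι := ι, block := fun i => .jordan (p i) (lam i), vec := v, length_pos := hp,
            isChain := fun i => ⟨fun j => ?_, hv0 i⟩, top_le_span := hspan, sum_length := hsum,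
            ker_le_span := by rw [hker]; exact bot_le,
            sum_nilCount := by rw [hker]; simp [KWBlock.nilCount],
            sum_numForms := ?_ }⟩
  · rw [← hc, hv, map_add, map_smul]
  · have : LinearMap.range b ≤ LinearMap.range a := by
      rintro _ ⟨x, rfl⟩
      exact ⟨c x, hc x⟩
    rw [sup_eq_left.2 this, LinearMap.finrank_range_of_inj ha]
    exact hsum

end

/-! ### Passing to the quotient by the kernel -/

/-- The block obtained from a block by lengthening it if it is nilpotent. -/
def KWBlock.extendNilpotent {k : Type*} : KWBlock k → KWBlock k
  | nilpotent m => nilpotent (m + 1)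
  | scroll n => scroll n
  | jordan p l => jordan p l

namespace KWBlock

variable {k : Type*} (B : KWBlock k)

lemma length_extendNilpotent : B.extendNilpotent.length = B.length + B.nilCount := by
  cases B <;> rfl

lemma nilCount_extendNilpotent : B.extendNilpotent.nilCount = B.nilCount := by
  cases B <;> rfl

lemma numForms_extendNilpotent (h : 0 < B.length) :
    B.extendNilpotent.numForms = B.numForms + B.nilCount := by
  cases B with
  | nilpotent m => simp only [length] at h; simp only [extendNilpotent, numForms, nilCount]; omega
  | scroll n => rfl
  | jordan p l => rfl

end KWBlock

section

variable {k V W : Type v} [Field k] [AddCommGroup V] [Module k V] [AddCommGroup W] [Module k W]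
  (a b : V →ₗ[k] W)

/-- The image of the kernel of `a` under `b`. -/
abbrev kerImage : Submodule k W := (LinearMap.ker a).map b

lemma ker_le_comap_kerImage : LinearMap.ker a ≤ (kerImage a b).comap a := fun x hx => by
  rw [Submodule.mem_comap, LinearMap.mem_ker.1 hx]
  exact zero_mem _

/-- The map induced by `a` modulo its kernel. -/
abbrev quotKerFst : (V ⧸ LinearMap.ker a) →ₗ[k] (W ⧸ kerImage a b) :=
  Submodule.mapQ _ _ a (ker_le_comap_kerImage a b)

/-- The map induced by `b` modulo the kernel of `a`. -/
abbrev quotKerSnd : (V ⧸ LinearMap.ker a) →ₗ[k] (W ⧸ kerImage a b) :=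
  Submodule.mapQ _ _ b (Submodule.le_comap_map _ _)

/-- The injective map to `W` induced by `a`. -/
abbrev quotKerLift : (V ⧸ LinearMap.ker a) →ₗ[k] W :=
  (LinearMap.ker a).liftQ a le_rfl

lemma quotKerFst_eq_mk (x : V ⧸ LinearMap.ker a) :
    quotKerFst a b x = (kerImage a b).mkQ (quotKerLift a x) := by
  obtain ⟨y, rfl⟩ := Submodule.mkQ_surjective _ x
  rfl

/-- Adding elements of `ker a` corrects a lift without changing its class. The last clause keeps the
zeros at the end of a chain equal to zero. -/
lemma exists_lift_quotKerSnd (x : V ⧸ LinearMap.ker a) (y : W)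
    (h : (kerImage a b).mkQ y = quotKerSnd a b x) :
    ∃ z, (LinearMap.ker a).mkQ z = x ∧ b z = y ∧ (x = 0 → y = 0 → z = 0) := by
  by_cases h0 : x = 0 ∧ y = 0
  · exact ⟨0, by simp [h0.1], by simp [h0.2], fun _ _ => rfl⟩
  obtain ⟨z, rfl⟩ := Submodule.mkQ_surjective _ x
  have h1 : (kerImage a b).mkQ y = (kerImage a b).mkQ (b z) := h
  rw [← sub_eq_zero, ← map_sub, Submodule.mkQ_apply, Submodule.Quotient.mk_eq_zero] at h1
  obtain ⟨u, hu, huy⟩ := h1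
  refine ⟨z + u, ?_, ?_, fun h2 h3 => absurd ⟨h2, h3⟩ h0⟩
  · have h2 : (LinearMap.ker a).mkQ u = 0 := (Submodule.Quotient.mk_eq_zero _).2 hu
    rw [map_add, h2, add_zero]
  · rw [map_add, huy, add_sub_cancel]

variable {a b}

/-- The value of `a` on a lift depends only on the class, so the lifts can be chosen with the
required values under `b`. A nilpotent chain gains a vector in front: `a (x 0)` is zero in the
quotient, so its representative in `W` is `b u` with `u ∈ ker a`. -/
lemma IsPencilChain.exists_lift {B : KWBlock k} {x : ℕ → V ⧸ LinearMap.ker a}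
    (h : IsPencilChain (quotKerFst a b) (quotKerSnd a b) B x) :
    ∃ y : ℕ → V, IsPencilChain a b B.extendNilpotent y ∧
      (∀ m, B = .nilpotent m → y 0 ∈ LinearMap.ker a ∧ b (y 0) = quotKerLift a (x 0)) ∧
      ∀ j < B.length, ∃ j' < B.extendNilpotent.length, (LinearMap.ker a).mkQ (y j') = x j := by
  have ha : ∀ z w, (LinearMap.ker a).mkQ z = w → a z = quotKerLift a w := by
    rintro z _ rfl
    rfl
  cases B with
  | nilpotent m =>
    obtain ⟨h0, h1, h2⟩ := h
    rw [quotKerFst_eq_mk, Submodule.mkQ_apply, Submodule.Quotient.mk_eq_zero] at h0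
    obtain ⟨u, hu, hux⟩ := h0
    have hl := fun j => exists_lift_quotKerSnd a b (x j) (quotKerLift a (x (j + 1)))
      (by rw [← h1, quotKerFst_eq_mk])
    choose z hz hbz hz0 using hl
    let y : ℕ → V := fun j => Nat.casesOn j u z
    refine ⟨y, ⟨LinearMap.mem_ker.1 hu, ?_, ?_⟩, fun _ _ => ⟨hu, hux⟩, ?_⟩
    · rintro (_ | j)
      · exact (ha _ _ (hz 0)).trans hux.symm
      · exact (ha _ _ (hz (j + 1))).trans (hbz j).symm
    · rintro (_ | j) hj
      · omega
      · exact hz0 j (h2 j (by omega)) (by rw [h2 _ (by omega), map_zero])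
    · intro j hj
      simp only [KWBlock.length] at hj
      exact ⟨j + 1, by simp only [KWBlock.extendNilpotent, KWBlock.length]; omega, hz j⟩
  | scroll n =>
    have hl : ∀ j, ∃ z, (LinearMap.ker a).mkQ z = x j ∧
        (j + 1 < n → b z = quotKerLift a (x (j + 1))) := by
      intro j
      by_cases hj : j + 1 < n
      · obtain ⟨z, h1, h2, -⟩ := exists_lift_quotKerSnd a b (x j) (quotKerLift a (x (j + 1)))
          (by rw [← h j hj, quotKerFst_eq_mk])
        exact ⟨z, h1, fun _ => h2⟩
      · obtain ⟨z, hz⟩ := Submodule.mkQ_surjective _ (x j)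
        exact ⟨z, hz, fun h => absurd h hj⟩
    choose z hz hbz using hl
    exact ⟨z, fun j hj => (ha _ _ (hz (j + 1))).trans (hbz j hj).symm, fun m hm => (by cases hm),
      fun j hj => ⟨j, hj, hz j⟩⟩
  | jordan p l =>
    obtain ⟨h1, h2⟩ := h
    have hl := fun j => exists_lift_quotKerSnd a b (x j)
      (quotKerLift a (x (j + 1)) + l • quotKerLift a (x j))
      (by rw [h1, map_add, map_smul, quotKerFst_eq_mk, quotKerFst_eq_mk])
    choose z hz hbz hz0 using hl
    refine ⟨z, ⟨fun j => ?_, fun j hj => ?_⟩, fun m hm => (by cases hm), fun j hj => ⟨j, hj, hz j⟩⟩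
    · rw [hbz, ha _ _ (hz j), ha _ _ (hz (j + 1))]
    · exact hz0 j (h2 j hj) (by rw [h2 j hj, h2 _ (by omega), map_zero, smul_zero, add_zero])

/-- The injective map `quotKerLift a` carries this kernel onto `kerImage a b`. -/
lemma finrank_ker_quotKerFst (h : kerImage a b ≤ LinearMap.range a) :
    Module.finrank k (LinearMap.ker (quotKerFst a b)) = Module.finrank k (kerImage a b) := by
  have hinj : Function.Injective (quotKerLift a) :=
    LinearMap.ker_eq_bot.1 (Submodule.ker_liftQ_eq_bot _ _ _ le_rfl)
  have : (LinearMap.ker (quotKerFst a b)).map (quotKerLift a) = kerImage a b := by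
    apply le_antisymm
    · rintro _ ⟨x, hx, rfl⟩
      have hx' : quotKerFst a b x = 0 := hx
      rwa [quotKerFst_eq_mk, Submodule.mkQ_apply, Submodule.Quotient.mk_eq_zero] at hx'
    · intro y hy
      obtain ⟨x, rfl⟩ := h hy
      refine ⟨(LinearMap.ker a).mkQ x, ?_, rfl⟩
      rw [SetLike.mem_coe, LinearMap.mem_ker, quotKerFst_eq_mk, Submodule.mkQ_apply,
        Submodule.Quotient.mk_eq_zero]
      exact hy
  exact (LinearEquiv.finrank_eq (Submodule.equivMapOfInjective _ hinj _)).trans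
    (congrArg (fun P : Submodule k W => Module.finrank k P) this)

variable [FiniteDimensional k V]

/-- For `t ≠ 0` the range of `a + t • b` contains `kerImage a b`, as does the range of `a`; both
ranks drop by its dimension. -/
lemma HasMaximalRank.quotKer (h : HasMaximalRank a b)
    (hba : kerImage a b ≤ LinearMap.range a) :
    HasMaximalRank (quotKerFst a b) (quotKerSnd a b) := by
  intro t
  by_cases ht : t = 0
  · rw [ht, zero_smul, add_zero]
  have hle : kerImage a b ≤ LinearMap.range (a + t • b) := by
    rintro _ ⟨x, hx, rfl⟩
    refine ⟨t⁻¹ • x, ?_⟩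
    have hx' : a x = 0 := hx
    rw [LinearMap.add_apply, LinearMap.smul_apply, map_smul, map_smul, hx', smul_zero, zero_add,
      smul_inv_smul₀ ht]
  have hcomap : LinearMap.ker a ≤ (kerImage a b).comap (a + t • b) := by
    intro x hx
    rw [Submodule.mem_comap, LinearMap.add_apply, LinearMap.smul_apply, LinearMap.mem_ker.1 hx,
      zero_add]
    exact Submodule.smul_mem _ _ ⟨x, hx, rfl⟩
  have heq : quotKerFst a b + t • quotKerSnd a b = Submodule.mapQ _ _ (a + t • b) hcomap := by
    ext x
    rfl
  rw [heq, Submodule.range_mapQ, Submodule.range_mapQ]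
  have h1 := Submodule.finrank_map_add_finrank_inf_ker (kerImage a b).mkQ
    (LinearMap.range (a + t • b))
  have h2 := Submodule.finrank_map_add_finrank_inf_ker (kerImage a b).mkQ (LinearMap.range a)
  rw [Submodule.ker_mkQ, inf_eq_right.2 hle] at h1
  rw [Submodule.ker_mkQ, inf_eq_right.2 hba] at h2
  have := h t
  omega

/-- The lifted chains account for `ker a` up to `ker a ⊓ ker b`, a basis of which is added as
nilpotent chains of length `1`, that is, zero columns. Dimension counts replace a proof of
independence. -/
theorem PencilDecomposition.nonempty_of_quotKer (hba : kerImage a b ≤ LinearMap.range a)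
    (Q : PencilDecomposition (quotKerFst a b) (quotKerSnd a b)) :
    Nonempty (PencilDecomposition a b) := by
  classical
  choose y hy hy0 hyx using fun i => (Q.isChain i).exists_lift
  let E : Submodule k V := LinearMap.ker a ⊓ LinearMap.ker b
  let e := Module.finBasis k E
  have hkerle : LinearMap.ker a ≤
      Submodule.span k ({x | ∃ i m, Q.block i = .nilpotent m ∧ y i 0 = x}) ⊔ E := by
    intro u hu
    obtain ⟨x, hx⟩ := hba ⟨u, hu, rfl⟩
    have hxker : (LinearMap.ker a).mkQ x ∈ LinearMap.ker (quotKerFst a b) := by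
      rw [LinearMap.mem_ker, quotKerFst_eq_mk, Submodule.mkQ_apply, Submodule.Quotient.mk_eq_zero]
      exact ⟨u, hu, hx.symm⟩
    have h1 : b u ∈ (Submodule.span k {x | ∃ i m, Q.block i = .nilpotent m ∧ y i 0 = x}).map b := by
      have h2 : quotKerLift a ((LinearMap.ker a).mkQ x) ∈ (Submodule.span k
          {x | ∃ i m, Q.block i = .nilpotent m ∧ Q.vec i 0 = x}).map (quotKerLift a) :=
        ⟨_, Q.ker_le_span hxker, rfl⟩
      rw [Submodule.map_span] at h2
      change a x ∈ _ at h2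
      rw [← hx]
      refine Submodule.span_le.2 ?_ h2
      rintro _ ⟨_, ⟨i, m, hi, rfl⟩, rfl⟩
      exact ⟨y i 0, Submodule.subset_span ⟨i, m, hi, rfl⟩, (hy0 i m hi).2⟩
    obtain ⟨s, hs, hsu⟩ := h1
    have hs' : s ∈ LinearMap.ker a := by
      refine Submodule.span_le.2 ?_ hs
      rintro _ ⟨i, m, hi, rfl⟩
      exact (hy0 i m hi).1
    have : u = s + (u - s) := by abel
    rw [this]
    refine Submodule.add_mem_sup hs ⟨sub_mem hu hs', ?_⟩
    rw [SetLike.mem_coe, LinearMap.mem_ker, map_sub, hsu, sub_self]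
  let block : Q.ι ⊕ ULift.{v} (Fin (Module.finrank k E)) → KWBlock k :=
    Sum.elim (fun i => (Q.block i).extendNilpotent) (fun _ => .nilpotent 1)
  let vec : Q.ι ⊕ ULift.{v} (Fin (Module.finrank k E)) → ℕ → V :=
    Sum.elim y (fun i j => if j = 0 then (e i.down : V) else 0)
  have hlen : ∀ i, 0 < (block i).length := by
    rintro (i | i)
    · have := Q.length_pos i
      simp only [block, Sum.elim_inl, KWBlock.length_extendNilpotent]
      omega
    · exact Nat.one_pos
  have hker : LinearMap.ker a ≤
      Submodule.span k {x | ∃ i m, block i = .nilpotent m ∧ vec i 0 = x} := by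
    refine hkerle.trans (sup_le (Submodule.span_le.2 ?_) ?_)
    · rintro _ ⟨i, m, hi, rfl⟩
      exact Submodule.subset_span ⟨Sum.inl i, m + 1, by simp [block, hi, KWBlock.extendNilpotent],
        rfl⟩
    · intro x hx
      have h1 := e.sum_repr ⟨x, hx⟩
      have h2 := congrArg E.subtype h1
      rw [map_sum] at h2
      change _ = x at h2
      rw [← h2]
      refine sum_mem fun i _ => ?_
      rw [map_smul]
      exact Submodule.smul_mem _ _ (Submodule.subset_span ⟨Sum.inr ⟨i⟩, 1, rfl, by simp [vec]⟩)
  have hker' : LinearMap.ker a ≤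
      Submodule.span k {x | ∃ i j, j < (block i).length ∧ vec i j = x} := by
    refine hker.trans (Submodule.span_mono ?_)
    rintro _ ⟨i, m, -, rfl⟩
    exact ⟨i, 0, hlen i, rfl⟩
  have hU := finrank_ker_quotKerFst hba
  have hK : Module.finrank k (kerImage a b) + Module.finrank k E = _ :=
    Submodule.finrank_map_add_finrank_inf_ker b (LinearMap.ker a)
  have hnil := Q.sum_nilCount
  refine ⟨{ ι := Q.ι ⊕ ULift.{v} (Fin (Module.finrank k E))
            block := block
            vec := vec
            length_pos := hlen
            isChain := ?_
            top_le_span := ?_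
            sum_length := ?_
            ker_le_span := hker
            sum_nilCount := ?_
            sum_numForms := ?_ }⟩
  · rintro (i | i)
    · exact hy i
    · refine ⟨?_, fun j => ?_, fun j hj => ?_⟩
      · simpa [vec] using (e i.down).2.1
      · by_cases hj : j = 0
        · have : b (e i.down : V) = 0 := (e i.down).2.2
          simp [vec, hj, this]
        · simp [vec, hj]
      · have : j ≠ 0 := by omega
        simp [vec, this]
  · intro x _
    have h1 : (LinearMap.ker a).mkQ x ∈ (Submodule.span k
        {x | ∃ i j, j < (block i).length ∧ vec i j = x}).map (LinearMap.ker a).mkQ := by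
      refine Submodule.span_le.2 ?_ (Q.top_le_span (x := (LinearMap.ker a).mkQ x) trivial)
      rintro _ ⟨i, j, hj, rfl⟩
      obtain ⟨j', hj', h⟩ := hyx i j hj
      exact ⟨y i j', Submodule.subset_span ⟨Sum.inl i, j', hj', rfl⟩, h⟩
    rwa [← Submodule.mem_comap, Submodule.comap_map_mkQ, sup_eq_right.2 hker'] at h1
  · have h1 := Q.sum_length
    have h2 := (LinearMap.ker a).finrank_quotient_add_finrank
    have h3 : ∑ i, (block i).length = ∑ i, (Q.block i).extendNilpotent.length +
      ∑ _i : ULift.{v} (Fin (Module.finrank k E)), 1 := Fintype.sum_sum_type _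
    rw [h3, Finset.sum_congr rfl fun i _ => KWBlock.length_extendNilpotent _,
      Finset.sum_add_distrib, Finset.sum_const, Finset.card_univ, Fintype.card_ulift,
      Fintype.card_fin, smul_eq_mul, mul_one]
    omega
  · have h3 : ∑ i, (block i).nilCount = ∑ i, (Q.block i).extendNilpotent.nilCount +
      ∑ _i : ULift.{v} (Fin (Module.finrank k E)), 1 := Fintype.sum_sum_type _
    rw [h3, Finset.sum_congr rfl fun i _ => KWBlock.nilCount_extendNilpotent _,
      Finset.sum_const, Finset.card_univ, Fintype.card_ulift, Fintype.card_fin, smul_eq_mul,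
      mul_one]
    omega
  · have h1 := Submodule.finrank_map_add_finrank_inf_ker (kerImage a b).mkQ
      (LinearMap.range a ⊔ LinearMap.range b)
    rw [Submodule.ker_mkQ, inf_eq_right.2 (hba.trans le_sup_left), Submodule.map_sup] at h1
    have h3 := Q.sum_numForms
    rw [Submodule.range_mapQ, Submodule.range_mapQ] at h3
    have h4 : ∑ i, (block i).numForms = ∑ i, (Q.block i).extendNilpotent.numForms +
      ∑ _i : ULift.{v} (Fin (Module.finrank k E)), 0 := Fintype.sum_sum_type _
    rw [h4, Finset.sum_congr rfl fun i _ => KWBlock.numForms_extendNilpotent _ (Q.length_pos i),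
      Finset.sum_add_distrib, Finset.sum_const_zero]
    omega

end

/-! ### Passing to the preimage of the range -/

/-- The block obtained from a block by lengthening it if it is a scroll block. -/
def KWBlock.extendScroll {k : Type*} : KWBlock k → KWBlock k
  | nilpotent m => nilpotent m
  | scroll n => scroll (n + 1)
  | jordan p l => jordan p l

namespace KWBlock

variable {k : Type*} {B : KWBlock k}

lemma length_extendScroll (h : B.nilCount = 0) : B.extendScroll.length = B.numForms := by
  cases B with
  | nilpotent m => simp [nilCount] at h
  | scroll n => rfl
  | jordan p l => rfl

lemma nilCount_extendScroll : B.extendScroll.nilCount = B.nilCount := by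
  cases B <;> rfl

lemma numForms_extendScroll (h : B.nilCount = 0) :
    B.extendScroll.numForms + B.length = 2 * B.numForms := by
  cases B with
  | nilpotent m => simp [nilCount] at h
  | scroll n => simp only [extendScroll, numForms, length]; omega
  | jordan p l => simp only [extendScroll, numForms, length]; omega

end KWBlock

section

variable {k V W : Type v} [Field k] [AddCommGroup V] [Module k V] [AddCommGroup W] [Module k W]
  {a b : V →ₗ[k] W}

/-- A scroll chain is prolonged by the image of its last vector under `c`, while the span of a
Jordan chain is already stable under `c`. -/
lemma IsPencilChain.exists_extend {V' : Submodule k V} {c : V' →ₗ[k] V}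
    (hc : ∀ x, a (c x) = b x) {B : KWBlock k} (hB : B.nilCount = 0) {x : ℕ → V'}
    (h : IsPencilChain V'.subtype c B x) :
    ∃ y : ℕ → V, IsPencilChain a b B.extendScroll y ∧ ∀ j < B.length,
      (x j : V) ∈ Submodule.span k {z | ∃ j < B.extendScroll.length, y j = z} ∧
      c (x j) ∈ Submodule.span k {z | ∃ j < B.extendScroll.length, y j = z} := by
  cases B with
  | nilpotent m => simp [KWBlock.nilCount] at hB
  | scroll n =>
    let y : ℕ → V := fun j => Nat.casesOn j (x 0) (fun j => c (x j))
    have hy : ∀ j < n, y j = x j := by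
      rintro (_ | j) hj
      · rfl
      · exact (h j hj).symm
    refine ⟨y, fun j hj => ?_, fun j hj => ⟨?_, ?_⟩⟩
    · rw [hy j (by omega)]
      exact hc _
    · exact Submodule.subset_span ⟨j, Nat.lt_succ_of_lt hj, hy j hj⟩
    · exact Submodule.subset_span ⟨j + 1, Nat.succ_lt_succ hj, rfl⟩
  | jordan p l =>
    obtain ⟨h1, h2⟩ := h
    have hmem : ∀ j, (x j : V) ∈ Submodule.span k
        {z | ∃ j < (KWBlock.jordan p l).extendScroll.length, (x j : V) = z} := by
      intro j
      by_cases hj : j < p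
      · exact Submodule.subset_span ⟨j, hj, rfl⟩
      · rw [h2 j (by omega)]
        exact zero_mem _
    refine ⟨fun j => x j, ⟨fun j => ?_, fun j hj => ?_⟩, fun j hj => ⟨hmem j, ?_⟩⟩
    · rw [← hc, h1, map_add, map_smul]
      rfl
    · exact congrArg V'.subtype (h2 j hj)
    · rw [h1]
      exact add_mem (hmem _) (Submodule.smul_mem _ _ (hmem _))

variable [FiniteDimensional k V]

lemma finrank_range_sup_range_add_finrank_comap (ha : Function.Injective a) :
    Module.finrank k (LinearMap.range a ⊔ LinearMap.range b : Submodule k W) +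
      Module.finrank k ((LinearMap.range a).comap b) = 2 * Module.finrank k V := by
  have h1 := Submodule.finrank_sup_add_finrank_inf_eq (LinearMap.range a) (LinearMap.range b)
  have h2 := Submodule.finrank_map_add_finrank_inf_ker b ((LinearMap.range a).comap b)
  have h3 := LinearMap.finrank_range_add_finrank_ker b
  have h4 : LinearMap.ker b ≤ (LinearMap.range a).comap b := by
    rw [← Submodule.comap_bot]
    exact Submodule.comap_mono bot_le
  rw [Submodule.map_comap_eq, inf_eq_right.2 h4, inf_comm] at h2
  rw [LinearMap.finrank_range_of_inj ha] at h1
  omega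

/-- On `V' = b⁻¹ (range a)` the pencil is replaced by the inclusion into `V` and `c = a⁻¹ b`. Its
chains extend to `V`, and a complement of `V' + c V'` gives scroll chains of length `1`. The
inclusion is injective, so no nilpotent chain occurs. -/
theorem PencilDecomposition.nonempty_of_comap (ha : Function.Injective a)
    {c : (LinearMap.range a).comap b →ₗ[k] V} (hc : ∀ x, a (c x) = b x)
    (Q : PencilDecomposition ((LinearMap.range a).comap b).subtype c) :
    Nonempty (PencilDecomposition a b) := by
  classical
  have hker := LinearMap.ker_eq_bot.2 ha
  have hnil : ∀ i, (Q.block i).nilCount = 0 := by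
    have h := Q.sum_nilCount
    rw [Submodule.ker_subtype, finrank_bot, Finset.sum_eq_zero_iff] at h
    exact fun i => h i (Finset.mem_univ i)
  choose y hy hyx using fun i => (Q.isChain i).exists_extend hc (hnil i)
  obtain ⟨E, hE⟩ := Submodule.exists_isCompl
    (LinearMap.range ((LinearMap.range a).comap b).subtype ⊔ LinearMap.range c)
  let e := Module.finBasis k E
  have hfinE := Submodule.finrank_add_eq_of_isCompl hE
  rw [← Q.sum_numForms] at hfinE
  let block : Q.ι ⊕ ULift.{v} (Fin (Module.finrank k E)) → KWBlock k :=
    Sum.elim (fun i => (Q.block i).extendScroll) (fun _ => .scroll 1)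
  let vec : Q.ι ⊕ ULift.{v} (Fin (Module.finrank k E)) → ℕ → V :=
    Sum.elim y (fun i _ => (e i.down : V))
  have hsum : ∀ f : KWBlock k → ℕ, ∑ i, f (block i) = ∑ i, f (Q.block i).extendScroll +
      Module.finrank k E * f (.scroll 1) := by
    intro f
    rw [Fintype.sum_sum_type]
    simp [block]
  have hnF : ∑ i, (Q.block i).extendScroll.numForms + ∑ i, (Q.block i).length =
      2 * ∑ i, (Q.block i).numForms := by
    rw [← Finset.sum_add_distrib, Finset.mul_sum]
    exact Finset.sum_congr rfl fun i _ => KWBlock.numForms_extendScroll (hnil i)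
  have hle : ∀ i, Submodule.span k {z | ∃ j < (Q.block i).extendScroll.length, y i j = z} ≤
      Submodule.span k {x | ∃ i j, j < (block i).length ∧ vec i j = x} := by
    intro i
    refine Submodule.span_mono ?_
    rintro _ ⟨j, hj, rfl⟩
    exact ⟨Sum.inl i, j, hj, rfl⟩
  refine ⟨{ ι := Q.ι ⊕ ULift.{v} (Fin (Module.finrank k E))
            block := block
            vec := vec
            length_pos := ?_
            isChain := ?_
            top_le_span := ?_
            sum_length := ?_
            ker_le_span := by rw [hker]; exact bot_le
            sum_nilCount := ?_
            sum_numForms := ?_ }⟩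
  · rintro (i | i)
    · have h1 := Q.length_pos i
      have h2 := hnil i
      simp only [block, Sum.elim_inl]
      cases h : Q.block i <;> rw [h] at h1 <;>
        simp only [KWBlock.extendScroll, KWBlock.length] at h1 ⊢ <;> omega
    · exact Nat.one_pos
  · rintro (i | i)
    · exact hy i
    · intro j hj
      omega
  · rw [← hE.sup_eq_top]
    refine sup_le (sup_le ?_ ?_) ?_
    · rw [LinearMap.range_eq_map, Submodule.map_le_iff_le_comap]
      refine Q.top_le_span.trans (Submodule.span_le.2 ?_)
      rintro _ ⟨i, j, hj, rfl⟩
      exact hle i (hyx i j hj).1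
    · rw [LinearMap.range_eq_map, Submodule.map_le_iff_le_comap]
      refine Q.top_le_span.trans (Submodule.span_le.2 ?_)
      rintro _ ⟨i, j, hj, rfl⟩
      exact hle i (hyx i j hj).2
    · intro x hx
      have h2 := congrArg E.subtype (e.sum_repr ⟨x, hx⟩)
      rw [map_sum] at h2
      change _ = x at h2
      rw [← h2]
      refine sum_mem fun i _ => ?_
      rw [map_smul]
      exact Submodule.smul_mem _ _ (Submodule.subset_span ⟨Sum.inr ⟨i⟩, 0, Nat.one_pos, rfl⟩)
  · rw [hsum KWBlock.length, Finset.sum_congr rfl fun i _ => KWBlock.length_extendScroll (hnil i)]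
    simp only [KWBlock.length, mul_one]
    exact hfinE
  · rw [hsum KWBlock.nilCount, hker, finrank_bot, Finset.sum_eq_zero, zero_add]
    · exact mul_zero _
    · intro i _
      rw [KWBlock.nilCount_extendScroll, hnil]
  · have h1 := finrank_range_sup_range_add_finrank_comap (b := b) ha
    have h2 := Q.sum_length
    have h3 : (KWBlock.scroll 1 : KWBlock k).numForms = 2 := rfl
    rw [hsum KWBlock.numForms, h3]
    omega

/-- A pencil `a, b` of linear maps on a finite-dimensional space, in which `a` has maximal rank,
decomposes into chains. -/
theorem nonempty_pencilDecomposition {k : Type v} [Field k] [IsAlgClosed k] (d : ℕ) :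
    ∀ {V W : Type v} [AddCommGroup V] [Module k V] [AddCommGroup W] [Module k W]
      [FiniteDimensional k V] {a b : V →ₗ[k] W} (_ : HasMaximalRank a b)
      (_ : Module.finrank k V = d), Nonempty (PencilDecomposition a b) := by
  induction d using Nat.strong_induction_on with
  | _ d ih =>
  intro V W _ _ _ _ _ a b hab hd
  have : Infinite k := IsAlgClosed.instInfinite
  -- If `a` is not injective, the dimension drops on passing to `V / ker a`; if it is, on passing to
  -- the preimage of its range, unless `b` factors through `a`.
  by_cases hker : LinearMap.ker a = ⊥
  · have ha := LinearMap.ker_eq_bot.1 hker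
    obtain ⟨g, hg⟩ := LinearMap.exists_leftInverse_of_injective a hker
    have hagb : ∀ x ∈ (LinearMap.range a).comap b, a (g (b x)) = b x := by
      rintro x ⟨y, hy⟩
      rw [← hy, ← LinearMap.comp_apply g a, hg, LinearMap.id_apply]
    by_cases htop : (LinearMap.range a).comap b = ⊤
    · exact nonempty_pencilDecomposition_of_comp ha (c := g.comp b)
        fun x => hagb x (by rw [htop]; trivial)
    · obtain ⟨Q⟩ := ih _ (hd ▸ Submodule.finrank_lt htop)
        (hasMaximalRank_of_injective (Submodule.injective_subtype _)
          ((g.comp b).comp ((LinearMap.range a).comap b).subtype)) rfl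
      exact Q.nonempty_of_comap ha fun x => hagb x x.2
  · have hba := hab.map_ker_le_range
    have h1 := (LinearMap.ker a).finrank_quotient_add_finrank
    have h2 : 0 < Module.finrank k (LinearMap.ker a) :=
      Nat.pos_of_ne_zero fun h => hker (Submodule.finrank_eq_zero.1 h)
    obtain ⟨Q⟩ := ih _ (by omega) (hab.quotKer hba) rfl
    exact Q.nonempty_of_quotKer hba

end

/-! ### Existence of Kronecker–Weierstrass normal forms -/

/-- The linear forms in the block that corresponds to a chain. -/
def KWBlock.chainForm {k V W : Type*} [Field k] [AddCommGroup V] [Module k V] [AddCommGroup W]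
    [Module k W] (a b : V →ₗ[k] W) : KWBlock k → (ℕ → V) → ℕ → W
  | nilpotent _, v, t => b (v t)
  | scroll n, v, t => if t < n then a (v t) else b (v (n - 1))
  | jordan _ _, v, t => a (v t)

section

variable {k V : Type v} [Field k] [AddCommGroup V] [Module k V] {N e : ℕ}

lemma IsPencilChain.matrix_chainForm {a b : V →ₗ[k] MvPolynomial (Fin N) k} {B : KWBlock k}
    {v : ℕ → V} (h : IsPencilChain a b B v) (j : Fin B.length) :
    B.matrix (fun t => B.chainForm a b v t) 0 j = a (v j) ∧
      B.matrix (fun t => B.chainForm a b v t) 1 j = b (v j) := by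
  obtain ⟨j, hj⟩ := j
  cases B with
  | nilpotent m =>
    obtain ⟨h0, h1, h2⟩ := h
    simp only [KWBlock.length] at hj
    refine ⟨?_, ?_⟩
    · rw [(KWBlock.matrix_of_isNilpotentBlock ⟨m, rfl⟩ _ _).1]
      rcases j with _ | j
      · exact h0.symm
      · rw [if_neg (Nat.succ_ne_zero j), KWBlock.extendZero_of_lt _
          (by simp only [KWBlock.numForms]; omega)]
        exact (h1 j).symm
    · rw [(KWBlock.matrix_of_isNilpotentBlock ⟨m, rfl⟩ _ _).2]
      by_cases hjm : j < m - 1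
      · exact KWBlock.extendZero_of_lt _ hjm
      · rw [KWBlock.extendZero_of_le _ (by simp only [KWBlock.numForms]; omega), ← h1,
          h2 _ (by simp only; omega), map_zero]
  | scroll n =>
    simp only [KWBlock.length] at hj
    refine ⟨?_, ?_⟩
    · rw [(KWBlock.matrix_of_isScrollBlock ⟨n, rfl⟩ _ _).1, KWBlock.extendZero_of_lt _
        (by simp only [KWBlock.numForms]; omega)]
      exact if_pos hj
    · rw [(KWBlock.matrix_of_isScrollBlock ⟨n, rfl⟩ _ _).2, KWBlock.extendZero_of_lt _
        (by simp only [KWBlock.numForms]; omega)]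
      by_cases hjn : j + 1 < n
      · exact (if_pos hjn).trans (h j hjn)
      · refine (if_neg hjn).trans ?_
        rw [show n - 1 = j by omega]
  | jordan p l =>
    obtain ⟨h1, h2⟩ := h
    have hext : ∀ t, KWBlock.extendZero (fun t : Fin (KWBlock.jordan p l).numForms =>
        (KWBlock.jordan p l).chainForm a b v t) t = a (v t) := by
      intro t
      by_cases ht : t < p
      · exact KWBlock.extendZero_of_lt _ ht
      · rw [KWBlock.extendZero_of_le _ (by simp only [KWBlock.numForms]; omega), h2 _ (by omega),
          map_zero]
    refine ⟨?_, ?_⟩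
    · rw [(KWBlock.matrix_of_isJordanBlock ⟨p, l, rfl⟩ _ _).1, hext]
    · rw [(KWBlock.matrix_of_isJordanBlock ⟨p, l, rfl⟩ _ _).2, hext, hext, h1]
      rfl

lemma KWBlock.matrix_mem_span {B : KWBlock k} (w : Fin B.numForms → MvPolynomial (Fin N) k)
    (r : Fin 2) (j : Fin B.length) : B.matrix w r j ∈ Submodule.span k (Set.range w) := by
  have hext : ∀ t, extendZero w t ∈ Submodule.span k (Set.range w) := by
    intro t
    by_cases ht : t < B.numForms
    · rw [extendZero_of_lt _ ht]
      exact Submodule.subset_span ⟨_, rfl⟩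
    · rw [extendZero_of_le _ (by omega)]
      exact zero_mem _
  rcases B.block_cases with h | h | h
  · obtain ⟨h0, h1⟩ := matrix_of_isNilpotentBlock h w j
    fin_cases r
    · refine (congrArg (· ∈ _) h0).mpr ?_
      split_ifs
      · exact zero_mem _
      · exact hext _
    · exact (congrArg (· ∈ _) h1).mpr (hext _)
  · obtain ⟨h0, h1⟩ := matrix_of_isScrollBlock h w j
    fin_cases r
    · exact (congrArg (· ∈ _) h0).mpr (hext _)
    · exact (congrArg (· ∈ _) h1).mpr (hext _)
  · obtain ⟨h0, h1⟩ := matrix_of_isJordanBlock h w j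
    fin_cases r
    · exact (congrArg (· ∈ _) h0).mpr (hext _)
    · exact (congrArg (· ∈ _) h1).mpr (add_mem (hext _) (Submodule.smul_mem _ _ (hext _)))

variable {X : Matrix (Fin 2) (Fin e) (MvPolynomial (Fin N) k)}

lemma isHomogeneous_linearCombination {Y : Fin e → MvPolynomial (Fin N) k}
    (hY : ∀ j, (Y j).IsHomogeneous 1) (x : Fin e → k) :
    (Fintype.linearCombination k Y x).IsHomogeneous 1 := by
  rw [Fintype.linearCombination_apply, ← mem_homogeneousSubmodule]
  exact sum_mem fun j _ => Submodule.smul_mem _ _ ((mem_homogeneousSubmodule _ _).2 (hY j))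

/-- The chain vectors span and are as many as the dimension, so they form an invertible column
change. The forms span the sum of the two ranges and are as many as its dimension, so they are
independent. -/
theorem PencilDecomposition.nonempty_normalForm (P : GL (Fin 2) k)
    {Y : Matrix (Fin 2) (Fin e) (MvPolynomial (Fin N) k)}
    (hY : (P : Matrix (Fin 2) (Fin 2) k).map (C : k →+* MvPolynomial (Fin N) k) * X = Y)
    (hYhom : ∀ r j, (Y r j).IsHomogeneous 1)
    (Q : PencilDecomposition (Fintype.linearCombination k (Y 0))
      (Fintype.linearCombination k (Y 1))) :
    Nonempty (KWNormalForm X) := by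
  classical
  let φ : Fin (Fintype.card Q.ι) ≃ Q.ι := (Fintype.equivFin Q.ι).symm
  let block : Fin (Fintype.card Q.ι) → KWBlock k := fun i => Q.block (φ i)
  let w : (Σ i, Fin (block i).length) → (Fin e → k) := fun s => Q.vec (φ s.1) s.2
  let form : (i : Fin (Fintype.card Q.ι)) → Fin (block i).numForms → MvPolynomial (Fin N) k :=
    fun i t => (block i).chainForm (Fintype.linearCombination k (Y 0))
      (Fintype.linearCombination k (Y 1)) (Q.vec (φ i)) t
  have hcard : Fintype.card (Σ i, Fin (block i).length) = Module.finrank k (Fin e → k) := by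
    rw [Fintype.card_sigma, ← Q.sum_length, ← Equiv.sum_comp φ]
    simp [block]
  have hwspan : ⊤ ≤ Submodule.span k (Set.range w) := by
    refine Q.top_le_span.trans (Submodule.span_mono ?_)
    rintro _ ⟨i, j, hj, rfl⟩
    obtain ⟨i, rfl⟩ := φ.surjective i
    exact ⟨⟨i, j, hj⟩, rfl⟩
  have hwli : LinearIndependent k w :=
    linearIndependent_of_top_le_span_of_card_eq_finrank hwspan hcard
  let column : Fin e ≃ Σ i, Fin (block i).length :=
    Fintype.equivOfCardEq (by rw [hcard, Module.finrank_fin_fun, Fintype.card_fin])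
  let M : Matrix (Fin e) (Fin e) k := Matrix.of fun j l => w (column l) j
  have hM : IsUnit M := by
    rw [← Matrix.linearIndependent_cols_iff_isUnit]
    exact hwli.comp column column.injective
  have hmat : ∀ (s : Σ i, Fin (block i).length) r,
      (block s.1).matrix (form s.1) r s.2 = Fintype.linearCombination k (Y r) (w s) := by
    intro s r
    obtain ⟨h0, h1⟩ := (Q.isChain (φ s.1)).matrix_chainForm s.2
    fin_cases r
    · exact h0
    · exact h1
  have hYM : ∀ r l, (Y * M.map (C : k →+* MvPolynomial (Fin N) k)) r l =
      Fintype.linearCombination k (Y r) (w (column l)) := by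
    intro r l
    rw [Fintype.linearCombination_apply, Matrix.mul_apply]
    exact Finset.sum_congr rfl fun j _ => by
      rw [Matrix.map_apply, mul_comm, ← smul_eq_C_mul]
      rfl
  refine ⟨{ numBlocks := Fintype.card Q.ι
            block := block
            length_pos := fun i => Q.length_pos _
            form := form
            form_linear := ?_
            form_independent := ?_
            column := column
            rowChange := P
            colChange := hM.unit
            eq_concatenation := ?_ }⟩
  · have h := fun r => isHomogeneous_linearCombination (hYhom r)
    have hB : ∀ (B : KWBlock k) (u : ℕ → Fin e → k) (t : ℕ),
        (B.chainForm (Fintype.linearCombination k (Y 0)) (Fintype.linearCombination k (Y 1))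
          u t).IsHomogeneous 1 := by
      rintro (m | n | p) u t
      · exact h _ _
      · simp only [KWBlock.chainForm]
        split_ifs <;> exact h _ _
      · exact h _ _
    exact fun i t => hB _ _ _
  · rw [linearIndependent_iff_card_le_finrank_span]
    have hle : LinearMap.range (Fintype.linearCombination k (Y 0)) ⊔
        LinearMap.range (Fintype.linearCombination k (Y 1)) ≤
        Submodule.span k (Set.range fun s : Σ i, Fin (block i).numForms => form s.1 s.2) := by
      have key : ∀ r, LinearMap.range (Fintype.linearCombination k (Y r)) ≤
          Submodule.span k (Set.range fun s : Σ i, Fin (block i).numForms => form s.1 s.2) := by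
        intro r
        rw [LinearMap.range_eq_map, Submodule.map_le_iff_le_comap]
        refine hwspan.trans (Submodule.span_le.2 ?_)
        rintro _ ⟨s, rfl⟩
        rw [SetLike.mem_coe, Submodule.mem_comap, ← hmat]
        refine Submodule.span_mono ?_ (KWBlock.matrix_mem_span _ r s.2)
        rintro _ ⟨t, rfl⟩
        exact ⟨⟨s.1, t⟩, rfl⟩
      exact sup_le (key 0) (key 1)
    have : FiniteDimensional k
        (Submodule.span k (Set.range fun s : Σ i, Fin (block i).numForms => form s.1 s.2)) :=
      FiniteDimensional.span_of_finite k (Set.finite_range _)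
    have h1 := Submodule.finrank_mono hle
    rw [← Q.sum_numForms, ← Equiv.sum_comp φ] at h1
    rw [Fintype.card_sigma, Set.finrank]
    simpa [block] using h1
  · ext1 r l
    rw [IsUnit.unit_spec, hY, hYM, Matrix.of_apply, hmat]

/-- The ranks are bounded by the dimension of `V`. A maximizing pair becomes the first row of the
row change. -/
lemma exists_maximal_rank {a b : V →ₗ[k] MvPolynomial (Fin N) k} [FiniteDimensional k V] :
    ∃ x y : k, (x ≠ 0 ∨ y ≠ 0) ∧ ∀ x' y' : k, (x' ≠ 0 ∨ y' ≠ 0) →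
      Module.finrank k (LinearMap.range (x' • a + y' • b)) ≤
        Module.finrank k (LinearMap.range (x • a + y • b)) := by
  let S : Set ℕ := {d | ∃ x y : k, (x ≠ 0 ∨ y ≠ 0) ∧
    Module.finrank k (LinearMap.range (x • a + y • b)) = d}
  have hS : BddAbove S := ⟨Module.finrank k V, by
    rintro _ ⟨x, y, -, rfl⟩
    exact LinearMap.finrank_range_le _⟩
  obtain ⟨x, y, hxy, h⟩ := Nat.sSup_mem (s := S) ⟨_, 1, 0, Or.inl one_ne_zero, rfl⟩ hS
  exact ⟨x, y, hxy, fun x' y' h' => h ▸ le_csSup hS ⟨x', y', h', rfl⟩⟩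

/-- Every `2 × e` matrix of linear forms over an algebraically closed field has a
Kronecker–Weierstrass normal form. -/
theorem nonempty_normalForm [IsAlgClosed k] (hX : ∀ i j, (X i j).IsHomogeneous 1) :
    Nonempty (KWNormalForm X) := by
  obtain ⟨x, y, hxy, hmax⟩ := exists_maximal_rank (a := Fintype.linearCombination k (X 0))
    (b := Fintype.linearCombination k (X 1))
  have main : ∀ P : GL (Fin 2) k, (P : Matrix (Fin 2) (Fin 2) k) 0 = ![x, y] →
      Nonempty (KWNormalForm X) := by
    intro P hP
    obtain ⟨Y, hY⟩ : ∃ Y, (P : Matrix (Fin 2) (Fin 2) k).map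
      (C : k →+* MvPolynomial (Fin N) k) * X = Y := ⟨_, rfl⟩
    have hYr : ∀ r j, Y r j = P r 0 • X 0 j + P r 1 • X 1 j := by
      intro r j
      rw [← hY, Matrix.mul_apply, Fin.sum_univ_two, Matrix.map_apply, Matrix.map_apply,
        smul_eq_C_mul, smul_eq_C_mul]
    have hYhom : ∀ r j, (Y r j).IsHomogeneous 1 := by
      intro r j
      rw [hYr, ← mem_homogeneousSubmodule]
      exact add_mem (Submodule.smul_mem _ _ ((mem_homogeneousSubmodule _ _).2 (hX 0 j)))
        (Submodule.smul_mem _ _ ((mem_homogeneousSubmodule _ _).2 (hX 1 j)))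
    have hlc : ∀ r, Fintype.linearCombination k (Y r) =
        P r 0 • Fintype.linearCombination k (X 0) + P r 1 • Fintype.linearCombination k (X 1) := by
      intro r
      refine LinearMap.ext fun z => ?_
      simp only [LinearMap.add_apply, LinearMap.smul_apply, Fintype.linearCombination_apply, hYr,
        Finset.smul_sum, ← Finset.sum_add_distrib, smul_add, smul_smul]
      exact Finset.sum_congr rfl fun j _ => by rw [mul_comm (z j), mul_comm (z j)]
    have h0 : P 0 0 = x := congrFun hP 0
    have h1 : P 0 1 = y := congrFun hP 1
    have hdet : x * P 1 1 - y * P 1 0 ≠ 0 := by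
      have h := P.det.ne_zero
      rwa [Matrix.GeneralLinearGroup.val_det_apply, Matrix.det_fin_two, h0, h1] at h
    have hmaxrank : HasMaximalRank (Fintype.linearCombination k (Y 0))
        (Fintype.linearCombination k (Y 1)) := by
      intro t
      rw [hlc, hlc, h0, h1, smul_add, smul_smul, smul_smul, add_add_add_comm, ← add_smul,
        ← add_smul]
      refine hmax _ _ ?_
      -- If both coefficients vanished, the rows of `P` would be dependent.
      by_contra! hcon
      apply hdet
      rw [eq_neg_of_add_eq_zero_left hcon.1, eq_neg_of_add_eq_zero_left hcon.2]
      ring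
    obtain ⟨Q⟩ := nonempty_pencilDecomposition _ hmaxrank rfl
    exact Q.nonempty_normalForm P hY hYhom
  by_cases hx : x = 0
  · have hy : y ≠ 0 := hxy.resolve_left fun h => h hx
    exact main (Matrix.GeneralLinearGroup.mkOfDetNeZero !![x, y; 1, 0]
      (by simpa [Matrix.det_fin_two] using hy)) rfl
  · exact main (Matrix.GeneralLinearGroup.mkOfDetNeZero !![x, y; 0, 1]
      (by simpa [Matrix.det_fin_two] using hx)) rfl

end

theorem theorem1p1 {k : Type*} [Field k] [IsAlgClosed k] [CharZero k] {N e : ℕ}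
    (X : Matrix (Fin 2) (Fin e) (MvPolynomial (Fin N) k))
    (hX : ∀ i j, (X i j).IsHomogeneous 1) :
    Nonempty (KWNormalForm X) ∧
      ∀ F : KWNormalForm X,
        IsKoszulAlgebra (determinantalGrading X) ↔ F.LengthCondition := by
  exact ⟨nonempty_normalForm hX, fun F => F.isKoszulAlgebra_iff_lengthCondition hX⟩
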